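/- Let $n\ge 3$, $\Lambda>0$, and let $p_1,\dots,p_n$ be (complex) momenta in a Minkowski space of arbitrary dimension with $\sum_i p_i=0$ and $p_i^2=0$. Fix distinct $z_1,z_2,z_3\in\mathbb C$ and use $z_4,\dots,z_n$ as coordinates on $\mathcal M_{0,n}$. Put $\omega=\Lambda^{-2}\sum_{1\le i<j\le n}2p_i\cdot p_j\,d\log(z_i-z_j)$ and $\nabla_\omega=d+\omega\wedge$. For $3\le p\le n$ let $\mathcal F_{n,p}$ be the fibre, with coordinates $z_{p+1},\dots,z_n$, of $\mathcal M_{0,n}\to\mathcal M_{0,p}$, and let $\mathbf F_p^+$ be the vector of forms (the fibration basis) $$(\mathbf F_p^+)_w=\bigwedge_{l=p+1}^n\Big(\frac{dz_l}{z_l-z_{w(l)}}-\frac{dz_l}{z_l-z_1}\Big),$$ indexed by the words $w=w(p+1)\cdots w(n)$ with $w(l)\in\{3,\dots,l-1\}$. A word on $\mathcal F_{n,p-1}$ is written $qQ$ with $q\in\{3,\dots,p-1\}$ and $Q$ a word on $\mathcal F_{n,p}$. Correspondingly, a matrix $M$ indexed by words on $\mathcal F_{n,p-1}$ has blocks $(M)_{qr}$,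 which are matrices indexed by words on $\mathcal F_{n,p}$. *Braid matrices at level $p$* are constant complex matrices $\mathbf\Omega_p^{ij}$ ($1\le i,j\le p$), indexed by words on $\mathcal F_{n,p}$, with $$\mathbf\Omega_p^{ij}=\mathbf\Omega_p^{ji},\qquad \mathbf\Omega_p^{ii}=0,\qquad \sum_{j=1}^p\mathbf\Omega_p^{ij}=0, \tag{1}$$ such that $d\mathbf F_p^+=\widetilde{\boldsymbol\omega}_p^+\wedge\mathbf F_p^+$ with $\widetilde{\boldsymbol\omega}_p^+=\Lambda^{-2}\sum_{1\le i<j\le p}\mathbf\Omega_p^{ij}\,d\log(z_i-z_j)$ holds, for forms with local coefficients, modulo twisted-exact forms on the fibre. That is, for each $i=4,\dots,p$ the relative top form $$\Big(\frac{\partial}{\partial z_i}+\omega_i\Big)\mathbf F_p^+-\frac1{\Lambda^2}\sum_{j\le p,\,j\ne i}\frac{\mathbf\Omega_p^{ij}\,\mathbf F_p^+}{z_i-z_j},\qquad \omega_i=\frac1{\Lambda^2}\sum_{j\le n,\,j\neq i}\frac{2p_i\cdot p_j}{z_i-z_j},$$ multiplied by $dz_i$, is $\nabla_\omega$-exact along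 $\mathcal F_{n,p}$. Here primitives are rational forms with poles only along $z_a=z_b$, $1\le a<b\le n$, and in particular without poles at infinity. Then: 1. For every $3\le p\le n$ braid matrices at level $p$ exist. 2. Matrices $\mathbf\Omega_n^{ij}$ are braid matrices at level $n$ if and only if $\mathbf\Omega_n^{ij}=(p_i+p_j)^2$ for all $1\le i,j\le n$. 3. Let $4\le p\le n$ and let $\mathbf\Omega_p^{k\ell}$ be braid matrices at level $p$. Consider, for $i=4,\dots,p-1$, $j=1,\dots,p-1$, $i\ne j$, and $q,r=3,\dots,p-1$, the recursion $$(\mathbf\Omega_{p-1}^{ij})_{qr}=\begin{cases} \mathbf\Omega_p^{ij}&q=r,\ q\ne i,j,\\ \mathbf\Omega_p^{pj}+\mathbf\Omega_p^{qj}&q=r=i,\ j\ne1,2,\\ \mathbf\Omega_p^{pj}+\mathbf\Omega_p^{qj}+\mathbf\Omega_p^{pq}&q=r=i,\ j=1,2,\\ \mathbf\Omega_p^{ip}+\mathbf\Omega_p^{iq}&q=r=j,\\ -\mathbf\Omega_p^{pj}&q=i,\ r=j,\\ -\mathbf\Omega_p^{ip}&q=j,\ r=i,\\ \mathbf\Omega_p^{ip}&j=1,\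 r=i,\ q\ne i,\\ \mathbf\Omega_p^{pr}&j=2,\ q=i,\ r\ne i,\\ 0&\text{otherwise.}\end{cases}$$ If matrices $\mathbf\Omega_{p-1}^{ij}$ have the properties (1) at level $p-1$ and satisfy the recursion, then they are braid matrices at level $p-1$. Conversely, if the kinematics is generic, meaning that $\big(\sum_{a\in A}p_a\big)^2\notin\Lambda^2\mathbb Z$ for all $A\subset\{1,\dots,n\}$ with $2\le|A|\le n-2$, then all braid matrices at level $p-1$ satisfy the recursion. -/

import Mathlib

open scoped BigOperators

noncomputable section

namespace BraidMatrices

/-! ### Kinematics -/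

/-- The Minkowski product `p · q` on `(D+1)`-dimensional space-time, mostly-plus signature.
Components are allowed to be complex; real Lorentz vectors are a special case. -/
def mdot {D : ℕ} (u v : Fin (D + 1) → ℂ) : ℂ :=
  -(u 0 * v 0) + ∑ μ : Fin D, u μ.succ * v μ.succ

/-- `s_A = (∑_{i ∈ A} p_i)²`. -/
def invariantOf {D : ℕ} (k : ℕ → Fin (D + 1) → ℂ) (A : Finset ℕ) : ℂ :=
  mdot (∑ i ∈ A, k i) (∑ i ∈ A, k i)

/-- `(p_i + p_j)²`. -/
def sInv {D : ℕ} (k : ℕ → Fin (D + 1) → ℂ) (i j : ℕ) : ℂ :=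
  mdot (k i + k j) (k i + k j)

/-- Generic (non-resonant) kinematics: no factorization channel `s_A`, `2 ≤ |A| ≤ n - 2`, is an
integer multiple of `Λ²`. -/
def NonResonant {D : ℕ} (n : ℕ) (Λ : ℝ) (k : ℕ → Fin (D + 1) → ℂ) : Prop :=
  ∀ A : Finset ℕ, A ⊆ Finset.Icc 1 n → 2 ≤ A.card → A.card + 2 ≤ n →
    ∀ m : ℤ, invariantOf k A ≠ (m : ℂ) * (Λ : ℂ) ^ 2

/-! ### The moduli space and rational forms on it -/

/-- The points of `M_{0,n}` with all punctures at finite distance, the first three punctures being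
fixed at `c₁, c₂, c₃`. A point is given by `z 1, …, z n`; the other values of `z` play no role. -/
def config (n : ℕ) (c₁ c₂ c₃ : ℂ) : Set (ℕ → ℂ) :=
  {z | z 1 = c₁ ∧ z 2 = c₂ ∧ z 3 = c₃ ∧ Set.InjOn z (Set.Icc 1 n)}

/-- The partial derivative `∂f/∂z_i`. -/
def pderivAt (i : ℕ) (f : (ℕ → ℂ) → ℂ) (z : ℕ → ℂ) : ℂ :=
  deriv (fun t => f (Function.update z i t)) (z i)

/-- The component of `dz_i` in `ω = Λ⁻² ∑_{1 ≤ i < j ≤ n} 2 p_i · p_j dlog (z_i - z_j)`. -/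
def omegaComp {D : ℕ} (n : ℕ) (Λ : ℝ) (k : ℕ → Fin (D + 1) → ℂ) (i : ℕ) (z : ℕ → ℂ) : ℂ :=
  (1 / (Λ : ℂ) ^ 2) * ∑ j ∈ (Finset.Icc 1 n).erase i, 2 * mdot (k i) (k j) / (z i - z j)

/-- The component of `dz_i ∧` in the twisted differential `∇_ω = d + ω ∧`. -/
def twistedD {D : ℕ} (n : ℕ) (Λ : ℝ) (k : ℕ → Fin (D + 1) → ℂ) (i : ℕ)
    (f : (ℕ → ℂ) → ℂ) (z : ℕ → ℂ) : ℂ :=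
  pderivAt i f z + omegaComp n Λ k i z * f z

/-- `f ⋀_{l ∈ S} dz_l` is a rational form on `M_{0,n}` with poles only where punctures collide:
`f` is a polynomial in `z_4, …, z_n` divided by a power of `∏_{i<j} (z_i - z_j)`, and there is no
pole at `z_l = ∞`, which means that `f = O(z_l⁻²)` if `dz_l` occurs in the form, and `f = O(1)`
otherwise (the product has degree `n - 1` in each `z_l`). -/
def IsRegularForm (n : ℕ) (c₁ c₂ c₃ : ℂ) (S : Finset ℕ) (f : (ℕ → ℂ) → ℂ) : Prop :=
  ∃ (m : ℕ) (P : MvPolynomial ℕ ℂ),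
    P.vars ⊆ Finset.Icc 4 n ∧
    (∀ l ∈ Finset.Icc 4 n, P.degreeOf l + (if l ∈ S then 2 else 0) ≤ m * (n - 1)) ∧
    ∀ z ∈ config n c₁ c₂ c₃,
      f z = MvPolynomial.eval z P /
        (∏ i ∈ Finset.Icc 1 n, ∏ j ∈ Finset.Ioc i n, (z i - z j)) ^ m

/-- `f dz_i ∧ (dz_{p+1} ∧ ⋯ ∧ dz_n)`, a one-form on the base `M_{0,p}` with values in top forms on
the fibre `F_{n,p}` (with coordinates `z_{p+1}, …, z_n`), is twisted-exact along the fibre: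
`f = ∑_{l = p+1}^{n} (∂_l + ω_l) g_l`, where `g_l` is the coefficient of a regular form that contains
`dz_i` and all of `dz_{p+1}, …, dz_n` except `dz_l` (the signs are absorbed in the `g_l`). -/
def FibreExact {D : ℕ} (n : ℕ) (Λ : ℝ) (k : ℕ → Fin (D + 1) → ℂ) (c₁ c₂ c₃ : ℂ) (p i : ℕ)
    (f : (ℕ → ℂ) → ℂ) : Prop :=
  ∃ g : ℕ → (ℕ → ℂ) → ℂ,
    (∀ l ∈ Finset.Ioc p n,
      IsRegularForm n c₁ c₂ c₃ (insert i ((Finset.Ioc p n).erase l)) (g l)) ∧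
    ∀ z ∈ config n c₁ c₂ c₃,
      f z = ∑ l ∈ Finset.Ioc p n, twistedD n Λ k l (g l) z

/-! ### The fibration basis -/

/-- Words `w(p+1) w(p+2) … w(n)` with `w(l) ∈ {3, …, l - 1}`; they index the
`(n-3)!/(p-3)!` elements of the fibration basis on `F_{n,p}`. -/
abbrev Word (n p : ℕ) : Type :=
  (l : ↥(Finset.Ioc p n)) → ↥(Finset.Ico 3 (l : ℕ))

/-- The first letter `q` of a word `qQ` on `F_{n,p}`. -/
def Word.head {n p : ℕ} (hp : p < n) (w : Word n p) : ℕ :=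
  (w ⟨p + 1, Finset.mem_Ioc.2 ⟨Nat.lt_succ_self p, hp⟩⟩ : ℕ)

/-- The remaining word `Q` on `F_{n,p+1}` of a word `qQ` on `F_{n,p}`. -/
def Word.tail {n p : ℕ} (w : Word n p) : Word n (p + 1) :=
  fun l => w ⟨l.1, Finset.mem_Ioc.2
    ⟨lt_trans (Nat.lt_succ_self p) (Finset.mem_Ioc.1 l.2).1, (Finset.mem_Ioc.1 l.2).2⟩⟩

/-- The fibration basis `F⁺_p`: the coefficient of `dz_{p+1} ∧ ⋯ ∧ dz_n` in
`⋀_{l=p+1}^{n} (dz_l / (z_l - z_{w(l)}) - dz_l / (z_l - z_1))`. -/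
def fibrationBasis (n p : ℕ) (w : Word n p) (z : ℕ → ℂ) : ℂ :=
  ∏ l : ↥(Finset.Ioc p n), (1 / (z l - z (w l)) - 1 / (z l - z 1))

/-! ### Braid matrices -/

/-- A collection of matrices `Ω^{ij}_p`, `1 ≤ i, j ≤ p` (values at other indices play no role). -/
abbrev MatrixFamily (n p : ℕ) : Type :=
  ℕ → ℕ → Matrix (Word n p) (Word n p) ℂ

/-- The general form of `ω̃_p = Λ⁻² ∑_{1 ≤ i < j ≤ p} Ω^{ij}_p dlog (z_i - z_j)`: the constant
matrices are symmetric in `i, j`, vanish for `i = j`, and `ω̃_p` has no poles at infinity. -/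
structure IsAnsatz (n p : ℕ) (Ω : MatrixFamily n p) : Prop where
  symm : ∀ i ∈ Finset.Icc 1 p, ∀ j ∈ Finset.Icc 1 p, Ω i j = Ω j i
  diag : ∀ i ∈ Finset.Icc 1 p, Ω i i = 0
  sum_eq_zero : ∀ i ∈ Finset.Icc 1 p, ∑ j ∈ Finset.Icc 1 p, Ω i j = 0

/-- `dF⁺_p = ω̃_p ∧ F⁺_p` for the fibration basis with local coefficients (so that `∂_i` acts as
`∂_i + ω_i`), in the twisted cohomology of the fibre `F_{n,p}`: for all `i = 4, …, p` (recall
`dz_1 = dz_2 = dz_3 = 0`) the `dz_i` components agree modulo twisted-exact forms. -/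
def SolvesGaussManin {D : ℕ} (n : ℕ) (Λ : ℝ) (k : ℕ → Fin (D + 1) → ℂ) (c₁ c₂ c₃ : ℂ) (p : ℕ)
    (Ω : MatrixFamily n p) : Prop :=
  ∀ i ∈ Finset.Icc 4 p, ∀ a : Word n p,
    FibreExact n Λ k c₁ c₂ c₃ p i fun z =>
      twistedD n Λ k i (fibrationBasis n p a) z -
        (1 / (Λ : ℂ) ^ 2) * ∑ j ∈ (Finset.Icc 1 p).erase i,
          (∑ b : Word n p, Ω i j a b * fibrationBasis n p b z) / (z i - z j)

/-- `Ω^{ij}_p` are braid matrices in the fibration basis. -/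
structure IsBraidFamily {D : ℕ} (n : ℕ) (Λ : ℝ) (k : ℕ → Fin (D + 1) → ℂ) (c₁ c₂ c₃ : ℂ) (p : ℕ)
    (Ω : MatrixFamily n p) : Prop where
  ansatz : IsAnsatz n p Ω
  gaussManin : SolvesGaussManin n Λ k c₁ c₂ c₃ p Ω

/-- The block `(q, r)` that the recursion prescribes for `Ω^{ij}_p`, in terms of the matrices
`Ω^{kℓ}_{p+1}`. -/
def recursionBlock (n p : ℕ) (Ω : MatrixFamily n (p + 1)) (i j q r : ℕ) :
    Matrix (Word n (p + 1)) (Word n (p + 1)) ℂ :=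
  if q = r ∧ q ≠ i ∧ q ≠ j then Ω i j
  else if q = r ∧ r = i ∧ j ≠ 1 ∧ j ≠ 2 then Ω (p + 1) j + Ω q j
  else if q = r ∧ r = i ∧ (j = 1 ∨ j = 2) then Ω (p + 1) j + Ω q j + Ω (p + 1) q
  else if q = r ∧ r = j then Ω i (p + 1) + Ω i q
  else if q = i ∧ r = j then -Ω (p + 1) j
  else if q = j ∧ r = i then -Ω i (p + 1)
  else if j = 1 ∧ r = i ∧ q ≠ i then Ω i (p + 1)
  else if j = 2 ∧ q = i ∧ r ≠ i then Ω (p + 1) r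
  else 0

/-- `Ω_p` arises from `Ω_{p+1}` by the recursion, for `4 ≤ i ≤ p` and `1 ≤ j ≤ p`, `i ≠ j`. -/
def SatisfiesRecursion (n p : ℕ) (hp : p < n) (Ωnext : MatrixFamily n (p + 1))
    (Ω : MatrixFamily n p) : Prop :=
  ∀ i ∈ Finset.Icc 4 p, ∀ j ∈ Finset.Icc 1 p, i ≠ j → ∀ a b : Word n p,
    Ω i j a b = recursionBlock n p Ωnext i j (a.head hp) (b.head hp) a.tail b.tail

end BraidMatrices

end

/-! The coordinates `y_l = 1 / (z_l - z_1)` move the puncture `z_1` to infinity. In these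
coordinates the coefficients of the forms without poles at `z_l = ∞` make up the ring `RegRing`
generated by the `y_l` and the `1 / (y_i - y_j)`, momentum conservation makes `∇_ω` the twisted
derivative `covD`, which does not see `z_1` any more, and the fibration basis becomes `⋀_l dy_l /
(y_l - y_{w(l)})`. The condition on braid matrices turns into the Gauss-Manin equation `SolvesGMY`
(`solvesGaussManin_iff`).

The recursion preserves solutions of this equation (`SolvesGMY.recursion`). The basis form for the
word `qQ` is `F_Q dy_{p+1} / (y_{p+1} - y_q)` with the basis form `F_Q` of the smaller fibre, so the
derivatives of `F_Q` are known; partial fractions bring the result to the required form, up to total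
derivatives with respect to `y_{p+1}` of explicit functions. Since the matrices `(p_i + p_j)²` solve
the equation for `p = n`, where the fibre is a point, this also proves existence
(`exists_solution`).

For generic kinematics, solutions are unique because the fibration basis is independent in twisted
cohomology. By downward induction on `p` it is a basis (`BasisSpans.step`, `BasisIndependent.step`):
the twisted cohomology of the fibre `F_{n,p}` is the first cohomology of the Fuchsian system in the
single variable `y_{p+1}` that the Gauss-Manin connection of `F_{n,p+1}` defines, with the
transposed braid matrices `Ω^{p+1,j}` as residues. If these residues have no eigenvalues that are
integers (in units of `Λ²`), then every vector of functions can be reduced to the forms `dy_{p+1} /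
(y_{p+1} - y_q)` with `q = 3, …, p` in a unique way (`exists_reduction`, `eq_zero_of_fuchs_eq`).

The eigenvalues are controlled by a stronger property, `HasNonResonantResidues`: for each set `I` of
punctures with at most one of `1, 2, 3`, the residue `∑_{i,j ∈ I} Ω^{ij}` along the divisor on which
the punctures in `I` collide has no eigenvalue in `Λ² ℤ`. The recursion is triangular in the sense
that the eigenvalues for `I` come from those for `I` and for `I ∪ {p+1}` one level up
(`HasNonResonantResidues.recursion`), and for `p = n` the residue is the number `s_I`
(`sum_pairs_eq_invariantOf`), to which the genericity assumption applies.

Finally, independence of the basis means that the difference of two solutions is zero as a matrix of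
combinations of the functions `1 / (y_i - y_j)` with constant coefficients, and these functions are
linearly independent (`SolvesGMY.unique`). -/

noncomputable section

namespace BraidMatrices

/-! ### The ring of regular functions and its derivations -/

section RegularRing

open Filter Topology

variable {n : ℕ} {c₁ c₂ c₃ : ℂ}

/-- The coordinate `y_l = 1 / (z_l - z_1)`, which moves the puncture `z_1` to infinity. -/
def yFun (l : ℕ) (z : config n c₁ c₂ c₃) : ℂ := 1 / (z.1 l - z.1 1)

/-- The function `1 / (y_i - y_j)`. -/
def rFun (i j : ℕ) (z : config n c₁ c₂ c₃) : ℂ := 1 / (yFun i z - yFun j z)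

/-- The algebra of regular functions on the moduli space in the coordinates `y`: it is generated by
the `y_l` and the `1 / (y_i - y_j)`, as a subalgebra of all functions on the configuration space. -/
def regAlg (n : ℕ) (c₁ c₂ c₃ : ℂ) : Subalgebra ℂ (config n c₁ c₂ c₃ → ℂ) :=
  Algebra.adjoin ℂ ({f | ∃ l ∈ Finset.Icc 4 n, f = yFun l} ∪
    {f | ∃ i ∈ Finset.Icc 2 n, ∃ j ∈ Finset.Icc 2 n, f = rFun i j})

/-- The regular functions as a ring. -/
abbrev RegRing (n : ℕ) (c₁ c₂ c₃ : ℂ) : Type := ↥(regAlg n c₁ c₂ c₃)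

theorem RegRing.ext_iff' {f g : RegRing n c₁ c₂ c₃} : f = g ↔ ∀ z, f.1 z = g.1 z := by
  rw [Subtype.ext_iff, funext_iff]

open Classical in
/-- `y_l` as a regular function (and `0` for indices out of range). -/
def Y (l : ℕ) : RegRing n c₁ c₂ c₃ :=
  if h : yFun l ∈ regAlg n c₁ c₂ c₃ then ⟨yFun l, h⟩ else 0

open Classical in
/-- `1 / (y_i - y_j)` as a regular function (and `0` for indices out of range, or `i = j`). -/
def R (i j : ℕ) : RegRing n c₁ c₂ c₃ :=
  if h : rFun i j ∈ regAlg n c₁ c₂ c₃ then ⟨rFun i j, h⟩ else 0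

theorem config_ne (z : config n c₁ c₂ c₃) {i j : ℕ} (hi : i ∈ Finset.Icc 1 n)
    (hj : j ∈ Finset.Icc 1 n) (hij : i ≠ j) : z.1 i ≠ z.1 j := fun h =>
  hij (z.2.2.2.2 (by simpa using hi) (by simpa using hj) h)

theorem yFun_mem {l : ℕ} (hl : l ∈ Finset.Icc 2 n) : yFun l ∈ regAlg n c₁ c₂ c₃ := by
  rw [Finset.mem_Icc] at hl
  by_cases h4 : 4 ≤ l
  · exact Algebra.subset_adjoin (Or.inl ⟨l, Finset.mem_Icc.2 ⟨h4, hl.2⟩, rfl⟩)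
  · have h : l = 2 ∨ l = 3 := by omega
    rcases h with rfl | rfl
    · convert (regAlg n c₁ c₂ c₃).algebraMap_mem (1 / (c₂ - c₁)) using 1
      funext z
      simp only [yFun, Pi.algebraMap_apply, Algebra.algebraMap_self, RingHom.id_apply, z.2.1,
        z.2.2.1]
    · convert (regAlg n c₁ c₂ c₃).algebraMap_mem (1 / (c₃ - c₁)) using 1
      funext z
      simp only [yFun, Pi.algebraMap_apply, Algebra.algebraMap_self, RingHom.id_apply, z.2.1,
        z.2.2.2.1]

theorem rFun_mem {i j : ℕ} (hi : i ∈ Finset.Icc 2 n) (hj : j ∈ Finset.Icc 2 n) :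
    rFun i j ∈ regAlg n c₁ c₂ c₃ :=
  Algebra.subset_adjoin (Or.inr ⟨i, hi, j, hj, rfl⟩)

theorem Y_apply {l : ℕ} (hl : l ∈ Finset.Icc 2 n) (z : config n c₁ c₂ c₃) :
    (Y l : RegRing n c₁ c₂ c₃).1 z = yFun l z := by
  rw [Y, dif_pos (yFun_mem hl)]

theorem R_apply {i j : ℕ} (hi : i ∈ Finset.Icc 2 n) (hj : j ∈ Finset.Icc 2 n)
    (z : config n c₁ c₂ c₃) : (R i j : RegRing n c₁ c₂ c₃).1 z = rFun i j z := by
  rw [R, dif_pos (rFun_mem hi hj)]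

theorem mem_Icc_one {n i : ℕ} (hi : i ∈ Finset.Icc 2 n) : i ∈ Finset.Icc 1 n := by
  simp only [Finset.mem_Icc] at hi ⊢; omega

theorem yFun_ne_zero {i : ℕ} (hi : i ∈ Finset.Icc 2 n) (z : config n c₁ c₂ c₃) :
    yFun i z ≠ 0 := by
  have h1 : z.1 i ≠ z.1 1 := config_ne z (mem_Icc_one hi)
    (by simp only [Finset.mem_Icc] at hi ⊢; omega) (by simp only [Finset.mem_Icc] at hi; omega)
  exact one_div_ne_zero (sub_ne_zero.2 h1)

theorem yFun_ne {i j : ℕ} (hi : i ∈ Finset.Icc 2 n) (hj : j ∈ Finset.Icc 2 n) (hij : i ≠ j)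
    (z : config n c₁ c₂ c₃) : yFun i z - yFun j z ≠ 0 := by
  have h : z.1 i ≠ z.1 j := config_ne z (mem_Icc_one hi) (mem_Icc_one hj) hij
  intro h0
  rw [sub_eq_zero, yFun, yFun, one_div, one_div, inv_inj] at h0
  exact h (sub_left_injective h0)

theorem R_mul_sub {i j : ℕ} (hi : i ∈ Finset.Icc 2 n) (hj : j ∈ Finset.Icc 2 n) (hij : i ≠ j) :
    (R i j : RegRing n c₁ c₂ c₃) * (Y i - Y j) = 1 := by
  rw [RegRing.ext_iff']
  intro z
  change (R i j : RegRing n c₁ c₂ c₃).1 z * ((Y i).1 z - (Y j).1 z) = 1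
  rw [R_apply hi hj, Y_apply hi, Y_apply hj, rFun, one_div_mul_cancel (yFun_ne hi hj hij z)]

theorem R_swap {i j : ℕ} (hi : i ∈ Finset.Icc 2 n) (hj : j ∈ Finset.Icc 2 n) :
    (R i j : RegRing n c₁ c₂ c₃) = -R j i := by
  rw [RegRing.ext_iff']
  intro z
  change _ = -(R j i : RegRing n c₁ c₂ c₃).1 z
  rw [R_apply hi hj, R_apply hj hi, rFun, rFun, one_div, one_div, ← inv_neg, neg_sub]

theorem R_self (i : ℕ) : (R i i : RegRing n c₁ c₂ c₃) = 0 := by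
  rw [R]
  split_ifs
  · rw [RegRing.ext_iff']
    intro z
    change rFun i i z = 0
    simp [rFun]
  · rfl

/-- Partial fractions: the Arnold relation for the points `y_x`, `y_i`, `y_j`. -/
theorem R_mul_R {x i j : ℕ} (hx : x ∈ Finset.Icc 2 n) (hi : i ∈ Finset.Icc 2 n)
    (hj : j ∈ Finset.Icc 2 n) (hxi : x ≠ i) (hxj : x ≠ j) (hij : i ≠ j) :
    (R x i * R x j : RegRing n c₁ c₂ c₃) = (R x i - R x j) * R i j := by
  have h1 := R_mul_sub (c₁ := c₁) (c₂ := c₂) (c₃ := c₃) hx hi hxi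
  have h2 := R_mul_sub (c₁ := c₁) (c₂ := c₂) (c₃ := c₃) hx hj hxj
  have h3 := R_mul_sub (c₁ := c₁) (c₂ := c₂) (c₃ := c₃) hi hj hij
  linear_combination (-(R x i * R x j)) * h3 + R i j * R x i * h2 - R i j * R x j * h1

/-- Extension by zero of a function on the configuration space to all of `ℕ → ℂ`. -/
def liftFun (f : config n c₁ c₂ c₃ → ℂ) : (ℕ → ℂ) → ℂ := Function.extend Subtype.val f 0

theorem liftFun_apply (f : config n c₁ c₂ c₃ → ℂ) (z : config n c₁ c₂ c₃) :
    liftFun f z.1 = f z :=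
  Subtype.val_injective.extend_apply f 0 z

theorem liftFun_of_mem (f : config n c₁ c₂ c₃ → ℂ) {z : ℕ → ℂ} (hz : z ∈ config n c₁ c₂ c₃) :
    liftFun f z = f ⟨z, hz⟩ :=
  liftFun_apply f ⟨z, hz⟩

theorem update_mem_config {l : ℕ} (hl : l ∈ Finset.Icc 4 n) (z : config n c₁ c₂ c₃) {t : ℂ}
    (ht : ∀ j ∈ (Finset.Icc 1 n).erase l, t ≠ z.1 j) :
    Function.update z.1 l t ∈ config n c₁ c₂ c₃ := by
  rw [Finset.mem_Icc] at hl
  have e : ∀ i, i ≠ l → Function.update z.1 l t i = z.1 i := fun i hi =>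
    Function.update_of_ne hi _ _
  refine ⟨?_, ?_, ?_, ?_⟩
  · rw [e _ (by omega)]; exact z.2.1
  · rw [e _ (by omega)]; exact z.2.2.1
  · rw [e _ (by omega)]; exact z.2.2.2.1
  · intro i hi j hj hij
    by_cases h1 : i = l <;> by_cases h2 : j = l
    · rw [h1, h2]
    · subst h1
      rw [Function.update_self, e _ h2] at hij
      exact absurd hij (ht j (Finset.mem_erase.2 ⟨h2, by simpa using hj⟩))
    · subst h2
      rw [Function.update_self, e _ h1] at hij
      exact absurd hij.symm (ht i (Finset.mem_erase.2 ⟨h1, by simpa using hi⟩))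
    · rw [e _ h1, e _ h2] at hij
      exact z.2.2.2.2 hi hj hij

theorem eventually_update_mem_config {l : ℕ} (hl : l ∈ Finset.Icc 4 n)
    (z : config n c₁ c₂ c₃) :
    ∀ᶠ t in 𝓝 (z.1 l), Function.update z.1 l t ∈ config n c₁ c₂ c₃ := by
  have h : ∀ j ∈ (Finset.Icc 1 n).erase l, ∀ᶠ t in 𝓝 (z.1 l), t ≠ z.1 j := fun j hj =>
    isOpen_ne.mem_nhds (config_ne z (by simp only [Finset.mem_Icc] at hl ⊢; omega)
      (Finset.mem_of_mem_erase hj) (Finset.ne_of_mem_erase hj).symm)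
  filter_upwards [(Filter.eventually_all_finset _).2 h] with t ht
  exact update_mem_config hl z ht

/-- `f'` is the derivative of `f` with respect to `y_l`, the other coordinates being fixed. The
factor `-y_l²` is `∂y_l/∂z_l`. -/
def HasPD (l : ℕ) (f f' : config n c₁ c₂ c₃ → ℂ) : Prop :=
  ∀ z : config n c₁ c₂ c₃,
    HasDerivAt (fun t => liftFun f (Function.update z.1 l t)) (-(yFun l z) ^ 2 * f' z) (z.1 l)

section
variable {l : ℕ} {f g f' g' : config n c₁ c₂ c₃ → ℂ}

theorem HasPD.congr_near (hl : l ∈ Finset.Icc 4 n) {G : config n c₁ c₂ c₃ → ℂ → ℂ}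
    (hG : ∀ z : config n c₁ c₂ c₃,
      HasDerivAt (G z) (-(yFun l z) ^ 2 * f' z) (z.1 l))
    (h : ∀ (z : config n c₁ c₂ c₃) (t : ℂ) (ht : Function.update z.1 l t ∈ config n c₁ c₂ c₃),
      f ⟨_, ht⟩ = G z t) : HasPD l f f' := by
  intro z
  refine (hG z).congr_of_eventuallyEq ?_
  filter_upwards [eventually_update_mem_config hl z] with t ht
  rw [liftFun_of_mem _ ht, h z t ht]

theorem HasPD.unique (hl : l ∈ Finset.Icc 4 n) (h : HasPD l f f') (h2 : HasPD l f g') :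
    f' = g' := by
  funext z
  have := (h z).unique (h2 z)
  refine mul_left_cancel₀ ?_ this
  exact neg_ne_zero.2 (pow_ne_zero _ (yFun_ne_zero
    (by simp only [Finset.mem_Icc] at hl ⊢; omega) z))

theorem HasPD.const (hl : l ∈ Finset.Icc 4 n) (r : ℂ) :
    HasPD l (fun _ : config n c₁ c₂ c₃ => r) 0 :=
  HasPD.congr_near hl (G := fun _ _ => r)
    (fun z => by simpa using hasDerivAt_const (z.1 l) r) (fun _ _ _ => rfl)

theorem HasPD.add (hl : l ∈ Finset.Icc 4 n) (hf : HasPD l f f') (hg : HasPD l g g') :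
    HasPD l (f + g) (f' + g') :=
  HasPD.congr_near hl (fun z => ((hf z).add (hg z)).congr_deriv (by simp only [Pi.add_apply]; ring))
    (fun z t ht => by simp [liftFun_of_mem _ ht])

theorem HasPD.mul (hl : l ∈ Finset.Icc 4 n) (hf : HasPD l f f') (hg : HasPD l g g') :
    HasPD l (f * g) (f' * g + f * g') :=
  HasPD.congr_near hl (fun z => ((hf z).mul (hg z)).congr_deriv (by
      simp only [Pi.add_apply, Pi.mul_apply, Function.update_eq_self, liftFun_apply]; ring))
    (fun z t ht => by simp [liftFun_of_mem _ ht])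

theorem HasPD.yFun (hl : l ∈ Finset.Icc 4 n) {j : ℕ} :
    HasPD l (yFun j : config n c₁ c₂ c₃ → ℂ) (fun _ => if l = j then 1 else 0) := by
  have hl1 : (1 : ℕ) ≠ l := by simp only [Finset.mem_Icc] at hl; omega
  split_ifs with h
  · subst h
    refine HasPD.congr_near hl (G := fun z t => 1 / (t - z.1 1)) (fun z => ?_) (fun z t ht => ?_)
    · have h0 : z.1 l - z.1 1 ≠ 0 := sub_ne_zero.2 (config_ne z
        (by simp only [Finset.mem_Icc] at hl ⊢; omega)
        (by simp only [Finset.mem_Icc] at hl ⊢; omega) hl1.symm)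
      have := ((hasDerivAt_id (z.1 l)).sub_const (z.1 1)).inv h0
      simp only [id_eq] at this
      refine (this.congr_of_eventuallyEq (Eventually.of_forall fun t => ?_)).congr_deriv ?_
      · simp
      · simp only [BraidMatrices.yFun]; field_simp
    · simp [BraidMatrices.yFun, Function.update_of_ne hl1]
  · refine HasPD.congr_near hl (G := fun z _ => BraidMatrices.yFun j z) (fun z => ?_)
      (fun z t ht => ?_)
    · simpa using hasDerivAt_const (z.1 l) _
    · simp [BraidMatrices.yFun, Function.update_of_ne hl1, Function.update_of_ne (Ne.symm h)]

theorem HasPD.rFun (hl : l ∈ Finset.Icc 4 n) {i j : ℕ} (hi : i ∈ Finset.Icc 2 n)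
    (hj : j ∈ Finset.Icc 2 n) :
    HasPD l (rFun i j : config n c₁ c₂ c₃ → ℂ)
      (fun z => -((if l = i then 1 else 0) - (if l = j then 1 else 0)) * rFun i j z ^ 2) := by
  by_cases hij : i = j
  · subst hij
    have := HasPD.const (c₁ := c₁) (c₂ := c₂) (c₃ := c₃) hl 0
    convert this using 1
    · funext z; simp [BraidMatrices.rFun]
    · funext z; simp
  · refine HasPD.congr_near hl (G := fun (z : config n c₁ c₂ c₃) t =>
      (liftFun (BraidMatrices.yFun i : config n c₁ c₂ c₃ → ℂ) (Function.update z.1 l t) -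
      liftFun (BraidMatrices.yFun j : config n c₁ c₂ c₃ → ℂ) (Function.update z.1 l t))⁻¹)
      (fun z => ?_) (fun z t ht => ?_)
    · have h := yFun_ne hi hj hij z
      refine ((((HasPD.yFun hl (j := i)) z).sub ((HasPD.yFun hl (j := j)) z)).inv ?_).congr_deriv ?_
      · simpa only [Pi.sub_apply, Function.update_eq_self, liftFun_apply] using h
      · simp only [Pi.sub_apply, Function.update_eq_self, liftFun_apply, BraidMatrices.rFun]
        field_simp
        ring
    · simp [liftFun_of_mem _ ht, BraidMatrices.rFun]

end

theorem exists_hasPD {l : ℕ} (hl : l ∈ Finset.Icc 4 n) {f : config n c₁ c₂ c₃ → ℂ}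
    (hf : f ∈ regAlg n c₁ c₂ c₃) : ∃ f' ∈ regAlg n c₁ c₂ c₃, HasPD l f f' := by
  induction hf using Algebra.adjoin_induction with
  | mem f hf =>
    rcases hf with ⟨j, hj, rfl⟩ | ⟨i, hi, j, hj, rfl⟩
    · exact ⟨_, (regAlg n c₁ c₂ c₃).algebraMap_mem (if l = j then 1 else 0), HasPD.yFun hl⟩
    · exact ⟨_, (regAlg n c₁ c₂ c₃).mul_mem ((regAlg n c₁ c₂ c₃).algebraMap_mem
        (-((if l = i then 1 else 0) - (if l = j then 1 else 0))))
        ((regAlg n c₁ c₂ c₃).pow_mem (rFun_mem hi hj) 2), HasPD.rFun hl hi hj⟩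
  | algebraMap r => exact ⟨0, zero_mem _, HasPD.const hl r⟩
  | add f g _ _ hf hg =>
    obtain ⟨f', hf', h1⟩ := hf
    obtain ⟨g', hg', h2⟩ := hg
    exact ⟨_, add_mem hf' hg', h1.add hl h2⟩
  | mul f g hf0 hg0 hf hg =>
    obtain ⟨f', hf', h1⟩ := hf
    obtain ⟨g', hg', h2⟩ := hg
    exact ⟨_, add_mem (mul_mem hf' hg0) (mul_mem hf0 hg'), h1.mul hl h2⟩

/-- The derivative of a regular function with respect to `y_l`. -/
def pdFun {l : ℕ} (hl : l ∈ Finset.Icc 4 n) (f : RegRing n c₁ c₂ c₃) : RegRing n c₁ c₂ c₃ :=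
  ⟨_, (exists_hasPD hl f.2).choose_spec.1⟩

theorem pdFun_spec {l : ℕ} (hl : l ∈ Finset.Icc 4 n) (f : RegRing n c₁ c₂ c₃) :
    HasPD l f.1 (pdFun hl f).1 :=
  (exists_hasPD hl f.2).choose_spec.2

theorem pdFun_eq {l : ℕ} (hl : l ∈ Finset.Icc 4 n) {f f' : RegRing n c₁ c₂ c₃}
    (h : HasPD l f.1 f'.1) : pdFun hl f = f' :=
  Subtype.ext ((pdFun_spec hl f).unique hl h)

theorem pdFun_mul {l : ℕ} (hl : l ∈ Finset.Icc 4 n) (f g : RegRing n c₁ c₂ c₃) :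
    pdFun hl (f * g) = f * pdFun hl g + g * pdFun hl f :=
  pdFun_eq hl (by
    have h := (pdFun_spec hl f).mul hl (pdFun_spec hl g)
    rwa [add_comm, mul_comm (pdFun hl f).1] at h)

open Classical in
/-- The derivation `∂/∂y_l` of the ring of regular functions (zero if `y_l` is not a coordinate). -/
def pd (l : ℕ) : Derivation ℂ (RegRing n c₁ c₂ c₃) (RegRing n c₁ c₂ c₃) :=
  if hl : l ∈ Finset.Icc 4 n then
    Derivation.mk'
      { toFun := pdFun hl
        map_add' := fun f g => pdFun_eq hl ((pdFun_spec hl f).add hl (pdFun_spec hl g))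
        map_smul' := fun r f => by
          have h0 : pdFun hl (algebraMap ℂ (RegRing n c₁ c₂ c₃) r) = 0 :=
            pdFun_eq hl (HasPD.const hl r)
          rw [Algebra.smul_def, pdFun_mul, h0, mul_zero, add_zero, RingHom.id_apply,
            Algebra.smul_def] }
      (pdFun_mul hl)
  else 0

theorem pd_spec {l : ℕ} (hl : l ∈ Finset.Icc 4 n) (f : RegRing n c₁ c₂ c₃) :
    HasPD l f.1 (pd l f).1 := by
  rw [pd, dif_pos hl]
  exact pdFun_spec hl f

theorem pd_eq {l : ℕ} (hl : l ∈ Finset.Icc 4 n) {f f' : RegRing n c₁ c₂ c₃}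
    (h : HasPD l f.1 f'.1) : pd l f = f' :=
  Subtype.ext ((pd_spec hl f).unique hl h)

theorem pd_Y {l j : ℕ} (hl : l ∈ Finset.Icc 4 n) (hj : j ∈ Finset.Icc 2 n) :
    pd l (Y j : RegRing n c₁ c₂ c₃) = if l = j then 1 else 0 := by
  refine pd_eq hl ?_
  convert HasPD.yFun (c₁ := c₁) (c₂ := c₂) (c₃ := c₃) hl (j := j) using 1
  · exact funext (Y_apply hj)
  · split_ifs <;> rfl

theorem pd_R {l i j : ℕ} (hl : l ∈ Finset.Icc 4 n) (hi : i ∈ Finset.Icc 2 n)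
    (hj : j ∈ Finset.Icc 2 n) :
    pd l (R i j : RegRing n c₁ c₂ c₃) =
      -((if l = i then 1 else 0) - (if l = j then 1 else 0)) * R i j ^ 2 := by
  refine pd_eq hl ?_
  convert HasPD.rFun (c₁ := c₁) (c₂ := c₂) (c₃ := c₃) hl hi hj using 1
  · exact funext (R_apply hi hj)
  · funext z
    have : ((R i j : RegRing n c₁ c₂ c₃) ^ 2).1 z = rFun i j z ^ 2 := by
      change ((R i j : RegRing n c₁ c₂ c₃).1 z) ^ 2 = _
      rw [R_apply hi hj]
    rw [← this]
    split_ifs <;> rfl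

/-- The regular functions of `y_4, …, y_m` only. -/
def sub (m : ℕ) : Subalgebra ℂ (RegRing n c₁ c₂ c₃) :=
  Algebra.adjoin ℂ ({f | ∃ l ∈ Finset.Icc 4 m, f = Y l} ∪
    {f | ∃ i ∈ Finset.Icc 2 m, ∃ j ∈ Finset.Icc 2 m, f = R i j})

theorem sub_top : (sub n : Subalgebra ℂ (RegRing n c₁ c₂ c₃)) = ⊤ := by
  rw [eq_top_iff]
  rintro ⟨f, hf⟩ -
  suffices ∀ hf : f ∈ regAlg n c₁ c₂ c₃, (⟨f, hf⟩ : RegRing n c₁ c₂ c₃) ∈ sub n from this hf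
  induction hf using Algebra.adjoin_induction with
  | mem f hf =>
    intro h
    rcases hf with ⟨j, hj, rfl⟩ | ⟨i, hi, j, hj, rfl⟩
    · exact Algebra.subset_adjoin (Or.inl ⟨j, hj, by rw [Y, dif_pos h]⟩)
    · exact Algebra.subset_adjoin (Or.inr ⟨i, hi, j, hj, by rw [R, dif_pos h]⟩)
  | algebraMap r => intro h; exact (sub n).algebraMap_mem r
  | add f g hf0 hg0 hf hg => intro h; exact add_mem (hf hf0) (hg hg0)
  | mul f g hf0 hg0 hf hg => intro h; exact mul_mem (hf hf0) (hg hg0)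

theorem sub_mono {m m' : ℕ} (h : m ≤ m') :
    (sub m : Subalgebra ℂ (RegRing n c₁ c₂ c₃)) ≤ sub m' := by
  refine Algebra.adjoin_mono (Set.union_subset_union ?_ ?_)
  · rintro _ ⟨l, hl, rfl⟩
    exact ⟨l, Finset.Icc_subset_Icc_right h hl, rfl⟩
  · rintro _ ⟨i, hi, j, hj, rfl⟩
    exact ⟨i, Finset.Icc_subset_Icc_right h hi, j, Finset.Icc_subset_Icc_right h hj, rfl⟩

theorem R_mem_sub {m i j : ℕ} (hi : i ∈ Finset.Icc 2 m) (hj : j ∈ Finset.Icc 2 m) :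
    (R i j : RegRing n c₁ c₂ c₃) ∈ sub m :=
  Algebra.subset_adjoin (Or.inr ⟨i, hi, j, hj, rfl⟩)

theorem Y_mem_sub {m l : ℕ} (hm : m ≤ n) (hl : l ∈ Finset.Icc 2 m) :
    (Y l : RegRing n c₁ c₂ c₃) ∈ sub m := by
  by_cases h4 : 4 ≤ l
  · exact Algebra.subset_adjoin
      (Or.inl ⟨l, Finset.mem_Icc.2 ⟨h4, (Finset.mem_Icc.1 hl).2⟩, rfl⟩)
  · have hl2 : l ∈ Finset.Icc 2 n := Finset.Icc_subset_Icc_right hm hl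
    have h : l = 2 ∨ l = 3 := by rw [Finset.mem_Icc] at hl; omega
    have : (Y l : RegRing n c₁ c₂ c₃) = algebraMap ℂ _ (1 / ((if l = 2 then c₂ else c₃) - c₁)) := by
      rw [RegRing.ext_iff']
      intro z
      rw [Y_apply hl2]
      change yFun l z = 1 / ((if l = 2 then c₂ else c₃) - c₁)
      rcases h with rfl | rfl
      · rw [if_pos rfl, yFun, z.2.1, z.2.2.1]
      · rw [if_neg (by norm_num), yFun, z.2.1, z.2.2.2.1]
    rw [this]
    exact (sub m).algebraMap_mem _

theorem sub_apply_congr {m : ℕ} (hm : m ≤ n) {f : RegRing n c₁ c₂ c₃} (hf : f ∈ sub m)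
    {z z' : config n c₁ c₂ c₃} (h : ∀ i ∈ Finset.Icc 1 m, z.1 i = z'.1 i) : f.1 z = f.1 z' := by
  have hy : ∀ i ∈ Finset.Icc 2 m, yFun i z = yFun i z' := fun i hi => by
    rw [yFun, yFun, h i (mem_Icc_one hi), z.2.1, z'.2.1]
  induction hf using Algebra.adjoin_induction with
  | mem f hf =>
    rcases hf with ⟨j, hj, rfl⟩ | ⟨i, hi, j, hj, rfl⟩
    · have hj2 : j ∈ Finset.Icc 2 m := by simp only [Finset.mem_Icc] at hj ⊢; omega
      have hj3 := Finset.Icc_subset_Icc_right hm hj2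
      rw [Y_apply hj3, Y_apply hj3, hy j hj2]
    · have hi3 := Finset.Icc_subset_Icc_right hm hi
      have hj3 := Finset.Icc_subset_Icc_right hm hj
      rw [R_apply hi3 hj3, R_apply hi3 hj3, rFun, rFun, hy i hi, hy j hj]
  | algebraMap r => rfl
  | add f g _ _ hf hg =>
    change f.1 z + g.1 z = f.1 z' + g.1 z'
    rw [hf, hg]
  | mul f g _ _ hf hg =>
    change f.1 z * g.1 z = f.1 z' * g.1 z'
    rw [hf, hg]

theorem pd_eq_zero {m l : ℕ} (hl : l ∈ Finset.Ioc m n) (h4 : 4 ≤ l)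
    {f : RegRing n c₁ c₂ c₃} (hf : f ∈ sub m) : pd l f = 0 := by
  rw [Finset.mem_Ioc] at hl
  have hl' : l ∈ Finset.Icc 4 n := Finset.mem_Icc.2 ⟨h4, hl.2⟩
  refine Derivation.eqOn_adjoin (D1 := pd l) (D2 := 0) ?_ hf
  rintro f (⟨j, hj, rfl⟩ | ⟨i, hi, j, hj, rfl⟩)
  · rw [Finset.mem_Icc] at hj
    rw [pd_Y hl' (Finset.mem_Icc.2 (by omega)), if_neg (by omega)]
    rfl
  · rw [Finset.mem_Icc] at hi hj
    rw [pd_R hl' (Finset.mem_Icc.2 (by omega)) (Finset.mem_Icc.2 (by omega)), if_neg (by omega),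
      if_neg (by omega)]
    simp

theorem pd_mem_sub {m l : ℕ} (hm : m ≤ n) (hl : l ∈ Finset.Icc 4 n)
    {f : RegRing n c₁ c₂ c₃} (hf : f ∈ sub m) :
    pd l f ∈ sub (n := n) (c₁ := c₁) (c₂ := c₂) (c₃ := c₃) m := by
  induction hf using Algebra.adjoin_induction with
  | mem f hf =>
    rcases hf with ⟨j, hj, rfl⟩ | ⟨i, hi, j, hj, rfl⟩
    · rw [Finset.mem_Icc] at hj
      rw [pd_Y hl (Finset.mem_Icc.2 (by omega))]
      split_ifs
      · exact one_mem _
      · exact zero_mem _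
    · rw [pd_R hl (Finset.Icc_subset_Icc_right hm hi) (Finset.Icc_subset_Icc_right hm hj)]
      refine mul_mem (neg_mem (sub_mem ?_ ?_)) (pow_mem (R_mem_sub hi hj) 2)
      · split_ifs
        · exact one_mem _
        · exact zero_mem _
      · split_ifs
        · exact one_mem _
        · exact zero_mem _
  | algebraMap r => rw [Derivation.map_algebraMap]; exact zero_mem _
  | add f g _ _ hf hg => rw [map_add]; exact add_mem hf hg
  | mul f g hf0 hg0 hf hg =>
    rw [Derivation.leibniz]
    exact add_mem (mul_mem hf0 hg) (mul_mem hg0 hf)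

theorem pd_comm {l m : ℕ} (hl : l ∈ Finset.Icc 4 n) (hm : m ∈ Finset.Icc 4 n)
    (f : RegRing n c₁ c₂ c₃) : pd l (pd m f) = pd m (pd l f) := by
  have h : ⁅(pd l : Derivation ℂ (RegRing n c₁ c₂ c₃) (RegRing n c₁ c₂ c₃)),
      (pd m : Derivation ℂ (RegRing n c₁ c₂ c₃) (RegRing n c₁ c₂ c₃))⁆ = 0 := by
    refine Derivation.ext_of_adjoin_eq_top _ sub_top ?_
    rintro f (⟨j, hj, rfl⟩ | ⟨i, hi, j, hj, rfl⟩)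
    · have hj2 : j ∈ Finset.Icc 2 n := by simp only [Finset.mem_Icc] at hj ⊢; omega
      rw [Derivation.commutator_apply, pd_Y hl hj2, pd_Y hm hj2]
      split_ifs <;> simp
    · rw [Derivation.commutator_apply, pd_R hl hi hj, pd_R hm hi hj, Derivation.leibniz,
        Derivation.leibniz, Derivation.leibniz_pow, Derivation.leibniz_pow, pd_R hl hi hj,
        pd_R hm hi hj]
      have h0 : ∀ (l i j : ℕ), pd l (-((if m = i then 1 else 0) - (if m = j then 1 else 0)) :
          RegRing n c₁ c₂ c₃) = 0 := fun l i j => by split_ifs <;> simp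
      have h1 : ∀ (m i j : ℕ), pd m (-((if l = i then 1 else 0) - (if l = j then 1 else 0)) :
          RegRing n c₁ c₂ c₃) = 0 := fun m i j => by split_ifs <;> simp
      rw [h0, h1]
      simp only [smul_eq_mul, nsmul_eq_mul, Derivation.coe_zero, Pi.zero_apply]
      ring
  have := congrArg (fun D => D f) h
  simp only [Derivation.commutator_apply, Derivation.coe_zero, Pi.zero_apply] at this
  exact sub_eq_zero.1 this

end RegularRing

/-! ### Regular forms in the coordinates `y` -/

/-- Each of the `n` punctures occurs in `n - 1` pairs. -/
@[to_additive]
theorem prod_pairs {M : Type*} [CommMonoid M] (f : ℕ → M) (n : ℕ) :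
    ∏ i ∈ Finset.Icc 1 n, ∏ j ∈ Finset.Ioc i n, (f i * f j) =
      ∏ l ∈ Finset.Icc 1 n, f l ^ (n - 1) := by
  induction n with
  | zero => simp
  | succ n ih =>
    rw [Finset.prod_Icc_succ_top (by omega), Finset.prod_Icc_succ_top (by omega)]
    have h : ∀ i ∈ Finset.Icc 1 n, ∏ j ∈ Finset.Ioc i (n + 1), (f i * f j) =
        (∏ j ∈ Finset.Ioc i n, (f i * f j)) * (f i * f (n + 1)) := fun i hi =>
      Finset.prod_Ioc_succ_top (Finset.mem_Icc.1 hi).2 _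
    rw [Finset.prod_congr rfl h, Finset.prod_mul_distrib, ih, Finset.Ioc_self, Finset.prod_empty,
      mul_one, Finset.prod_mul_distrib, Finset.prod_const, Nat.card_Icc, ← mul_assoc,
      ← Finset.prod_mul_distrib]
    simp only [Nat.add_sub_cancel]
    congr 1
    refine Finset.prod_congr rfl fun l hl => ?_
    rw [← pow_succ, Nat.sub_add_cancel (le_trans (Finset.mem_Icc.1 hl).1 (Finset.mem_Icc.1 hl).2)]

section RegularForms

variable {n : ℕ} {c₁ c₂ c₃ : ℂ}

theorem IsRegularForm.congr {S : Finset ℕ} {f g : (ℕ → ℂ) → ℂ}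
    (hf : IsRegularForm n c₁ c₂ c₃ S f) (h : ∀ z ∈ config n c₁ c₂ c₃, g z = f z) :
    IsRegularForm n c₁ c₂ c₃ S g := by
  obtain ⟨m, P, h1, h2, h3⟩ := hf
  exact ⟨m, P, h1, h2, fun z hz => (h z hz).trans (h3 z hz)⟩

theorem IsRegularForm.mul {S T : Finset ℕ} {f g : (ℕ → ℂ) → ℂ}
    (hf : IsRegularForm n c₁ c₂ c₃ S f) (hg : IsRegularForm n c₁ c₂ c₃ T g) :
    IsRegularForm n c₁ c₂ c₃ (S ∪ T) (fun z => f z * g z) := by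
  obtain ⟨m, P, h1, h2, h3⟩ := hf
  obtain ⟨m', P', h1', h2', h3'⟩ := hg
  refine ⟨m + m', P * P', ?_, fun l hl => ?_, fun z hz => ?_⟩
  · exact (MvPolynomial.vars_mul _ _).trans (Finset.union_subset h1 h1')
  · have a := h2 l hl
    have a' := h2' l hl
    have b := MvPolynomial.degreeOf_mul_le l P P'
    rw [add_mul]
    simp only [Finset.mem_union]
    split_ifs at * <;> first | omega | tauto
  · beta_reduce
    rw [h3 z hz, h3' z hz, map_mul, pow_add, div_mul_div_comm]

theorem isRegularForm_const (r : ℂ) : IsRegularForm n c₁ c₂ c₃ ∅ (fun _ => r) :=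
  ⟨0, MvPolynomial.C r, by simp, fun l _ => by simp, fun z _ => by simp⟩

/-- The polynomial that takes the value `z_i` on the configuration space. -/
def coordPoly (c₁ c₂ c₃ : ℂ) (i : ℕ) : MvPolynomial ℕ ℂ :=
  if i = 1 then MvPolynomial.C c₁ else if i = 2 then MvPolynomial.C c₂
  else if i = 3 then MvPolynomial.C c₃ else MvPolynomial.X i

theorem eval_coordPoly {z : ℕ → ℂ} (hz : z ∈ config n c₁ c₂ c₃) (i : ℕ) :
    MvPolynomial.eval z (coordPoly c₁ c₂ c₃ i) = z i := by
  rw [coordPoly]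
  split_ifs with h1 h2 h3
  · rw [MvPolynomial.eval_C, h1, hz.1]
  · rw [MvPolynomial.eval_C, h2, hz.2.1]
  · rw [MvPolynomial.eval_C, h3, hz.2.2.1]
  · rw [MvPolynomial.eval_X]

theorem vars_coordPoly {i : ℕ} (hi : i ∈ Finset.Icc 1 n) :
    (coordPoly c₁ c₂ c₃ i).vars ⊆ Finset.Icc 4 n := by
  rw [Finset.mem_Icc] at hi
  rw [coordPoly]
  split_ifs with h1 h2 h3
  · simp
  · simp
  · simp
  · rw [MvPolynomial.vars_X, Finset.singleton_subset_iff, Finset.mem_Icc]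
    omega

theorem degreeOf_coordPoly (i l : ℕ) :
    (coordPoly c₁ c₂ c₃ i).degreeOf l ≤ if l = i then 1 else 0 := by
  rw [coordPoly]
  split_ifs with h1 h2 h3 h4 h5 h6 h7 <;>
    simp_all [MvPolynomial.degreeOf_C, MvPolynomial.degreeOf_X]

theorem vars_coordPoly_sub {i j : ℕ} (hi : i ∈ Finset.Icc 1 n) (hj : j ∈ Finset.Icc 1 n) :
    (coordPoly c₁ c₂ c₃ i - coordPoly c₁ c₂ c₃ j).vars ⊆ Finset.Icc 4 n :=
  Finset.Subset.trans (MvPolynomial.vars_sub_subset _)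
    (Finset.union_subset (vars_coordPoly hi) (vars_coordPoly hj))

theorem degreeOf_coordPoly_sub (i j l : ℕ) :
    (coordPoly c₁ c₂ c₃ i - coordPoly c₁ c₂ c₃ j).degreeOf l ≤
      (if l = i then 1 else 0) + (if l = j then 1 else 0) := by
  have h1 := degreeOf_coordPoly (c₁ := c₁) (c₂ := c₂) (c₃ := c₃) i l
  have h2 := degreeOf_coordPoly (c₁ := c₁) (c₂ := c₂) (c₃ := c₃) j l
  have h3 := MvPolynomial.degreeOf_sub_le l (coordPoly c₁ c₂ c₃ i) (coordPoly c₁ c₂ c₃ j)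
  omega

/-- The pairs `i < j` of punctures. -/
def pairs (n : ℕ) : Finset (Σ _ : ℕ, ℕ) := (Finset.Icc 1 n).sigma fun i => Finset.Ioc i n

theorem mem_pairs {e : Σ _ : ℕ, ℕ} (he : e ∈ pairs n) :
    e.1 ∈ Finset.Icc 1 n ∧ e.2 ∈ Finset.Icc 1 n ∧ e.1 < e.2 := by
  simp only [pairs, Finset.mem_sigma, Finset.mem_Icc, Finset.mem_Ioc] at he ⊢
  omega

/-- The discriminant `∏_{i<j} (z_i - z_j)` as a polynomial, restricted to a set of pairs. -/
def discPoly (c₁ c₂ c₃ : ℂ) (U : Finset (Σ _ : ℕ, ℕ)) : MvPolynomial ℕ ℂ :=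
  ∏ e ∈ U, (coordPoly c₁ c₂ c₃ e.1 - coordPoly c₁ c₂ c₃ e.2)

theorem vars_discPoly {U : Finset (Σ _ : ℕ, ℕ)} (hU : U ⊆ pairs n) :
    (discPoly c₁ c₂ c₃ U).vars ⊆ Finset.Icc 4 n := by
  refine (MvPolynomial.vars_prod _).trans ?_
  rw [Finset.biUnion_subset]
  intro e he
  exact vars_coordPoly_sub (mem_pairs (hU he)).1 (mem_pairs (hU he)).2.1

theorem degreeOf_discPoly_le (U : Finset (Σ _ : ℕ, ℕ)) (l : ℕ) :
    (discPoly c₁ c₂ c₃ U).degreeOf l ≤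
      ∑ e ∈ U, ((if l = e.1 then 1 else 0) + (if l = e.2 then 1 else 0)) :=
  (MvPolynomial.degreeOf_prod_le _ _ _).trans
    (Finset.sum_le_sum fun e _ => degreeOf_coordPoly_sub e.1 e.2 l)

theorem sum_pairs_indicator {l : ℕ} (hl : l ∈ Finset.Icc 1 n) :
    ∑ e ∈ pairs n, ((if l = e.1 then 1 else 0) + (if l = e.2 then 1 else 0)) = n - 1 := by
  have h := sum_pairs (fun i => if l = i then 1 else 0) n
  rw [Finset.sum_sigma'] at h
  refine h.trans ?_
  simp only [smul_eq_mul, mul_ite, mul_one, mul_zero]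
  rw [Finset.sum_ite_eq, if_pos hl]

theorem degreeOf_discPoly {l : ℕ} (hl : l ∈ Finset.Icc 1 n) :
    (discPoly c₁ c₂ c₃ (pairs n)).degreeOf l ≤ n - 1 :=
  (degreeOf_discPoly_le _ l).trans (sum_pairs_indicator hl).le

theorem degreeOf_discPoly_erase {l : ℕ} (hl : l ∈ Finset.Icc 1 n) {e : Σ _ : ℕ, ℕ}
    (he : e ∈ pairs n) :
    (discPoly c₁ c₂ c₃ ((pairs n).erase e)).degreeOf l +
      ((if l = e.1 then 1 else 0) + (if l = e.2 then 1 else 0)) ≤ n - 1 := by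
  rw [← sum_pairs_indicator hl, ← Finset.sum_erase_add _ _ he]
  exact Nat.add_le_add_right (degreeOf_discPoly_le _ l) _

theorem eval_discPoly {z : ℕ → ℂ} (hz : z ∈ config n c₁ c₂ c₃) (U : Finset (Σ _ : ℕ, ℕ)) :
    MvPolynomial.eval z (discPoly c₁ c₂ c₃ U) = ∏ e ∈ U, (z e.1 - z e.2) := by
  simp [discPoly, map_prod, eval_coordPoly hz]

theorem disc_eq (z : ℕ → ℂ) : ∏ i ∈ Finset.Icc 1 n, ∏ j ∈ Finset.Ioc i n, (z i - z j) =
    ∏ e ∈ pairs n, (z e.1 - z e.2) :=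
  Finset.prod_sigma' _ _ _

theorem disc_ne_zero {z : ℕ → ℂ} (hz : z ∈ config n c₁ c₂ c₃) :
    ∏ e ∈ pairs n, (z e.1 - z e.2) ≠ 0 :=
  Finset.prod_ne_zero_iff.2 fun _ he => sub_ne_zero.2 (config_ne ⟨z, hz⟩ (mem_pairs he).1
    (mem_pairs he).2.1 (mem_pairs he).2.2.ne)

theorem IsRegularForm.add {S : Finset ℕ} {f g : (ℕ → ℂ) → ℂ}
    (hf : IsRegularForm n c₁ c₂ c₃ S f) (hg : IsRegularForm n c₁ c₂ c₃ S g) :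
    IsRegularForm n c₁ c₂ c₃ S (fun z => f z + g z) := by
  obtain ⟨m, P, h1, h2, h3⟩ := hf
  obtain ⟨m', P', h1', h2', h3'⟩ := hg
  have hv : ∀ m, (discPoly c₁ c₂ c₃ (pairs n) ^ m).vars ⊆ Finset.Icc 4 n := fun m =>
    (MvPolynomial.vars_pow _ m).trans (vars_discPoly subset_rfl)
  refine ⟨m + m', P * discPoly c₁ c₂ c₃ (pairs n) ^ m' + P' * discPoly c₁ c₂ c₃ (pairs n) ^ m,
    ?_, fun l hl => ?_, fun z hz => ?_⟩
  · refine (MvPolynomial.vars_add_subset _ _).trans (Finset.union_subset ?_ ?_)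
    · exact (MvPolynomial.vars_mul _ _).trans (Finset.union_subset h1 (hv _))
    · exact (MvPolynomial.vars_mul _ _).trans (Finset.union_subset h1' (hv _))
  · have hd : ∀ m, (discPoly c₁ c₂ c₃ (pairs n) ^ m).degreeOf l ≤ m * (n - 1) := fun m =>
      (MvPolynomial.degreeOf_pow_le _ _ _).trans (Nat.mul_le_mul_left _
        (degreeOf_discPoly (by simp only [Finset.mem_Icc] at hl ⊢; omega)))
    have a := h2 l hl
    have a' := h2' l hl
    have b := MvPolynomial.degreeOf_mul_le l P (discPoly c₁ c₂ c₃ (pairs n) ^ m')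
    have b' := MvPolynomial.degreeOf_mul_le l P' (discPoly c₁ c₂ c₃ (pairs n) ^ m)
    have d := MvPolynomial.degreeOf_add_le l (P * discPoly c₁ c₂ c₃ (pairs n) ^ m')
      (P' * discPoly c₁ c₂ c₃ (pairs n) ^ m)
    have e := hd m
    have e' := hd m'
    rw [add_mul]
    omega
  · beta_reduce
    rw [h3 z hz, h3' z hz, map_add, map_mul, map_mul, map_pow, map_pow, eval_discPoly hz, disc_eq]
    have := disc_ne_zero hz
    rw [pow_add]
    field_simp

/-- The coordinate `y_l` as a function of all sequences `z`. -/
def yRaw (l : ℕ) (z : ℕ → ℂ) : ℂ := 1 / (z l - z 1)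

theorem one_div_sub_eq {z : ℕ → ℂ} (hz : z ∈ config n c₁ c₂ c₃) {e : Σ _ : ℕ, ℕ}
    (he : e ∈ pairs n) : 1 / (z e.1 - z e.2) =
      MvPolynomial.eval z (discPoly c₁ c₂ c₃ ((pairs n).erase e)) /
        ∏ i ∈ Finset.Icc 1 n, ∏ j ∈ Finset.Ioc i n, (z i - z j) := by
  have h0 : z e.1 - z e.2 ≠ 0 := sub_ne_zero.2 (config_ne ⟨z, hz⟩ (mem_pairs he).1
    (mem_pairs he).2.1 (mem_pairs he).2.2.ne)
  have h1 := disc_ne_zero hz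
  rw [disc_eq, eval_discPoly hz, div_eq_div_iff h0 h1, one_mul, Finset.prod_erase_mul _ _ he]

theorem one_mem_pairs {l : ℕ} (hl : l ∈ Finset.Icc 2 n) : (⟨1, l⟩ : Σ _ : ℕ, ℕ) ∈ pairs n := by
  simp only [pairs, Finset.mem_sigma, Finset.mem_Icc, Finset.mem_Ioc] at hl ⊢
  omega

theorem yRaw_eq {z : ℕ → ℂ} (hz : z ∈ config n c₁ c₂ c₃) {l : ℕ} (hl : l ∈ Finset.Icc 2 n) :
    yRaw l z = MvPolynomial.eval z (-discPoly c₁ c₂ c₃ ((pairs n).erase ⟨1, l⟩)) /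
        ∏ i ∈ Finset.Icc 1 n, ∏ j ∈ Finset.Ioc i n, (z i - z j) := by
  rw [map_neg, neg_div, ← one_div_sub_eq hz (one_mem_pairs hl), yRaw,
    ← one_div_neg_eq_neg_one_div, neg_sub]

theorem isRegularForm_yRaw {l : ℕ} (hl : l ∈ Finset.Icc 4 n) :
    IsRegularForm n c₁ c₂ c₃ ∅ (yRaw l) := by
  have hl2 : l ∈ Finset.Icc 2 n := by simp only [Finset.mem_Icc] at hl ⊢; omega
  refine ⟨1, -discPoly c₁ c₂ c₃ ((pairs n).erase ⟨1, l⟩), ?_, fun l' hl' => ?_, fun z hz => ?_⟩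
  · rw [MvPolynomial.vars_neg]
    exact vars_discPoly (Finset.erase_subset _ _)
  · rw [MvPolynomial.degreeOf_neg]
    have := degreeOf_discPoly_erase (c₁ := c₁) (c₂ := c₂) (c₃ := c₃) (l := l')
      (by simp only [Finset.mem_Icc] at hl' ⊢; omega) (one_mem_pairs hl2)
    simp only [Finset.notMem_empty, if_false]
    omega
  · rw [pow_one, yRaw_eq hz hl2]

theorem isRegularForm_yRaw_sq {l : ℕ} (hl : l ∈ Finset.Icc 4 n) :
    IsRegularForm n c₁ c₂ c₃ {l} (fun z => yRaw l z ^ 2) := by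
  have hl2 : l ∈ Finset.Icc 2 n := by simp only [Finset.mem_Icc] at hl ⊢; omega
  refine ⟨2, (-discPoly c₁ c₂ c₃ ((pairs n).erase ⟨1, l⟩)) ^ 2, ?_, fun l' hl' => ?_,
    fun z hz => ?_⟩
  · refine (MvPolynomial.vars_pow _ _).trans ?_
    rw [MvPolynomial.vars_neg]
    exact vars_discPoly (Finset.erase_subset _ _)
  · have h := degreeOf_discPoly_erase (c₁ := c₁) (c₂ := c₂) (c₃ := c₃) (l := l')
      (by simp only [Finset.mem_Icc] at hl' ⊢; omega) (one_mem_pairs hl2)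
    have h' := MvPolynomial.degreeOf_pow_le l' (-discPoly c₁ c₂ c₃ ((pairs n).erase ⟨1, l⟩)) 2
    rw [MvPolynomial.degreeOf_neg] at h'
    simp only [Finset.mem_singleton]
    simp only at h
    split_ifs at h ⊢ <;> omega
  · beta_reduce
    rw [yRaw_eq hz hl2, map_pow, div_pow]

theorem isRegularForm_rFun {i j : ℕ} (hi : i ∈ Finset.Icc 2 n) (hj : j ∈ Finset.Icc 2 n)
    (hij : i < j) :
    IsRegularForm n c₁ c₂ c₃ ∅ (liftFun (rFun (c₁ := c₁) i j : config n c₁ c₂ c₃ → ℂ)) := by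
  have he : (⟨i, j⟩ : Σ _ : ℕ, ℕ) ∈ pairs n := by
    simp only [pairs, Finset.mem_sigma, Finset.mem_Icc, Finset.mem_Ioc] at hi hj ⊢
    omega
  have h1 : 1 ∈ Finset.Icc 1 n := by simp only [Finset.mem_Icc] at hi ⊢; omega
  refine ⟨1, (coordPoly c₁ c₂ c₃ i - coordPoly c₁ c₂ c₃ 1) *
    (coordPoly c₁ c₂ c₃ 1 - coordPoly c₁ c₂ c₃ j) * discPoly c₁ c₂ c₃ ((pairs n).erase ⟨i, j⟩),
    ?_, fun l hl => ?_, fun z hz => ?_⟩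
  · refine (MvPolynomial.vars_mul _ _).trans (Finset.union_subset
      ((MvPolynomial.vars_mul _ _).trans (Finset.union_subset ?_ ?_)) ?_)
    · exact vars_coordPoly_sub (mem_Icc_one hi) h1
    · exact vars_coordPoly_sub h1 (mem_Icc_one hj)
    · exact vars_discPoly (Finset.erase_subset _ _)
  · have h := degreeOf_discPoly_erase (c₁ := c₁) (c₂ := c₂) (c₃ := c₃) (l := l)
      (by simp only [Finset.mem_Icc] at hl ⊢; omega) he
    have a := MvPolynomial.degreeOf_mul_le l ((coordPoly c₁ c₂ c₃ i - coordPoly c₁ c₂ c₃ 1) *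
      (coordPoly c₁ c₂ c₃ 1 - coordPoly c₁ c₂ c₃ j)) (discPoly c₁ c₂ c₃ ((pairs n).erase ⟨i, j⟩))
    have b := MvPolynomial.degreeOf_mul_le l (coordPoly c₁ c₂ c₃ i - coordPoly c₁ c₂ c₃ 1)
      (coordPoly c₁ c₂ c₃ 1 - coordPoly c₁ c₂ c₃ j)
    have d := degreeOf_coordPoly_sub (c₁ := c₁) (c₂ := c₂) (c₃ := c₃) i 1 l
    have d' := degreeOf_coordPoly_sub (c₁ := c₁) (c₂ := c₂) (c₃ := c₃) 1 j l
    have hl1 : l ≠ 1 := by simp only [Finset.mem_Icc] at hl; omega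
    rw [if_neg hl1] at d d'
    simp only [Finset.notMem_empty, if_false]
    simp only at h
    omega
  · have hne : ∀ {a b : ℕ}, a ∈ Finset.Icc 1 n → b ∈ Finset.Icc 1 n → a ≠ b → z a - z b ≠ 0 :=
      fun ha hb hab => sub_ne_zero.2 (config_ne ⟨z, hz⟩ ha hb hab)
    have n1 := hne (mem_Icc_one hi) h1 (by simp only [Finset.mem_Icc] at hi; omega)
    have n2 := hne (mem_Icc_one hj) h1 (by simp only [Finset.mem_Icc] at hj; omega)
    have n3 := hne (mem_Icc_one hi) (mem_Icc_one hj) hij.ne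
    rw [liftFun_of_mem _ hz, pow_one, map_mul, mul_div_assoc, ← one_div_sub_eq hz he, map_mul,
      map_sub, map_sub, eval_coordPoly hz, eval_coordPoly hz, eval_coordPoly hz]
    have e : rFun i j ⟨z, hz⟩ = 1 / (1 / (z i - z 1) - 1 / (z j - z 1)) := rfl
    have e2 : 1 / (z i - z 1) - 1 / (z j - z 1) = -(z i - z j) / ((z i - z 1) * (z j - z 1)) := by
      field_simp
      ring
    rw [e, e2]
    field_simp
    ring

theorem isRegularForm_liftFun (b : RegRing n c₁ c₂ c₃) :
    IsRegularForm n c₁ c₂ c₃ ∅ (liftFun b.1) := by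
  have hneg : ∀ {f : (ℕ → ℂ) → ℂ}, IsRegularForm n c₁ c₂ c₃ ∅ f →
      IsRegularForm n c₁ c₂ c₃ ∅ (fun z => -1 * f z) := fun hf => (isRegularForm_const _).mul hf
  obtain ⟨f, hf⟩ := b
  induction hf using Algebra.adjoin_induction with
  | mem f hf =>
    rcases hf with ⟨j, hj, rfl⟩ | ⟨i, hi, j, hj, rfl⟩
    · exact (isRegularForm_yRaw hj).congr fun z hz => by rw [liftFun_of_mem _ hz]; rfl
    · rcases lt_trichotomy i j with h | rfl | h
      · exact isRegularForm_rFun hi hj h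
      · exact (isRegularForm_const 0).congr fun z hz => by
          rw [liftFun_of_mem _ hz]
          exact show 1 / (yFun i _ - yFun i _) = (0 : ℂ) by rw [sub_self, div_zero]
      · refine (hneg (isRegularForm_rFun hj hi h)).congr fun z hz => ?_
        rw [liftFun_of_mem _ hz, liftFun_of_mem _ hz]
        change 1 / (yFun i _ - yFun j _) = -1 * (1 / (yFun j _ - yFun i _))
        rw [one_div, one_div, neg_one_mul, ← inv_neg, neg_sub]
  | algebraMap r =>
    exact (isRegularForm_const r).congr fun z hz => by
      rw [liftFun_of_mem _ hz]; rfl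
  | add f g _ _ hf hg =>
    exact (hf.add hg).congr fun z hz => by
      rw [liftFun_of_mem _ hz, liftFun_of_mem _ hz, liftFun_of_mem _ hz]; rfl
  | mul f g _ _ hf hg =>
    exact (hf.mul hg).congr fun z hz => by
      rw [liftFun_of_mem _ hz, liftFun_of_mem _ hz, liftFun_of_mem _ hz]; rfl

theorem isRegularForm_prod_sq (S : Finset ℕ) (hS : S ⊆ Finset.Icc 4 n) :
    IsRegularForm n c₁ c₂ c₃ S (fun z => ∏ l ∈ S, yRaw l z ^ 2) := by
  induction S using Finset.induction_on with
  | empty => simpa using isRegularForm_const 1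
  | insert l S hl ih =>
    refine ((isRegularForm_yRaw_sq (hS (Finset.mem_insert_self _ _))).mul
      (ih ((Finset.subset_insert _ _).trans hS))).congr fun z _ => ?_
    rw [Finset.prod_insert hl]

/-- A regular function of the `y_l` times `∏_{l ∈ S} y_l²` is the coefficient of a regular form. The
squares come from `dz_l = -dy_l / y_l²` and encode the absence of a pole at `z_l = ∞`, which is the
point `y_l = 0`. `IsRegularForm.exists_eq` is the converse. -/
theorem isRegularForm_of_eq {S : Finset ℕ} (hS : S ⊆ Finset.Icc 4 n) (b : RegRing n c₁ c₂ c₃) :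
    IsRegularForm n c₁ c₂ c₃ S (fun z => (∏ l ∈ S, yRaw l z ^ 2) * liftFun b.1 z) := by
  have h := (isRegularForm_prod_sq (c₁ := c₁) (c₂ := c₂) (c₃ := c₃) S hS).mul
    (isRegularForm_liftFun b)
  rwa [Finset.union_empty] at h

/-- Evaluation of regular functions at a point. -/
def ev (z : config n c₁ c₂ c₃) : RegRing n c₁ c₂ c₃ →ₐ[ℂ] ℂ :=
  (Pi.evalAlgHom ℂ (fun _ : config n c₁ c₂ c₃ => ℂ) z).comp (regAlg n c₁ c₂ c₃).val

theorem RegRing.ext_ev {f g : RegRing n c₁ c₂ c₃} (h : ∀ z, ev z f = ev z g) : f = g :=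
  RegRing.ext_iff'.2 h

theorem ev_Y {l : ℕ} (hl : l ∈ Finset.Icc 2 n) (z : config n c₁ c₂ c₃) :
    ev z (Y l) = yFun l z := Y_apply hl z

theorem ev_R {i j : ℕ} (hi : i ∈ Finset.Icc 2 n) (hj : j ∈ Finset.Icc 2 n)
    (z : config n c₁ c₂ c₃) : ev z (R i j) = 1 / (yFun i z - yFun j z) := R_apply hi hj z

/-- Up to a regular function, `1 / (z_i - z_j)` is the product of those of `y_i`, `y_j` that are
not constant. -/
theorem exists_one_div_sub {e : Σ _ : ℕ, ℕ} (he : e ∈ pairs n) :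
    ∃ ρ : RegRing n c₁ c₂ c₃, ∀ z : config n c₁ c₂ c₃, 1 / (z.1 e.1 - z.1 e.2) =
      ev z ρ * ((if 4 ≤ e.1 then yFun e.1 z else 1) * (if 4 ≤ e.2 then yFun e.2 z else 1)) := by
  have hE : ∀ l ∈ Finset.Icc 2 n, ∀ z : config n c₁ c₂ c₃,
      yFun l z = ev z (if 4 ≤ l then 1 else Y l) * (if 4 ≤ l then yFun l z else 1) := by
    intro l hl z
    split_ifs
    · rw [map_one, one_mul]
    · rw [ev_Y hl, mul_one]
  obtain ⟨i, j⟩ := e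
  have h := mem_pairs he
  simp only [Finset.mem_Icc] at h
  have hj : j ∈ Finset.Icc 2 n := Finset.mem_Icc.2 (by omega)
  by_cases hi1 : i = 1
  · subst hi1
    refine ⟨-(if 4 ≤ j then 1 else Y j), fun z => ?_⟩
    rw [if_neg (by norm_num : ¬ 4 ≤ 1), one_mul, map_neg, neg_mul, ← hE j hj z, yFun,
      ← one_div_neg_eq_neg_one_div, neg_sub]
  · have hi : i ∈ Finset.Icc 2 n := Finset.mem_Icc.2 (by omega)
    refine ⟨(if 4 ≤ i then 1 else Y i) * (if 4 ≤ j then 1 else Y j) * R j i, fun z => ?_⟩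
    have n1 := yFun_ne_zero hi z
    have n2 := yFun_ne_zero hj z
    have n3 := yFun_ne hj hi (by omega) z
    have n4 : z.1 i - z.1 1 ≠ 0 := fun h0 => n1 (by rw [yFun, h0, div_zero])
    have n5 : z.1 j - z.1 1 ≠ 0 := fun h0 => n2 (by rw [yFun, h0, div_zero])
    have n6 : z.1 i - z.1 j ≠ 0 := sub_ne_zero.2 (config_ne z (mem_Icc_one hi) (mem_Icc_one hj)
      (by omega))
    trans yFun i z * yFun j z * (1 / (yFun j z - yFun i z))
    · have e2 : yFun j z - yFun i z = (z.1 i - z.1 j) / ((z.1 i - z.1 1) * (z.1 j - z.1 1)) := by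
        rw [yFun, yFun]
        field_simp
        ring
      rw [e2, yFun, yFun]
      field_simp
    · rw [map_mul, map_mul, ev_R hj hi]
      linear_combination (yFun j z * (1 / (yFun j z - yFun i z))) * hE i hi z +
        (ev z (if 4 ≤ i then 1 else Y i) * (if 4 ≤ i then yFun i z else 1) *
          (1 / (yFun j z - yFun i z))) * hE j hj z

/-- The inverse discriminant is a regular function of the `y_l`, divisible by `y_l^(n-1)` for each
`l ≥ 4`; in particular it vanishes to order `n - 1` at `z_l = ∞`. -/
theorem exists_one_div_disc (n : ℕ) (c₁ c₂ c₃ : ℂ) :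
    ∃ u : RegRing n c₁ c₂ c₃, ∀ z : config n c₁ c₂ c₃,
      1 / ∏ i ∈ Finset.Icc 1 n, ∏ j ∈ Finset.Ioc i n, (z.1 i - z.1 j) =
        ev z u * ∏ l ∈ Finset.Icc 4 n, yFun l z ^ (n - 1) := by
  choose! ρ hρ using fun (e : Σ _ : ℕ, ℕ) (he : e ∈ pairs n) =>
    exists_one_div_sub (c₁ := c₁) (c₂ := c₂) (c₃ := c₃) he
  refine ⟨∏ e ∈ pairs n, ρ e, fun z => ?_⟩
  have h := prod_pairs (fun l => if 4 ≤ l then yFun l z else 1) n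
  rw [Finset.prod_sigma'] at h
  rw [disc_eq, one_div, ← Finset.prod_inv_distrib]
  simp only [← one_div]
  rw [Finset.prod_congr rfl fun e he => hρ e he z, Finset.prod_mul_distrib, map_prod]
  congr 1
  refine h.trans ?_
  have hsub : Finset.Icc 4 n ⊆ Finset.Icc 1 n := Finset.Icc_subset_Icc_left (by norm_num)
  rw [← Finset.prod_subset hsub]
  · exact Finset.prod_congr rfl fun l hl => by rw [if_pos (Finset.mem_Icc.1 hl).1]
  · intro l hl hl'
    simp only [Finset.mem_Icc] at hl hl'
    rw [if_neg (by omega), one_pow]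

/-- The coefficient of a regular form is `∏_{l ∈ S} y_l²` times a regular function of the `y_l`: the
degree bounds on the numerator are what makes all exponents of the `y_l` non-negative. -/
theorem IsRegularForm.exists_eq {S : Finset ℕ} (hS : S ⊆ Finset.Icc 4 n) {f : (ℕ → ℂ) → ℂ}
    (hf : IsRegularForm n c₁ c₂ c₃ S f) :
    ∃ b : RegRing n c₁ c₂ c₃, ∀ z : config n c₁ c₂ c₃,
      f z.1 = (∏ l ∈ S, yFun l z ^ 2) * ev z b := by
  obtain ⟨m, P, h1, h2, h3⟩ := hf
  obtain ⟨u, hu⟩ := exists_one_div_disc n c₁ c₂ c₃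
  let e : ℕ → ℕ := fun l => if l ∈ S then 2 else 0
  refine ⟨u ^ m * ∑ d ∈ P.support, P.coeff d • ∏ l ∈ Finset.Icc 4 n,
    ((c₁ • Y l + 1) ^ d l * Y l ^ (m * (n - 1) - d l - e l)), fun z => ?_⟩
  have hprod : ∏ l ∈ S, yFun l z ^ 2 = ∏ l ∈ Finset.Icc 4 n, yFun l z ^ e l := by
    rw [← Finset.prod_subset hS]
    · exact Finset.prod_congr rfl fun l hl => by simp only [e, if_pos hl]
    · intro l _ hl
      simp only [e, if_neg hl, pow_zero]
  rw [h3 z.1 z.2, div_eq_mul_one_div, ← one_div_pow, hu z, mul_pow, MvPolynomial.eval_eq,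
    map_mul, map_pow, map_sum, hprod, Finset.mul_sum, Finset.sum_mul, Finset.mul_sum]
  refine Finset.sum_congr rfl fun d hd => ?_
  have hd1 : ∏ i ∈ d.support, z.1 i ^ d i = ∏ i ∈ Finset.Icc 4 n, z.1 i ^ d i := by
    refine Finset.prod_subset (fun i hi => h1 ?_) fun i _ hi => ?_
    · exact (MvPolynomial.mem_vars_iff_mem_support i).2 ⟨d, hd, hi⟩
    · rw [Finsupp.notMem_support_iff.1 hi, pow_zero]
  have hd2 : (∏ i ∈ Finset.Icc 4 n, z.1 i ^ d i) * (∏ l ∈ Finset.Icc 4 n, yFun l z ^ (n - 1)) ^ m =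
      (∏ l ∈ Finset.Icc 4 n, yFun l z ^ e l) * ∏ l ∈ Finset.Icc 4 n,
        ((c₁ * yFun l z + 1) ^ d l * yFun l z ^ (m * (n - 1) - d l - e l)) := by
    rw [← Finset.prod_pow, ← Finset.prod_mul_distrib, ← Finset.prod_mul_distrib]
    refine Finset.prod_congr rfl fun l hl => ?_
    have hl2 : l ∈ Finset.Icc 2 n := by simp only [Finset.mem_Icc] at hl ⊢; omega
    have a := h2 l hl
    have a' : d l ≤ P.degreeOf l := MvPolynomial.monomial_le_degreeOf l hd
    have a'' : d l + e l ≤ m * (n - 1) := by simp only [e]; omega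
    have hz : c₁ * yFun l z + 1 = z.1 l * yFun l z := by
      have h0 : z.1 l - z.1 1 ≠ 0 := fun h0 => yFun_ne_zero hl2 z (by rw [yFun, h0, div_zero])
      have h1 := z.2.1
      rw [yFun]
      field_simp
      linear_combination -h1
    rw [hz, mul_pow, ← pow_mul]
    have : (n - 1) * m = e l + d l + (m * (n - 1) - d l - e l) := by
      rw [mul_comm]; omega
    rw [this, pow_add, pow_add]
    ring
  rw [map_smul, map_prod, smul_eq_mul, hd1]
  have hd3 : ∏ l ∈ Finset.Icc 4 n, ev z ((c₁ • Y l + 1) ^ d l * Y l ^ (m * (n - 1) - d l - e l)) =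
      ∏ l ∈ Finset.Icc 4 n, ((c₁ * yFun l z + 1) ^ d l * yFun l z ^ (m * (n - 1) - d l - e l)) :=
    Finset.prod_congr rfl fun l hl => by
      have hl2 : l ∈ Finset.Icc 2 n := by simp only [Finset.mem_Icc] at hl ⊢; omega
      rw [map_mul, map_pow, map_pow, map_add, map_smul, map_one, ev_Y hl2, smul_eq_mul]
  rw [hd3]
  linear_combination P.coeff d * (ev z) u ^ m * hd2

end RegularForms

/-! ### The twisted differential in the coordinates `y` -/

section Twisted

open Filter Topology

variable {n : ℕ} {c₁ c₂ c₃ : ℂ}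

/-- The twisted derivative `∂/∂y_l + ∑_j s_{lj} / (y_l - y_j)` on regular functions, where `j` runs
over the punctures `2, …, n` at finite distance. -/
def covD (s : ℕ → ℕ → ℂ) (l : ℕ) : RegRing n c₁ c₂ c₃ →ₗ[ℂ] RegRing n c₁ c₂ c₃ where
  toFun f := pd l f + (∑ j ∈ Finset.Icc 2 n, s l j • R l j) * f
  map_add' f g := by rw [map_add]; ring
  map_smul' r f := by rw [Derivation.map_smul, mul_smul_comm, smul_add, RingHom.id_apply]

theorem covD_apply (s : ℕ → ℕ → ℂ) (l : ℕ) (f : RegRing n c₁ c₂ c₃) :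
    covD s l f = pd l f + (∑ j ∈ Finset.Icc 2 n, s l j • R l j) * f := rfl

theorem covD_mul (s : ℕ → ℕ → ℂ) (l : ℕ) (f g : RegRing n c₁ c₂ c₃) :
    covD s l (f * g) = pd l f * g + f * covD s l g := by
  rw [covD_apply, covD_apply, Derivation.leibniz, smul_eq_mul, smul_eq_mul]
  ring

theorem covD_mul_of_pd_eq_zero (s : ℕ → ℕ → ℂ) (l : ℕ) {f : RegRing n c₁ c₂ c₃}
    (hf : pd l f = 0) (g : RegRing n c₁ c₂ c₃) : covD s l (f * g) = f * covD s l g := by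
  rw [covD_mul, hf, zero_mul, zero_add]

/-- The regular functions that, as relative top forms, are twisted-exact along the fibre with
coordinates `y_{p+1}, …, y_n`. -/
def exactForms (s : ℕ → ℕ → ℂ) (p : ℕ) : Submodule ℂ (RegRing n c₁ c₂ c₃) where
  carrier := {f | ∃ g : ℕ → RegRing n c₁ c₂ c₃, f = ∑ l ∈ Finset.Ioc p n, covD s l (g l)}
  zero_mem' := ⟨0, by simp⟩
  add_mem' := by
    rintro _ _ ⟨g, rfl⟩ ⟨g', rfl⟩
    exact ⟨g + g', by simp [Finset.sum_add_distrib]⟩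
  smul_mem' := by
    rintro r _ ⟨g, rfl⟩
    exact ⟨r • g, by simp [Finset.smul_sum]⟩

/-- The fibration basis in the coordinates `y`: the coefficient of `dy_{p+1} ∧ ⋯ ∧ dy_n` in
`⋀_l dy_l / (y_l - y_{w(l)})`. -/
def basisY {p : ℕ} (w : Word n p) : RegRing n c₁ c₂ c₃ :=
  ∏ l : ↥(Finset.Ioc p n), R l (w l)

/-- The Gauss-Manin equation of the fibration basis in the coordinates `y`. -/
def SolvesGMY (c₁ c₂ c₃ : ℂ) (s : ℕ → ℕ → ℂ) (κ : ℂ) (p : ℕ) (Ω : MatrixFamily n p) : Prop :=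
  ∀ i ∈ Finset.Icc 4 p, ∀ a : Word n p,
    covD s i (basisY a) - κ • ∑ j ∈ (Finset.Icc 2 p).erase i,
      R i j * ∑ b : Word n p, Ω i j a b • basisY b ∈
        (exactForms s p : Submodule ℂ (RegRing n c₁ c₂ c₃))

/-- The exponents `2 p_i · p_j / Λ²` of the twist. -/
def twistExp {D : ℕ} (Λ : ℝ) (k : ℕ → Fin (D + 1) → ℂ) (i j : ℕ) : ℂ :=
  (1 / (Λ : ℂ) ^ 2) * (2 * mdot (k i) (k j))

/-- Weights `w_j` with vanishing sum do not see the puncture that has been moved to infinity. -/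
theorem sum_weights_eq {p l : ℕ} (hp : p ≤ n) (hl : l ∈ Finset.Icc 2 p) (w : ℕ → ℂ)
    (hw : ∑ j ∈ (Finset.Icc 1 p).erase l, w j = 0) (z : config n c₁ c₂ c₃) :
    ∑ j ∈ (Finset.Icc 1 p).erase l, w j / (z.1 l - z.1 j) =
      -(yFun l z) ^ 2 * ∑ j ∈ (Finset.Icc 2 p).erase l, w j * ev z (R l j) := by
  have hln : l ∈ Finset.Icc 2 n := Finset.Icc_subset_Icc_right hp hl
  have h1 : Finset.Icc 1 p = insert 1 (Finset.Icc 2 p) := by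
    ext x; simp only [Finset.mem_Icc, Finset.mem_insert] at hl ⊢; omega
  have hl1 : 1 ≠ l := by simp only [Finset.mem_Icc] at hl; omega
  have h1' : (1 : ℕ) ∉ (Finset.Icc 2 p).erase l := by simp
  rw [h1, Finset.erase_insert_of_ne hl1, Finset.sum_insert h1'] at hw ⊢
  have key : ∀ j ∈ (Finset.Icc 2 p).erase l, w j / (z.1 l - z.1 j) =
      yFun l z * w j + -(yFun l z) ^ 2 * (w j * ev z (R l j)) := by
    intro j hj
    have hjl := Finset.ne_of_mem_erase hj
    have hjn : j ∈ Finset.Icc 2 n :=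
      Finset.Icc_subset_Icc_right hp (Finset.mem_of_mem_erase hj)
    have n1 : z.1 l - z.1 1 ≠ 0 := fun h0 => yFun_ne_zero hln z (by rw [yFun, h0, div_zero])
    have n2 : z.1 j - z.1 1 ≠ 0 := fun h0 => yFun_ne_zero hjn z (by rw [yFun, h0, div_zero])
    have n3 : z.1 l - z.1 j ≠ 0 := sub_ne_zero.2 (config_ne z (mem_Icc_one hln) (mem_Icc_one hjn)
      hjl.symm)
    have n4 : z.1 j - z.1 l ≠ 0 := sub_ne_zero.2 (config_ne z (mem_Icc_one hjn) (mem_Icc_one hln)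
      hjl)
    have e2 : yFun l z - yFun j z = (z.1 j - z.1 l) / ((z.1 l - z.1 1) * (z.1 j - z.1 1)) := by
      rw [yFun, yFun]
      field_simp
      ring
    rw [ev_R hln hjn, e2, yFun]
    field_simp
    ring
  rw [Finset.sum_congr rfl key, Finset.sum_add_distrib, ← Finset.mul_sum, ← Finset.mul_sum, yFun]
  linear_combination (1 / (z.1 l - z.1 1)) * hw

theorem yRaw_update {l l' : ℕ} (h : l' ≠ l) (hl : 1 ≠ l) (z : ℕ → ℂ) (t : ℂ) :
    yRaw l' (Function.update z l t) = yRaw l' z := by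
  rw [yRaw, yRaw, Function.update_of_ne h, Function.update_of_ne hl]

variable {D : ℕ} {Λ : ℝ} {k : ℕ → Fin (D + 1) → ℂ}

/-- The exponents at a puncture add up to zero. -/
def TwistBalanced (n : ℕ) (k : ℕ → Fin (D + 1) → ℂ) : Prop :=
  ∀ l ∈ Finset.Icc 1 n, ∑ j ∈ (Finset.Icc 1 n).erase l, 2 * mdot (k l) (k j) = 0

theorem omegaComp_eq (hk : TwistBalanced n k) {l : ℕ} (hl : l ∈ Finset.Icc 2 n)
    (z : config n c₁ c₂ c₃) :
    omegaComp n Λ k l z.1 =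
      -(yFun l z) ^ 2 * ev z (∑ j ∈ Finset.Icc 2 n, twistExp Λ k l j • R l j) := by
  have h := sum_weights_eq le_rfl hl (fun j => 2 * mdot (k l) (k j)) (hk l (mem_Icc_one hl)) z
  rw [omegaComp, h, ← Finset.add_sum_erase _ _ hl, R_self, smul_zero, zero_add, map_sum,
    mul_left_comm, Finset.mul_sum]
  congr 1
  refine Finset.sum_congr rfl fun j _ => ?_
  rw [map_smul, smul_eq_mul, twistExp]
  ring

/-- On forms, `∇_ω` becomes the twisted derivative in the coordinate `y_l`; the factor
`-y_l²` is absorbed by `dz_l = -dy_l / y_l²`. -/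
theorem twistedD_eq (hk : TwistBalanced n k) {l : ℕ} (hl : l ∈ Finset.Icc 4 n) {S : Finset ℕ}
    (hlS : l ∉ S) {f : (ℕ → ℂ) → ℂ} {b : RegRing n c₁ c₂ c₃}
    (hf : ∀ z : config n c₁ c₂ c₃, f z.1 = (∏ l ∈ S, yFun l z ^ 2) * ev z b)
    (z : config n c₁ c₂ c₃) :
    twistedD n Λ k l f z.1 =
      -((∏ l ∈ insert l S, yFun l z ^ 2) * ev z (covD (twistExp Λ k) l b)) := by
  have hl2 : l ∈ Finset.Icc 2 n := by simp only [Finset.mem_Icc] at hl ⊢; omega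
  have hl1 : 1 ≠ l := by simp only [Finset.mem_Icc] at hl; omega
  have hd : HasDerivAt (fun t => f (Function.update z.1 l t))
      ((∏ l ∈ S, yFun l z ^ 2) * (-(yFun l z) ^ 2 * ev z (pd l b))) (z.1 l) := by
    refine ((pd_spec hl b z).const_mul (∏ l ∈ S, yFun l z ^ 2)).congr_of_eventuallyEq ?_
    filter_upwards [eventually_update_mem_config hl z] with t ht
    rw [liftFun_of_mem _ ht, hf ⟨_, ht⟩]
    refine congrArg (· * _) (Finset.prod_congr rfl fun l' hl' => ?_)
    exact congrArg (· ^ 2) (yRaw_update (fun h => hlS (by rwa [h] at hl')) hl1 z.1 t)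
  rw [twistedD, pderivAt, hd.deriv, omegaComp_eq hk hl2, hf z, Finset.prod_insert hlS, covD_apply,
    map_add, map_mul]
  ring

theorem Ioc_subset_Icc_four {p : ℕ} (hp : 3 ≤ p) : Finset.Ioc p n ⊆ Finset.Icc 4 n := by
  intro l hl
  simp only [Finset.mem_Ioc, Finset.mem_Icc] at hl ⊢
  omega

/-- Exactness along the fibre in the coordinates `y`. The primitives lose the signs that
`dz_l = -dy_l / y_l²` introduces. -/
theorem fibreExact_iff (hk : TwistBalanced n k) {p i : ℕ} (hp : 3 ≤ p) (hpn : p ≤ n)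
    (hi : i ∈ Finset.Icc 4 p) {f : (ℕ → ℂ) → ℂ} {b : RegRing n c₁ c₂ c₃}
    (hf : ∀ z : config n c₁ c₂ c₃,
      f z.1 = (∏ l ∈ insert i (Finset.Ioc p n), yFun l z ^ 2) * ev z b) :
    FibreExact n Λ k c₁ c₂ c₃ p i f ↔ b ∈ exactForms (twistExp Λ k) p := by
  rw [Finset.mem_Icc] at hi
  have hS : ∀ l, insert i ((Finset.Ioc p n).erase l) ⊆ Finset.Icc 4 n := fun l =>
    Finset.insert_subset (Finset.mem_Icc.2 (by omega))
      ((Finset.erase_subset _ _).trans (Ioc_subset_Icc_four hp))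
  have hlS : ∀ l ∈ Finset.Ioc p n, l ∉ insert i ((Finset.Ioc p n).erase l) := fun l hl => by
    rw [Finset.mem_Ioc] at hl
    rw [Finset.mem_insert, not_or]
    exact ⟨by omega, Finset.notMem_erase _ _⟩
  have hins : ∀ l ∈ Finset.Ioc p n, insert l (insert i ((Finset.Ioc p n).erase l)) =
      insert i (Finset.Ioc p n) := fun l hl => by
    rw [Finset.insert_comm, Finset.insert_erase hl]
  have hW : ∀ z : config n c₁ c₂ c₃, ∏ l ∈ insert i (Finset.Ioc p n), yFun l z ^ 2 ≠ 0 := by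
    intro z
    refine Finset.prod_ne_zero_iff.2 fun l hl => pow_ne_zero _ (yFun_ne_zero ?_ z)
    rw [Finset.mem_insert, Finset.mem_Ioc] at hl
    rw [Finset.mem_Icc]
    omega
  constructor
  · rintro ⟨g, hg, hfg⟩
    have hg' : ∀ l, ∃ b : RegRing n c₁ c₂ c₃, l ∈ Finset.Ioc p n → ∀ z : config n c₁ c₂ c₃,
        g l z.1 = (∏ l ∈ insert i ((Finset.Ioc p n).erase l), yFun l z ^ 2) * ev z b := by
      intro l
      by_cases hl : l ∈ Finset.Ioc p n
      · obtain ⟨b, hb⟩ := (hg l hl).exists_eq (hS l)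
        exact ⟨b, fun _ => hb⟩
      · exact ⟨0, fun h => absurd h hl⟩
    choose B hB using hg'
    refine ⟨fun l => -B l, RegRing.ext_ev fun z => mul_left_cancel₀ (hW z) ?_⟩
    rw [← hf z, hfg z.1 z.2, map_sum, Finset.mul_sum]
    refine Finset.sum_congr rfl fun l hl => ?_
    rw [twistedD_eq hk (Ioc_subset_Icc_four hp hl) (hlS l hl) (hB l hl) z, hins l hl, map_neg,
      map_neg, mul_neg]
  · rintro ⟨g, rfl⟩
    refine ⟨fun l z => (∏ l ∈ insert i ((Finset.Ioc p n).erase l), yRaw l z ^ 2) *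
      liftFun (-g l).1 z, fun l _ => isRegularForm_of_eq (hS l) _, fun z hz => ?_⟩
    rw [hf ⟨z, hz⟩, map_sum, Finset.mul_sum]
    refine Finset.sum_congr rfl fun l hl => ?_
    rw [twistedD_eq hk (Ioc_subset_Icc_four hp hl) (hlS l hl) (b := -g l)
      (fun z => by beta_reduce; rw [liftFun_apply]; rfl) ⟨z, hz⟩, hins l hl, map_neg,
      map_neg, mul_neg, neg_neg]

/-- The fibration basis of forms in `z` is, up to sign, the one in `y`, since
`dz_l / (z_l - z_j) - dz_l / (z_l - z_1) = dy_l / (y_l - y_j)`. -/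
theorem fibrationBasis_eq {p : ℕ} (hp : 3 ≤ p) (a : Word n p) (z : config n c₁ c₂ c₃) :
    fibrationBasis n p a z.1 =
      (∏ l ∈ Finset.Ioc p n, yFun l z ^ 2) * ev z ((-1 : ℂ) ^ (n - p) • basisY a) := by
  have h : ∀ l : ↥(Finset.Ioc p n), 1 / (z.1 l - z.1 (a l)) - 1 / (z.1 l - z.1 1) =
      -1 * (yFun l z ^ 2 * ev z (R l (a l))) := by
    intro l
    have h1 := Finset.mem_Ioc.1 l.2
    have h2 := Finset.mem_Ico.1 (a l).2
    have hl : (l : ℕ) ∈ Finset.Icc 2 n := Finset.mem_Icc.2 (by omega)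
    have ha : (a l : ℕ) ∈ Finset.Icc 2 n := Finset.mem_Icc.2 (by omega)
    have hne : (a l : ℕ) ≠ l := by omega
    have n1 : z.1 l - z.1 1 ≠ 0 := fun h0 => yFun_ne_zero hl z (by rw [yFun, h0, div_zero])
    have n2 : z.1 (a l) - z.1 1 ≠ 0 := fun h0 => yFun_ne_zero ha z (by rw [yFun, h0, div_zero])
    have n3 : z.1 l - z.1 (a l) ≠ 0 := sub_ne_zero.2 (config_ne z (mem_Icc_one hl) (mem_Icc_one ha)
      hne.symm)
    have n4 : z.1 (a l) - z.1 l ≠ 0 := sub_ne_zero.2 (config_ne z (mem_Icc_one ha) (mem_Icc_one hl)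
      hne)
    have e2 : yFun l z - yFun (a l) z =
        (z.1 (a l) - z.1 l) / ((z.1 l - z.1 1) * (z.1 (a l) - z.1 1)) := by
      rw [yFun, yFun]
      field_simp
      ring
    rw [ev_R hl ha, e2, yFun]
    field_simp
    ring
  rw [fibrationBasis, Finset.prod_congr rfl fun l _ => h l, Finset.prod_mul_distrib,
    Finset.prod_mul_distrib, Finset.prod_const, map_smul, basisY, map_prod, smul_eq_mul,
    Finset.prod_coe_sort (Finset.Ioc p n) (fun l => yFun l z ^ 2), Finset.card_univ,
    Fintype.card_coe, Nat.card_Ioc]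
  ring

/-- The Gauss-Manin equation in the coordinates `y`. The term with `j = 1` disappears because the
twist and the braid matrices have vanishing row sums (`sum_weights_eq`). -/
theorem solvesGaussManin_iff (hk : TwistBalanced n k) {p : ℕ} (hp : 3 ≤ p) (hpn : p ≤ n)
    {Ω : MatrixFamily n p} (hΩ : IsAnsatz n p Ω) :
    SolvesGaussManin n Λ k c₁ c₂ c₃ p Ω ↔
      SolvesGMY c₁ c₂ c₃ (twistExp Λ k) (1 / (Λ : ℂ) ^ 2) p Ω := by
  refine forall₂_congr fun i hi => forall_congr' fun a => ?_
  have hi' := Finset.mem_Icc.1 hi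
  have hi2 : i ∈ Finset.Icc 2 p := Finset.mem_Icc.2 (by omega)
  have hi4 : i ∈ Finset.Icc 4 n := Finset.mem_Icc.2 (by omega)
  have hiS : i ∉ Finset.Ioc p n := by rw [Finset.mem_Ioc]; omega
  set ε : ℂ := (-1 : ℂ) ^ (n - p) with hε
  have hε0 : -ε ≠ 0 := neg_ne_zero.2 (pow_ne_zero _ (by norm_num))
  rw [fibreExact_iff hk hp hpn hi (b := (-ε) • (covD (twistExp Λ k) i (basisY a) -
    (1 / (Λ : ℂ) ^ 2) • ∑ j ∈ (Finset.Icc 2 p).erase i,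
      R i j * ∑ b : Word n p, Ω i j a b • basisY b)) ?_]
  · exact Submodule.smul_mem_iff _ hε0
  intro z
  have hw : ∑ j ∈ (Finset.Icc 1 p).erase i,
      (∑ b : Word n p, Ω i j a b * fibrationBasis n p b z.1) = 0 := by
    rw [Finset.sum_comm]
    refine Finset.sum_eq_zero fun b _ => ?_
    have h0 := congrFun (congrFun (hΩ.sum_eq_zero i (by rw [Finset.mem_Icc]; omega)) a) b
    rw [← Finset.add_sum_erase _ _ (mem_Icc_one hi2), hΩ.diag i (mem_Icc_one hi2), zero_add,
      Matrix.sum_apply] at h0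
    rw [← Finset.sum_mul, h0]
    exact zero_mul _
  rw [twistedD_eq hk hi4 hiS (fibrationBasis_eq hp a) z, sum_weights_eq hpn hi2 _ hw z,
    Finset.prod_insert hiS, map_smul, map_smul, map_smul, map_sub, map_smul, map_sum]
  have h : ∀ j ∈ (Finset.Icc 2 p).erase i,
      (∑ b : Word n p, Ω i j a b * fibrationBasis n p b z.1) * ev z (R i j) =
      (ε * ∏ l ∈ Finset.Ioc p n, yFun l z ^ 2) *
        ev z (R i j * ∑ b : Word n p, Ω i j a b • basisY b) := by
    intro j _
    rw [map_mul, map_sum, Finset.sum_mul, Finset.mul_sum, Finset.mul_sum]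
    refine Finset.sum_congr rfl fun b _ => ?_
    rw [fibrationBasis_eq hp, map_smul, map_smul, smul_eq_mul, smul_eq_mul]
    ring
  rw [Finset.sum_congr rfl h, ← Finset.mul_sum]
  simp only [smul_eq_mul]
  ring

theorem twistBalanced_of (momentum_conservation : ∑ i ∈ Finset.Icc 1 n, k i = 0)
    (massless : ∀ i ∈ Finset.Icc 1 n, mdot (k i) (k i) = 0) : TwistBalanced n k := by
  intro l hl
  have h0 : ∑ j ∈ Finset.Icc 1 n, mdot (k l) (k j) = 0 := by
    have hlin : ∑ j ∈ Finset.Icc 1 n, mdot (k l) (k j) =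
        mdot (k l) (∑ j ∈ Finset.Icc 1 n, k j) := by
      simp only [mdot, Finset.sum_apply, Finset.sum_add_distrib, Finset.sum_neg_distrib,
        Finset.mul_sum]
      rw [Finset.sum_comm]
    rw [hlin, momentum_conservation]
    simp [mdot]
  rw [← Finset.add_sum_erase _ _ hl, massless l hl, zero_add] at h0
  rw [← Finset.mul_sum, h0, mul_zero]

end Twisted

/-! ### Words and the blocks of the recursion -/

section Words

variable {n p : ℕ}

theorem Word.head_mem (hp : p < n) (a : Word n p) : a.head hp ∈ Finset.Ico 3 (p + 1) :=
  (a ⟨p + 1, Finset.mem_Ioc.2 ⟨Nat.lt_succ_self p, hp⟩⟩).2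

/-- Words are pairs of a first letter and a remaining word. -/
def wordEquiv (hp : p < n) : Word n p ≃ ↥(Finset.Ico 3 (p + 1)) × Word n (p + 1) where
  toFun a := (⟨a.head hp, a.head_mem hp⟩, a.tail)
  invFun x := fun l => if h : (l : ℕ) = p + 1 then ⟨x.1, by rw [h]; exact x.1.2⟩
    else x.2 ⟨l, Finset.mem_Ioc.2 (by have := Finset.mem_Ioc.1 l.2; omega)⟩
  left_inv a := by
    funext l
    obtain ⟨l, hl⟩ := l
    by_cases h : l = p + 1
    · subst h
      simp [Word.head]
    · simp [h, Word.tail]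
  right_inv x := by
    obtain ⟨q, Q⟩ := x
    refine Prod.ext (Subtype.ext ?_) (funext fun l => ?_)
    · simp [Word.head]
    · have : (l : ℕ) ≠ p + 1 := by have := Finset.mem_Ioc.1 l.2; omega
      simp [Word.tail, this]

/-- The word with first letter `q` and remaining word `Q`. -/
def Word.cons (hp : p < n) {q : ℕ} (hq : q ∈ Finset.Ico 3 (p + 1)) (Q : Word n (p + 1)) :
    Word n p :=
  (wordEquiv hp).symm (⟨q, hq⟩, Q)

theorem Word.head_cons (hp : p < n) {q : ℕ} (hq : q ∈ Finset.Ico 3 (p + 1))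
    (Q : Word n (p + 1)) : (Word.cons hp hq Q).head hp = q :=
  congrArg (fun x => (x.1 : ℕ)) ((wordEquiv hp).apply_symm_apply (⟨q, hq⟩, Q))

theorem Word.tail_cons (hp : p < n) {q : ℕ} (hq : q ∈ Finset.Ico 3 (p + 1))
    (Q : Word n (p + 1)) : (Word.cons hp hq Q).tail = Q :=
  congrArg Prod.snd ((wordEquiv hp).apply_symm_apply (⟨q, hq⟩, Q))

theorem Word.cons_head_tail (hp : p < n) (a : Word n p) :
    Word.cons hp (a.head_mem hp) a.tail = a :=
  (wordEquiv hp).symm_apply_apply a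

theorem sum_word {M : Type*} [AddCommMonoid M] (hp : p < n) (g : ℕ → Word n (p + 1) → M) :
    ∑ a : Word n p, g (a.head hp) a.tail = ∑ q ∈ Finset.Ico 3 (p + 1), ∑ Q, g q Q := by
  rw [← (wordEquiv hp).symm.sum_comp, Fintype.sum_prod_type,
    ← Finset.sum_coe_sort (Finset.Ico 3 (p + 1)) (fun q => ∑ Q, g q Q)]
  refine Finset.sum_congr rfl fun q _ => Finset.sum_congr rfl fun Q _ => ?_
  have h1 := Word.head_cons hp q.2 Q
  have h2 := Word.tail_cons hp q.2 Q
  rw [Word.cons] at h1 h2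
  rw [h1, h2]

theorem basisY_cons {c₁ c₂ c₃ : ℂ} (hp : p < n) (a : Word n p) :
    (basisY a : RegRing n c₁ c₂ c₃) = R (p + 1) (a.head hp) * basisY a.tail := by
  classical
  let g : ℕ → RegRing n c₁ c₂ c₃ := fun l =>
    if h : l ∈ Finset.Ioc p n then R l (a ⟨l, h⟩) else 1
  have h1 : (basisY a : RegRing n c₁ c₂ c₃) = ∏ l ∈ Finset.Ioc p n, g l := by
    rw [basisY, ← Finset.prod_coe_sort (Finset.Ioc p n) g]
    exact Finset.prod_congr rfl fun l _ => by simp only [g, dif_pos l.2]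
  have h2 : (basisY a.tail : RegRing n c₁ c₂ c₃) = ∏ l ∈ Finset.Ioc (p + 1) n, g l := by
    rw [basisY, ← Finset.prod_coe_sort (Finset.Ioc (p + 1) n) g]
    refine Finset.prod_congr rfl fun l _ => ?_
    have hl : (l : ℕ) ∈ Finset.Ioc p n := by
      have := Finset.mem_Ioc.1 l.2
      exact Finset.mem_Ioc.2 (by omega)
    simp only [g, dif_pos hl]
    rfl
  have h3 : Finset.Ioc p n = insert (p + 1) (Finset.Ioc (p + 1) n) := by
    ext x; simp only [Finset.mem_Ioc, Finset.mem_insert]; omega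
  rw [h1, h2, h3, Finset.prod_insert (by simp)]
  congr 1
  simp only [g, Word.head]
  rw [dif_pos (Finset.mem_Ioc.2 ⟨Nat.lt_succ_self p, hp⟩)]

end Words

section Act

variable {W M : Type*} [Fintype W] [AddCommGroup M] [Module ℂ M]

/-- The action of a complex matrix on a vector with entries in a complex vector space. -/
def act (A : Matrix W W ℂ) (X : W → M) (Q : W) : M := ∑ P, A Q P • X P

theorem act_add (A B : Matrix W W ℂ) (X : W → M) (Q : W) :
    act (A + B) X Q = act A X Q + act B X Q := by
  simp [act, add_smul, Finset.sum_add_distrib]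

theorem act_neg (A : Matrix W W ℂ) (X : W → M) (Q : W) : act (-A) X Q = -act A X Q := by
  simp [act]

theorem act_sub (A B : Matrix W W ℂ) (X : W → M) (Q : W) :
    act (A - B) X Q = act A X Q - act B X Q := by
  rw [sub_eq_add_neg, act_add, act_neg, sub_eq_add_neg]

theorem act_zero (X : W → M) (Q : W) : act (0 : Matrix W W ℂ) X Q = 0 := by
  simp [act]

theorem act_sum {ι : Type*} (s : Finset ι) (A : ι → Matrix W W ℂ) (X : W → M) (Q : W) :
    act (∑ i ∈ s, A i) X Q = ∑ i ∈ s, act (A i) X Q := by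
  classical
  induction s using Finset.induction_on with
  | empty => simp [act_zero]
  | insert i s hi ih => rw [Finset.sum_insert hi, Finset.sum_insert hi, act_add, ih]

theorem act_ite (c : Prop) [Decidable c] (A : Matrix W W ℂ) (X : W → M) (Q : W) :
    act (if c then A else 0) X Q = if c then act A X Q else 0 := by
  split_ifs
  · rfl
  · exact act_zero X Q

theorem act_act (A B : Matrix W W ℂ) (X : W → M) : act A (act B X) = act (A * B) X := by
  funext Q
  simp only [act, Matrix.mul_apply, Finset.sum_smul, Finset.smul_sum, mul_smul]
  exact Finset.sum_comm

theorem act_one [DecidableEq W] (X : W → M) : act (1 : Matrix W W ℂ) X = X := by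
  funext Q
  simp [act, Matrix.one_apply, ite_smul]

theorem act_smul_one [DecidableEq W] (r : ℂ) (X : W → M) :
    act (r • (1 : Matrix W W ℂ)) X = r • X := by
  funext Q
  simp [act, Matrix.one_apply, ite_smul]

theorem act_add_vec (A : Matrix W W ℂ) (X X' : W → M) (Q : W) :
    act A (X + X') Q = act A X Q + act A X' Q := by
  simp [act, Finset.sum_add_distrib]

theorem act_mem {S : Submodule ℂ M} (A : Matrix W W ℂ) {X : W → M} (h : ∀ P, X P ∈ S) (Q : W) :
    act A X Q ∈ S := sum_mem fun P _ => S.smul_mem _ (h P)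

end Act

section Recursion

variable {n p : ℕ}

/-- The blocks of the recursion as a sum of elementary contributions. -/
theorem recursionBlock_eq {Ω : MatrixFamily n (p + 1)} (hΩ : IsAnsatz n (p + 1) Ω)
    {i j q r : ℕ} (hi : i ∈ Finset.Icc 4 p) (hj : j ∈ Finset.Icc 1 p) (hij : i ≠ j)
    (hq : q ∈ Finset.Ico 3 (p + 1)) (hr : r ∈ Finset.Ico 3 (p + 1)) :
    recursionBlock n p Ω i j q r = (if q = r then Ω i j else 0) +
      (if q = i then if i = r then Ω (p + 1) j else 0 else 0) -
      (if q = i then if j = r then Ω (p + 1) j else 0 else 0) +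
      (if q = j then if j = r then Ω (p + 1) i else 0 else 0) -
      (if q = j then if i = r then Ω (p + 1) i else 0 else 0) +
      (if j = 1 then if i = r then Ω (p + 1) i else 0 else 0) +
      (if j = 2 ∧ q = i then Ω (p + 1) r else 0) := by
  rw [Finset.mem_Icc] at hi hj
  rw [Finset.mem_Ico] at hq hr
  have hs := hΩ.symm i (Finset.mem_Icc.2 (by omega)) (p + 1) (Finset.mem_Icc.2 (by omega))
  have hs2 := hΩ.symm i (Finset.mem_Icc.2 (by omega)) j (Finset.mem_Icc.2 (by omega))
  rw [recursionBlock, hs]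
  by_cases h1 : q = i
  · subst h1
    by_cases h2 : q = r
    · subst h2
      by_cases h3 : j = 1
      · subst h3
        simp [hij, hij.symm]
        abel
      · by_cases h4 : j = 2
        · subst h4
          simp [hij, hij.symm]
          abel
        · have := Ne.symm hij
          simp [h3, h4, hij, this]
          abel
    · by_cases h3 : r = j
      · subst h3
        have h5 : r ≠ 1 := by omega
        have h6 : r ≠ 2 := by omega
        simp [h2, h5, h6]
      · have h5 : j ≠ r := Ne.symm h3
        have h6 : r ≠ q := Ne.symm h2
        simp [h2, hij, h3, h5, h6]
  · by_cases h2 : q = j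
    · subst h2
      have h5 : q ≠ 1 := by omega
      have h6 : q ≠ 2 := by omega
      by_cases h3 : q = r
      · subst h3
        simp [h1, hij]
        abel
      · by_cases h4 : r = i
        · subst h4
          simp [h1, h5, h6]
        · have : i ≠ r := Ne.symm h4
          simp [h1, h3, h4, h5, h6, this]
    · by_cases h3 : q = r
      · subst h3
        have : i ≠ q := Ne.symm h1
        simp [h1, h2, this]
      · by_cases h4 : r = i
        · subst h4
          simp [h1, h2]
        · have : i ≠ r := Ne.symm h4
          simp [h1, h2, h3, h4, this]

/-- A row of blocks of the recursion, applied to a vector of vectors. -/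
theorem sum_act_recursionBlock {M : Type*} [AddCommGroup M] [Module ℂ M]
    {Ω : MatrixFamily n (p + 1)} (hΩ : IsAnsatz n (p + 1) Ω)
    {i j q : ℕ} (hi : i ∈ Finset.Icc 4 p) (hj : j ∈ Finset.Icc 1 p) (hij : i ≠ j)
    (hq : q ∈ Finset.Ico 3 (p + 1)) (X : ℕ → Word n (p + 1) → M) (Q : Word n (p + 1)) :
    ∑ r ∈ Finset.Ico 3 (p + 1), act (recursionBlock n p Ω i j q r) (X r) Q =
      act (Ω i j) (X q) Q +
      (if q = i then act (Ω (p + 1) j) (X i) Q - (if 3 ≤ j then act (Ω (p + 1) j) (X j) Q else 0)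
        else 0) +
      (if q = j then act (Ω (p + 1) i) (X j) Q - act (Ω (p + 1) i) (X i) Q else 0) +
      (if j = 1 then act (Ω (p + 1) i) (X i) Q else 0) +
      (if j = 2 ∧ q = i then ∑ r ∈ Finset.Ico 3 (p + 1), act (Ω (p + 1) r) (X r) Q else 0) := by
  have hi' : i ∈ Finset.Ico 3 (p + 1) := by
    simp only [Finset.mem_Icc, Finset.mem_Ico] at hi ⊢; omega
  have hj' : j ∈ Finset.Ico 3 (p + 1) ↔ 3 ≤ j := by
    simp only [Finset.mem_Icc, Finset.mem_Ico] at hj ⊢; omega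
  rw [Finset.sum_congr rfl fun r hr => by rw [recursionBlock_eq hΩ hi hj hij hq hr]]
  simp only [act_add, act_sub, act_ite, Finset.sum_add_distrib, Finset.sum_sub_distrib]
  rw [Finset.sum_ite_eq, if_pos hq]
  simp only [Finset.sum_ite_irrel, Finset.sum_ite_eq, hi', hj', if_true, Finset.sum_const_zero]
  have e : q = j → 3 ≤ j := fun h => by rw [← h]; exact (Finset.mem_Ico.1 hq).1
  split_ifs <;> first | (exfalso; tauto) | abel

end Recursion

section Family

variable {n p : ℕ}

theorem recursionBlock_symm {Ω : MatrixFamily n (p + 1)} (hΩ : IsAnsatz n (p + 1) Ω)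
    {i j q r : ℕ} (hi : i ∈ Finset.Icc 4 p) (hj : j ∈ Finset.Icc 4 p) (hij : i ≠ j)
    (hq : q ∈ Finset.Ico 3 (p + 1)) (hr : r ∈ Finset.Ico 3 (p + 1)) :
    recursionBlock n p Ω i j q r = recursionBlock n p Ω j i q r := by
  have h1 : ∀ {l}, l ∈ Finset.Icc 4 p → l ∈ Finset.Icc 1 p ∧ l ∈ Finset.Icc 1 (p + 1) ∧ l ≠ 1 ∧
      l ≠ 2 := fun h => by simp only [Finset.mem_Icc] at h ⊢; omega
  rw [recursionBlock_eq hΩ hi (h1 hj).1 hij hq hr, recursionBlock_eq hΩ hj (h1 hi).1 hij.symm hq hr,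
    hΩ.symm j (h1 hj).2.1 i (h1 hi).2.1]
  simp only [(h1 hi).2.2, (h1 hj).2.2, if_false, false_and, add_zero]
  abel

theorem sum_recursionBlock {Ω : MatrixFamily n (p + 1)} (hΩ : IsAnsatz n (p + 1) Ω)
    {i q r : ℕ} (hi : i ∈ Finset.Icc 4 p)
    (hq : q ∈ Finset.Ico 3 (p + 1)) (hr : r ∈ Finset.Ico 3 (p + 1)) :
    ∑ j ∈ (Finset.Icc 1 p).erase i, recursionBlock n p Ω i j q r = 0 := by
  have hi' := Finset.mem_Icc.1 hi
  have hq' := Finset.mem_Ico.1 hq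
  have hr' := Finset.mem_Ico.1 hr
  have hi1 : i ∈ Finset.Icc 1 p := Finset.mem_Icc.2 (by omega)
  have hN : p + 1 ∈ Finset.Icc 1 (p + 1) := Finset.mem_Icc.2 (by omega)
  have hiN : i ∈ Finset.Icc 1 (p + 1) := Finset.mem_Icc.2 (by omega)
  have s1 : ∑ j ∈ (Finset.Icc 1 p).erase i, Ω i j = -Ω (p + 1) i := by
    have h := hΩ.sum_eq_zero i hiN
    rw [Finset.sum_Icc_succ_top (by omega), ← Finset.add_sum_erase _ _ hi1, hΩ.diag i hiN, zero_add,
      hΩ.symm i hiN _ hN] at h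
    exact eq_neg_of_add_eq_zero_left h
  have s2 : ∑ j ∈ (Finset.Icc 1 p).erase i, Ω (p + 1) j = -Ω (p + 1) i := by
    have h := hΩ.sum_eq_zero (p + 1) hN
    rw [Finset.sum_Icc_succ_top (by omega), ← Finset.add_sum_erase _ _ hi1, hΩ.diag _ hN,
      add_zero] at h
    exact eq_neg_of_add_eq_zero_right h
  have m1 : 1 ∈ (Finset.Icc 1 p).erase i := by
    rw [Finset.mem_erase, Finset.mem_Icc]; omega
  have m2 : 2 ∈ (Finset.Icc 1 p).erase i := by
    rw [Finset.mem_erase, Finset.mem_Icc]; omega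
  have mq : q ∈ (Finset.Icc 1 p).erase i ↔ q ≠ i := by
    rw [Finset.mem_erase, Finset.mem_Icc]; omega
  have mr : r ∈ (Finset.Icc 1 p).erase i ↔ r ≠ i := by
    rw [Finset.mem_erase, Finset.mem_Icc]; omega
  rw [Finset.sum_congr rfl fun j hj => by
    rw [recursionBlock_eq hΩ hi (Finset.mem_of_mem_erase hj) (Finset.ne_of_mem_erase hj).symm hq
      hr]]
  simp only [Finset.sum_add_distrib, Finset.sum_sub_distrib, ite_and]
  by_cases hqi : q = i
  · subst hqi
    by_cases hqr : q = r
    · subst hqr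
      simp [s1, s2, m1, m2]
    · have hrq : r ≠ q := Ne.symm hqr
      simp [hqr, m2, mr, hrq]
  · by_cases hqr : q = r
    · subst hqr
      have hiq : i ≠ q := Ne.symm hqi
      simp [hqi, hiq, s1, mq]
    · by_cases hir : i = r
      · subst hir
        simp [hqi, mq, m1]
      · have h0 : ∀ j : ℕ, (if q = j then if j = r then Ω (p + 1) i else 0 else 0) = 0 := by
          intro j
          split_ifs with h1 h2
          · exact absurd (h1.trans h2) hqr
          · rfl
          · rfl
        simp [hqi, hqr, hir, h0]

/-- The matrix that the recursion prescribes for `Ω^{ij}`, assembled from its blocks. -/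
def recMat (hp : p < n) (Ω : MatrixFamily n (p + 1)) (i j : ℕ) : Matrix (Word n p) (Word n p) ℂ :=
  fun a b => recursionBlock n p Ω i j (a.head hp) (b.head hp) a.tail b.tail

theorem recMat_symm (hp : p < n) {Ω : MatrixFamily n (p + 1)} (hΩ : IsAnsatz n (p + 1) Ω)
    {i j : ℕ} (hi : i ∈ Finset.Icc 4 p) (hj : j ∈ Finset.Icc 4 p) (hij : i ≠ j) :
    recMat hp Ω i j = recMat hp Ω j i := by
  funext a b
  rw [recMat, recMat, recursionBlock_symm hΩ hi hj hij (a.head_mem hp) (b.head_mem hp)]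

theorem sum_recMat (hp : p < n) {Ω : MatrixFamily n (p + 1)} (hΩ : IsAnsatz n (p + 1) Ω)
    {i : ℕ} (hi : i ∈ Finset.Icc 4 p) :
    ∑ j ∈ (Finset.Icc 1 p).erase i, recMat hp Ω i j = 0 := by
  ext a b
  have h := congrFun (congrFun (sum_recursionBlock hΩ hi (a.head_mem hp) (b.head_mem hp)) a.tail)
    b.tail
  rw [Matrix.sum_apply] at h ⊢
  exact h

/-- `∑_{l ≥ 4} Ω^{li}` for the recursion; it determines the matrices `Ω^{ij}` with `i, j ≤ 3`. -/
def recTail (hp : p < n) (Ω : MatrixFamily n (p + 1)) (i : ℕ) : Matrix (Word n p) (Word n p) ℂ :=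
  ∑ l ∈ Finset.Icc 4 p, recMat hp Ω l i

/-- The family of matrices that the recursion produces. For `i, j ≤ 3` the matrices solve the three
equations `∑_j Ω^{ij} = 0`, `i = 1, 2, 3`; the index `6 - i - j` is the third element of
`{1, 2, 3}`. -/
def recFamily (hp : p < n) (Ω : MatrixFamily n (p + 1)) : MatrixFamily n p := fun i j =>
  if i = j then 0 else if 4 ≤ i then recMat hp Ω i j else if 4 ≤ j then recMat hp Ω j i
  else (1 / 2 : ℂ) • (recTail hp Ω (6 - i - j) - recTail hp Ω i - recTail hp Ω j)

theorem recFamily_satisfiesRecursion (hp : p < n) (Ω : MatrixFamily n (p + 1)) :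
    SatisfiesRecursion n p hp Ω (recFamily hp Ω) := by
  intro i hi j _ hij a b
  rw [recFamily, if_neg hij, if_pos (Finset.mem_Icc.1 hi).1]
  rfl

theorem recFamily_isAnsatz (hp3 : 3 ≤ p) (hp : p < n) {Ω : MatrixFamily n (p + 1)}
    (hΩ : IsAnsatz n (p + 1) Ω) : IsAnsatz n p (recFamily hp Ω) where
  symm i hi j hj := by
    rw [Finset.mem_Icc] at hi hj
    by_cases hij : i = j
    · rw [hij]
    · rw [recFamily, recFamily, if_neg hij, if_neg (Ne.symm hij)]
      by_cases h1 : 4 ≤ i <;> by_cases h2 : 4 ≤ j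
      · rw [if_pos h1, if_pos h2]
        exact recMat_symm hp hΩ (Finset.mem_Icc.2 (by omega)) (Finset.mem_Icc.2 (by omega)) hij
      · rw [if_pos h1, if_neg h2, if_pos h1]
      · rw [if_neg h1, if_pos h2, if_pos h2]
      · rw [if_neg h1, if_neg h2, if_neg h1, if_neg h2, Nat.sub_right_comm, sub_right_comm]
  diag i _ := by rw [recFamily, if_pos rfl]
  sum_eq_zero i hi := by
    have hi' := Finset.mem_Icc.1 hi
    by_cases h4 : 4 ≤ i
    · rw [← Finset.add_sum_erase _ _ hi, ← sum_recMat hp hΩ (Finset.mem_Icc.2 ⟨h4, hi'.2⟩)]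
      conv_lhs => rw [recFamily, if_pos rfl, zero_add]
      refine Finset.sum_congr rfl fun j hj => ?_
      rw [recFamily, if_neg (Finset.ne_of_mem_erase hj).symm, if_pos h4]
    · have hsplit : Finset.Icc 1 p = insert 1 (insert 2 (insert 3 (Finset.Icc 4 p))) := by
        ext x; simp only [Finset.mem_Icc, Finset.mem_insert]; omega
      have htail : ∑ j ∈ Finset.Icc 4 p, recFamily hp Ω i j = recTail hp Ω i := by
        refine Finset.sum_congr rfl fun j hj => ?_
        rw [Finset.mem_Icc] at hj
        rw [recFamily, if_neg (by omega), if_neg h4, if_pos hj.1]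
      rw [hsplit, Finset.sum_insert (by simp), Finset.sum_insert (by simp),
        Finset.sum_insert (by simp), htail]
      have : i = 1 ∨ i = 2 ∨ i = 3 := by omega
      rcases this with rfl | rfl | rfl <;> simp [recFamily] <;> module

theorem SatisfiesRecursion.eq_recMat {hp : p < n} {Ωn : MatrixFamily n (p + 1)}
    {Ω : MatrixFamily n p} (h : SatisfiesRecursion n p hp Ωn Ω) {i j : ℕ}
    (hi : i ∈ Finset.Icc 4 p) (hj : j ∈ Finset.Icc 1 p) (hij : i ≠ j) :
    Ω i j = recMat hp Ωn i j := by
  funext a b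
  exact h i hi j hj hij a b

/-- A matrix of the recursion, applied to a vector that is indexed by words. -/
theorem act_recMat {M : Type*} [AddCommGroup M] [Module ℂ M] (hp : p < n)
    {Ω : MatrixFamily n (p + 1)} (hΩ : IsAnsatz n (p + 1) Ω) {i j : ℕ}
    (hi : i ∈ Finset.Icc 4 p) (hj : j ∈ Finset.Icc 1 p) (hij : i ≠ j)
    (X : ℕ → Word n (p + 1) → M) (a : Word n p) :
    act (recMat hp Ω i j) (fun b => X (b.head hp) b.tail) a =
      act (Ω i j) (X (a.head hp)) a.tail +
      (if a.head hp = i then act (Ω (p + 1) j) (X i) a.tail -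
        (if 3 ≤ j then act (Ω (p + 1) j) (X j) a.tail else 0) else 0) +
      (if a.head hp = j then act (Ω (p + 1) i) (X j) a.tail - act (Ω (p + 1) i) (X i) a.tail
        else 0) +
      (if j = 1 then act (Ω (p + 1) i) (X i) a.tail else 0) +
      (if j = 2 ∧ a.head hp = i then
        ∑ r ∈ Finset.Ico 3 (p + 1), act (Ω (p + 1) r) (X r) a.tail else 0) := by
  rw [← sum_act_recursionBlock hΩ hi hj hij (a.head_mem hp) X a.tail]
  exact sum_word hp (fun r P => recursionBlock n p Ω i j (a.head hp) r a.tail P • X r P)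

end Family

/-! ### Residues along boundary divisors -/

section BoundaryResidues

variable {n p : ℕ}

/-- `∑_{j < i} Ω^{ij}` over pairs of indices in `I`. -/
def sumPairs {M : Type*} [AddCommMonoid M] (Ω : ℕ → ℕ → M) (I : Finset ℕ) : M :=
  ∑ i ∈ I, ∑ j ∈ I with j < i, Ω i j

theorem sumPairs_insert {M : Type*} [AddCommMonoid M] (Ω : ℕ → ℕ → M) {I : Finset ℕ} {N : ℕ}
    (h : ∀ i ∈ I, i < N) : sumPairs Ω (insert N I) = sumPairs Ω I + ∑ j ∈ I, Ω N j := by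
  have hN : N ∉ I := fun hN => lt_irrefl _ (h N hN)
  rw [sumPairs, Finset.sum_insert hN, add_comm]
  congr 1
  · refine Finset.sum_congr rfl fun i hi => ?_
    rw [Finset.filter_insert, if_neg (not_lt.2 (h i hi).le)]
  · rw [Finset.filter_insert, if_neg (lt_irrefl _), Finset.filter_true_of_mem h]

/-- The residues `∑_{i,j ∈ I} Ω^{ij}` along the boundary divisors on which the punctures in `I`
collide have no eigenvalue in `Λ² ℤ`. Only sets `I` with at most one of the three fixed punctures
are considered; the others are complementary to these. -/
def HasNonResonantResidues (n p : ℕ) (Λ : ℝ) (Ω : MatrixFamily n p) : Prop :=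
  ∀ I ⊆ Finset.Icc 1 p, 2 ≤ I.card → (I ∩ {1, 2, 3}).card ≤ 1 → ∀ (m : ℤ) (x : Word n p → ℂ),
    act (sumPairs Ω I) x = ((m : ℂ) * (Λ : ℂ) ^ 2) • x → x = 0

/-- The terms of a sum over pairs in `I` whose larger index is `q`. -/
theorem sum_pairs_ite_left {M : Type*} [AddCommMonoid M] (I : Finset ℕ) (q : ℕ) (f : ℕ → ℕ → M) :
    ∑ i ∈ I, ∑ j ∈ I with j < i, (if q = i then f i j else 0) =
      if q ∈ I then ∑ j ∈ I with j < q, f q j else 0 := by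
  simp only [Finset.sum_ite_irrel, Finset.sum_const_zero, Finset.sum_ite_eq]

/-- The terms of a sum over pairs in `I` whose smaller index is `q`. -/
theorem sum_pairs_ite_right {M : Type*} [AddCommMonoid M] (I : Finset ℕ) (q : ℕ) (f : ℕ → ℕ → M) :
    ∑ i ∈ I, ∑ j ∈ I with j < i, (if q = j then f i j else 0) =
      if q ∈ I then ∑ i ∈ I with q < i, f i q else 0 := by
  simp only [Finset.sum_ite_eq, Finset.mem_filter, ite_and]
  split_ifs with h
  · rw [Finset.sum_filter]
  · exact Finset.sum_const_zero

/-- The residue of the recursion along the divisor of `I`, applied to a vector. -/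
theorem act_sumPairs_recursion (hp : p < n) {Ωn : MatrixFamily n (p + 1)}
    (hΩn : IsAnsatz n (p + 1) Ωn) {Ω : MatrixFamily n p} (hΩ : SatisfiesRecursion n p hp Ωn Ω)
    {I : Finset ℕ} (hI : I ⊆ Finset.Icc 1 p) (hI3 : (I ∩ {1, 2, 3}).card ≤ 1)
    (X : ℕ → Word n (p + 1) → ℂ) (a : Word n p) :
    act (sumPairs Ω I) (fun b => X (b.head hp) b.tail) a =
      act (sumPairs Ωn I) (X (a.head hp)) a.tail +
      (if a.head hp ∈ I then ∑ i ∈ I, (act (Ωn (p + 1) i) (X (a.head hp)) a.tail -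
        (if 3 ≤ i then act (Ωn (p + 1) i) (X i) a.tail else 0)) else 0) +
      (if 1 ∈ I then ∑ i ∈ I with 3 ≤ i, act (Ωn (p + 1) i) (X i) a.tail else 0) +
      (if 2 ∈ I ∧ a.head hp ∈ I then
        ∑ r ∈ Finset.Ico 3 (p + 1), act (Ωn (p + 1) r) (X r) a.tail else 0) := by
  have hq := Finset.mem_Ico.1 (a.head_mem hp)
  generalize hqd : a.head hp = q at hq ⊢
  generalize hQd : a.tail = Q
  have hbig : ∀ i ∈ I, ∀ j ∈ I, j < i → 4 ≤ i := by
    intro i hi j hj hji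
    by_contra h
    have h1 := Finset.mem_Icc.1 (hI hi)
    have h2 := Finset.mem_Icc.1 (hI hj)
    refine absurd (Finset.card_le_one.1 hI3 i ?_ j ?_) hji.ne' <;>
      simp only [Finset.mem_inter, Finset.mem_insert, Finset.mem_singleton]
    · exact ⟨hi, by omega⟩
    · exact ⟨hj, by omega⟩
  have key : ∀ i ∈ I, ∀ j ∈ I.filter (· < i),
      act (Ω i j) (fun b => X (b.head hp) b.tail) a =
      act (Ωn i j) (X q) Q +
      (if q = i then act (Ωn (p + 1) j) (X q) Q -
        (if 3 ≤ j then act (Ωn (p + 1) j) (X j) Q else 0) else 0) +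
      (if q = j then act (Ωn (p + 1) i) (X q) Q -
        (if 3 ≤ i then act (Ωn (p + 1) i) (X i) Q else 0) else 0) +
      (if 1 = j then act (Ωn (p + 1) i) (X i) Q else 0) +
      (if 2 = j then if q = i then ∑ r ∈ Finset.Ico 3 (p + 1), act (Ωn (p + 1) r) (X r) Q else 0
        else 0) := by
    intro i hi j hj
    rw [Finset.mem_filter] at hj
    have h4 := hbig i hi j hj.1 hj.2
    have hi4 : i ∈ Finset.Icc 4 p := Finset.mem_Icc.2 ⟨h4, (Finset.mem_Icc.1 (hI hi)).2⟩
    rw [hΩ.eq_recMat hi4 (hI hj.1) hj.2.ne', act_recMat hp hΩn hi4 (hI hj.1) hj.2.ne', ite_and,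
      if_pos (show 3 ≤ i by omega)]
    simp only [show (1 = j) = (j = 1) from propext eq_comm,
      show (2 = j) = (j = 2) from propext eq_comm]
    have hji := hj.2.ne
    rw [hqd, hQd]
    by_cases h1 : q = i
    · have h2 : q ≠ j := by omega
      simp only [h1, hji.symm, if_true, if_false]
    · by_cases h2 : q = j
      · simp only [h2, hji, if_true, if_false]
      · simp only [h1, h2, if_false]
  have hact : act (sumPairs Ω I) (fun b => X (b.head hp) b.tail) a =
      ∑ i ∈ I, ∑ j ∈ I with j < i, act (Ω i j) (fun b => X (b.head hp) b.tail) a := by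
    rw [sumPairs, act_sum]
    exact Finset.sum_congr rfl fun i _ => act_sum _ _ _ _
  have hact2 : act (sumPairs Ωn I) (X q) Q =
      ∑ i ∈ I, ∑ j ∈ I with j < i, act (Ωn i j) (X q) Q := by
    rw [sumPairs, act_sum]
    exact Finset.sum_congr rfl fun i _ => act_sum _ _ _ _
  rw [hact, hact2, Finset.sum_congr rfl fun i hi => Finset.sum_congr rfl (key i hi)]
  simp only [Finset.sum_add_distrib]
  rw [sum_pairs_ite_left I q (fun i j => act (Ωn (p + 1) j) (X q) Q -
        (if 3 ≤ j then act (Ωn (p + 1) j) (X j) Q else 0)),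
    sum_pairs_ite_right I q (fun i j => act (Ωn (p + 1) i) (X q) Q -
        (if 3 ≤ i then act (Ωn (p + 1) i) (X i) Q else 0)),
    sum_pairs_ite_right I 1 (fun i j => act (Ωn (p + 1) i) (X i) Q),
    sum_pairs_ite_right I 2 (fun i j =>
      if q = i then ∑ r ∈ Finset.Ico 3 (p + 1), act (Ωn (p + 1) r) (X r) Q else 0)]
  have h1 : 1 ∈ I → 2 ∉ I := fun h1 h2 => absurd (Finset.card_le_one.1 hI3 1 (by simp [h1]) 2
    (by simp [h2])) (by norm_num)
  have e1 : (if 1 ∈ I then ∑ i ∈ I with 1 < i, act (Ωn (p + 1) i) (X i) Q else 0) =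
      if 1 ∈ I then ∑ i ∈ I with 3 ≤ i, act (Ωn (p + 1) i) (X i) Q else 0 := by
    split_ifs with h
    · refine Finset.sum_congr (Finset.filter_congr fun i hi => ?_) fun _ _ => rfl
      have : i ≠ 2 := fun h2 => h1 h (by rwa [h2] at hi)
      omega
    · rfl
  rw [e1]
  by_cases hqI : q ∈ I
  · rw [if_pos hqI, if_pos hqI, if_pos hqI, Finset.sum_ite_eq, if_pos
      (Finset.mem_filter.2 ⟨hqI, by omega⟩)]
    simp only [hqI, and_true]
    congr 2
    rw [add_assoc]
    congr 1
    rw [← Finset.add_sum_erase _ _ hqI, if_pos hq.1, sub_self, zero_add,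
      ← Finset.sum_filter_add_sum_filter_not (I.erase q) (fun j => j < q)]
    congr 1
    · refine Finset.sum_congr ?_ fun _ _ => rfl
      ext i
      simp only [Finset.mem_filter, Finset.mem_erase]
      exact ⟨fun h => ⟨⟨h.2.ne, h.1⟩, h.2⟩, fun h => ⟨h.1.2, h.2⟩⟩
    · refine Finset.sum_congr ?_ fun _ _ => rfl
      ext i
      simp only [Finset.mem_filter, Finset.mem_erase]
      exact ⟨fun h => ⟨⟨h.2.ne', h.1⟩, not_lt.2 h.2.le⟩, fun h => ⟨h.1.2, by omega⟩⟩
  · rw [if_neg hqI, if_neg hqI, if_neg hqI, Finset.sum_ite_eq, if_neg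
      (fun h => hqI (Finset.mem_filter.1 h).1)]
    simp only [hqI, and_false, if_false, ite_self, add_zero]

/-- The residues of the recursion have the eigenvalues of the residues, one level up, for the sets
`I` and `I ∪ {p+1}`. -/
theorem HasNonResonantResidues.recursion {Λ : ℝ} (hp3 : 3 ≤ p) (hp : p < n)
    {Ωn : MatrixFamily n (p + 1)} (hΩn : IsAnsatz n (p + 1) Ωn) {Ω : MatrixFamily n p}
    (hΩ : SatisfiesRecursion n p hp Ωn Ω)
    (h : HasNonResonantResidues n (p + 1) Λ Ωn) : HasNonResonantResidues n p Λ Ω := by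
  intro I hI hcard hI3 m x hx
  set X : ℕ → Word n (p + 1) → ℂ := fun q Q =>
    if hq : q ∈ Finset.Ico 3 (p + 1) then x (Word.cons hp hq Q) else 0 with hX
  have hxX : x = fun b => X (b.head hp) b.tail := by
    funext b
    rw [hX]
    simp only [dif_pos (b.head_mem hp), Word.cons_head_tail]
  set μ : ℂ := (m : ℂ) * (Λ : ℂ) ^ 2 with hμ
  have hlt : ∀ i ∈ I, i < p + 1 := fun i hi => by have := Finset.mem_Icc.1 (hI hi); omega
  have hIN : p + 1 ∉ I := fun hN => lt_irrefl _ (hlt _ hN)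
  have hIp : I ⊆ Finset.Icc 1 (p + 1) := hI.trans (Finset.Icc_subset_Icc_right (by omega))
  have main : ∀ q ∈ Finset.Ico 3 (p + 1), ∀ Q,
      act (sumPairs Ωn I) (X q) Q +
      (if q ∈ I then ∑ i ∈ I, (act (Ωn (p + 1) i) (X q) Q -
        (if 3 ≤ i then act (Ωn (p + 1) i) (X i) Q else 0)) else 0) +
      (if 1 ∈ I then ∑ i ∈ I with 3 ≤ i, act (Ωn (p + 1) i) (X i) Q else 0) +
      (if 2 ∈ I ∧ q ∈ I then
        ∑ r ∈ Finset.Ico 3 (p + 1), act (Ωn (p + 1) r) (X r) Q else 0) = μ * X q Q := by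
    intro q hq Q
    have h1 := act_sumPairs_recursion hp hΩn hΩ hI hI3 X (Word.cons hp hq Q)
    rw [Word.head_cons, Word.tail_cons, ← hxX, hx, Pi.smul_apply, smul_eq_mul, hxX] at h1
    simp only [Word.head_cons, Word.tail_cons] at h1
    exact h1.symm
  -- the two nonresonance conditions, for `I` and for `I ∪ {p+1}`
  have kI : ∀ v : Word n (p + 1) → ℂ, (∀ Q, act (sumPairs Ωn I) v Q = μ * v Q) → v = 0 :=
    fun v hv => h I hIp hcard hI3 m v (funext hv)
  have kN : ∀ v : Word n (p + 1) → ℂ,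
      (∀ Q, act (sumPairs Ωn I) v Q + ∑ i ∈ I, act (Ωn (p + 1) i) v Q = μ * v Q) → v = 0 := by
    intro v hv
    refine h (insert (p + 1) I) (Finset.insert_subset (Finset.mem_Icc.2 (by omega)) hIp)
      (hcard.trans (Finset.card_le_card (Finset.subset_insert _ _))) ?_ m v (funext fun Q => ?_)
    · rwa [Finset.insert_inter_of_notMem]
      simp only [Finset.mem_insert, Finset.mem_singleton]
      omega
    · rw [sumPairs_insert _ hlt, act_add, act_sum]
      exact hv Q
  have memI : ∀ q ∈ I, 3 ≤ q → q ∈ Finset.Ico 3 (p + 1) := fun q hq h3 =>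
    Finset.mem_Ico.2 ⟨h3, hlt q hq⟩
  suffices hX0 : ∀ q ∈ Finset.Ico 3 (p + 1), X q = 0 by
    rw [hxX]
    funext b
    exact congrFun (hX0 _ (b.head_mem hp)) _
  have hdisj : ∀ {i j : ℕ}, i ∈ I → j ∈ I → i ∈ ({1, 2, 3} : Finset ℕ) →
      j ∈ ({1, 2, 3} : Finset ℕ) → i = j := fun hi hj hi3 hj3 =>
    Finset.card_le_one.1 hI3 _ (Finset.mem_inter.2 ⟨hi, hi3⟩) _ (Finset.mem_inter.2 ⟨hj, hj3⟩)
  by_cases h1 : 1 ∈ I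
  · -- the components `X q` with `q ∈ I` have the eigenvalue for `I ∪ {p+1}`; if they vanish, the
    -- other ones have the eigenvalue for `I`
    have h2 : 2 ∉ I := fun h2 => absurd (hdisj h1 h2 (by simp) (by simp)) (by norm_num)
    have hf : ∀ q ∈ I, 3 ≤ q → X q = 0 := by
      intro q hqI hq3
      refine kN _ fun Q => ?_
      have e := main q (memI q hqI hq3) Q
      rw [if_pos hqI, if_pos h1, if_neg (fun h => h2 h.1), Finset.sum_sub_distrib,
        Finset.sum_filter] at e
      rw [← e]
      ring
    intro q hq
    by_cases hqI : q ∈ I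
    · exact hf q hqI (Finset.mem_Ico.1 hq).1
    · refine kI _ fun Q => ?_
      have e := main q hq Q
      rw [if_neg hqI, if_pos h1, if_neg (fun h => h2 h.1), Finset.sum_eq_zero fun i hi => by
        rw [hf i (Finset.mem_filter.1 hi).1 (Finset.mem_filter.1 hi).2]; simp [act]] at e
      rw [← e]
      ring
  · -- here it is the components with `q ∉ I` that decouple, with the eigenvalue for `I`
    have hout : ∀ q ∈ Finset.Ico 3 (p + 1), q ∉ I → X q = 0 := by
      intro q hq hqI
      refine kI _ fun Q => ?_
      have e := main q hq Q
      rw [if_neg hqI, if_neg h1, if_neg (fun h => hqI h.2)] at e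
      rw [← e]
      ring
    by_cases h2 : 2 ∈ I
    · intro q hq
      by_cases hqI : q ∈ I
      · refine kN _ fun Q => ?_
        have e := main q hq Q
        have hS : ∑ r ∈ Finset.Ico 3 (p + 1), act (Ωn (p + 1) r) (X r) Q =
            ∑ i ∈ I, (if 3 ≤ i then act (Ωn (p + 1) i) (X i) Q else 0) := by
          rw [← Finset.sum_filter]
          symm
          refine Finset.sum_subset (fun i hi => ?_) fun r hr hrI => ?_
          · exact memI i (Finset.mem_filter.1 hi).1 (Finset.mem_filter.1 hi).2
          · rw [hout r hr fun h => hrI (Finset.mem_filter.2 ⟨h, (Finset.mem_Ico.1 hr).1⟩)]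
            simp [act]
        rw [if_pos hqI, if_neg h1, if_pos ⟨h2, hqI⟩, Finset.sum_sub_distrib, hS] at e
        rw [← e]
        ring
      · exact hout q hq hqI
    · -- all `X q`, `q ∈ I`, agree, since they solve the same nonresonant equation
      have h3 : ∀ i ∈ I, 3 ≤ i := by
        intro i hi
        have := Finset.mem_Icc.1 (hI hi)
        have n1 : i ≠ 1 := fun h => h1 (h ▸ hi)
        have n2 : i ≠ 2 := fun h => h2 (h ▸ hi)
        omega
      have main' : ∀ q ∈ I, ∀ Q, act (sumPairs Ωn I) (X q) Q +
          ∑ i ∈ I, act (Ωn (p + 1) i) (X q) Q - ∑ i ∈ I, act (Ωn (p + 1) i) (X i) Q =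
          μ * X q Q := by
        intro q hqI Q
        have e := main q (memI q hqI (h3 q hqI)) Q
        rw [if_pos hqI, if_neg h1, if_neg (fun h => h2 h.1), Finset.sum_sub_distrib,
          Finset.sum_congr rfl fun i hi => if_pos (h3 i hi)] at e
        rw [← e]
        ring
      have hact : ∀ (A : Matrix (Word n (p + 1)) (Word n (p + 1)) ℂ) (u v : Word n (p + 1) → ℂ) Q,
          act A (u - v) Q = act A u Q - act A v Q := by
        intro A u v Q
        simp [act, mul_sub, Finset.sum_sub_distrib]
      have hconst : ∀ q ∈ I, ∀ r ∈ I, X q = X r := by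
        intro q hq r hr
        rw [← sub_eq_zero]
        refine kN _ fun Q => ?_
        simp only [hact, Finset.sum_sub_distrib, Pi.sub_apply]
        linear_combination main' q hq Q - main' r hr Q
      intro q hq
      by_cases hqI : q ∈ I
      · refine kI _ fun Q => ?_
        have e := main' q hqI Q
        have e2 : ∑ i ∈ I, act (Ωn (p + 1) i) (X i) Q = ∑ i ∈ I, act (Ωn (p + 1) i) (X q) Q :=
          Finset.sum_congr rfl fun i hi => by rw [hconst i hi q hqI]
        rw [← e, e2]
        ring
      · exact hout q hq hqI

end BoundaryResidues

/-! ### The recursion solves the Gauss-Manin equation -/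

section GaussManin

variable {n p : ℕ} {c₁ c₂ c₃ : ℂ}

theorem act_mul_left {W : Type*} [Fintype W] (A : Matrix W W ℂ) (f : RegRing n c₁ c₂ c₃)
    (X : W → RegRing n c₁ c₂ c₃) (Q : W) : act A (fun P => f * X P) Q = f * act A X Q := by
  simp only [act, Finset.mul_sum, mul_smul_comm]

theorem exactForms_mono {s : ℕ → ℕ → ℂ} :
    (exactForms s (p + 1) : Submodule ℂ (RegRing n c₁ c₂ c₃)) ≤ exactForms s p := by
  rintro _ ⟨g, rfl⟩
  refine ⟨fun l => if l ∈ Finset.Ioc (p + 1) n then g l else 0, ?_⟩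
  have hsub : Finset.Ioc (p + 1) n ⊆ Finset.Ioc p n := Finset.Ioc_subset_Ioc_left (Nat.le_succ p)
  rw [← Finset.sum_subset hsub]
  · exact Finset.sum_congr rfl fun l hl => by simp only [if_pos hl]
  · intro l _ hl
    simp only [if_neg hl, map_zero]

theorem covD_mem_exactForms {s : ℕ → ℕ → ℂ} {l : ℕ} (hl : l ∈ Finset.Ioc p n)
    (f : RegRing n c₁ c₂ c₃) : covD s l f ∈ exactForms s p := by
  refine ⟨fun i => if i = l then f else 0, ?_⟩
  rw [Finset.sum_eq_single l (fun i _ hi => by simp only [if_neg hi, map_zero])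
    (fun h => absurd hl h)]
  simp only [if_true]

theorem mul_mem_exactForms {s : ℕ → ℕ → ℂ} {m : ℕ} {f e : RegRing n c₁ c₂ c₃}
    (hf : ∀ l ∈ Finset.Ioc m n, pd l f = 0) (he : e ∈ exactForms s m) :
    f * e ∈ exactForms s m := by
  obtain ⟨g, rfl⟩ := he
  refine ⟨fun l => f * g l, ?_⟩
  rw [Finset.mul_sum]
  exact Finset.sum_congr rfl fun l hl => (covD_mul_of_pd_eq_zero s l (hf l hl) _).symm

theorem sub_mul_mem_exactForms {s : ℕ → ℕ → ℂ} {m : ℕ} (hm : 3 ≤ m) {f e : RegRing n c₁ c₂ c₃}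
    (hf : f ∈ sub m) (he : e ∈ exactForms s m) : f * e ∈ exactForms s m :=
  mul_mem_exactForms (fun l hl => pd_eq_zero hl (by have := Finset.mem_Ioc.1 hl; omega) hf) he

/-- The recursion turns solutions of the Gauss-Manin equation for the fibre `F_{n,p+1}` into
solutions for the fibre `F_{n,p}`. Only total derivatives with respect to `y_{p+1}` are needed: the
double pole at `y_{p+1} = y_i` is removed with the primitive `F / (y_{p+1} - y_i)`, and the
one-form `dy_{p+1} / (y_{p+1} - y_2)`, which is not in the basis, with the primitive `F`. -/
theorem SolvesGMY.recursion {s : ℕ → ℕ → ℂ} {κ : ℂ} (hp3 : 3 ≤ p) (hp : p < n)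
    {Ωn : MatrixFamily n (p + 1)} (hΩn : IsAnsatz n (p + 1) Ωn)
    (hGM : SolvesGMY c₁ c₂ c₃ s κ (p + 1) Ωn) {Ω : MatrixFamily n p}
    (hΩ : SatisfiesRecursion n p hp Ωn Ω) : SolvesGMY c₁ c₂ c₃ s κ p Ω := by
  intro i hi a
  have hi' := Finset.mem_Icc.1 hi
  have hq := Finset.mem_Ico.1 (a.head_mem hp)
  set X : ℕ → Word n (p + 1) → RegRing n c₁ c₂ c₃ := fun r P => R (p + 1) r * basisY P with hX
  have hXb : (fun b : Word n p => (basisY b : RegRing n c₁ c₂ c₃)) =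
      fun b => X (b.head hp) b.tail := funext fun b => basisY_cons hp b
  have hrow : ∀ j ∈ (Finset.Icc 2 p).erase i,
      ∑ b : Word n p, Ω i j a b • (basisY b : RegRing n c₁ c₂ c₃) =
      act (Ωn i j) (X (a.head hp)) a.tail +
      (if a.head hp = i then act (Ωn (p + 1) j) (X i) a.tail -
        (if 3 ≤ j then act (Ωn (p + 1) j) (X j) a.tail else 0) else 0) +
      (if a.head hp = j then act (Ωn (p + 1) i) (X j) a.tail - act (Ωn (p + 1) i) (X i) a.tail
        else 0) +
      (if j = 2 ∧ a.head hp = i then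
        ∑ r ∈ Finset.Ico 3 (p + 1), act (Ωn (p + 1) r) (X r) a.tail else 0) := by
    intro j hj
    have hji := Finset.ne_of_mem_erase hj
    have hj2 := Finset.mem_Icc.1 (Finset.mem_of_mem_erase hj)
    have hj1 : j ∈ Finset.Icc 1 p := Finset.mem_Icc.2 (by omega)
    have h := act_recMat hp hΩn hi hj1 hji.symm X a
    rw [← hΩ.eq_recMat hi hj1 hji.symm, ← hXb, if_neg (show ¬ j = 1 by omega), add_zero] at h
    exact h
  rw [basisY_cons hp a, Finset.sum_congr rfl fun j hj => by rw [hrow j hj]]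
  clear hrow hXb hΩ
  generalize a.head hp = q at hq ⊢
  generalize a.tail = Q
  have hN4 : p + 1 ∈ Finset.Icc 4 (p + 1) := Finset.mem_Icc.2 (by omega)
  have hNn : p + 1 ∈ Finset.Icc 4 n := Finset.mem_Icc.2 (by omega)
  have hN2 : p + 1 ∈ Finset.Icc 2 n := Finset.mem_Icc.2 (by omega)
  have hNf : p + 1 ∈ Finset.Ioc p n := Finset.mem_Ioc.2 (by omega)
  have hi4 : i ∈ Finset.Icc 4 n := Finset.mem_Icc.2 (by omega)
  have hi2 : i ∈ Finset.Icc 2 n := Finset.mem_Icc.2 (by omega)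
  have hq2 : q ∈ Finset.Icc 2 n := Finset.mem_Icc.2 (by omega)
  have h22 : 2 ∈ Finset.Icc 2 n := Finset.mem_Icc.2 (by omega)
  have mem2 : ∀ {j}, j ∈ Finset.Icc 2 p → j ∈ Finset.Icc 2 n := fun hj =>
    Finset.Icc_subset_Icc_right hp.le hj
  have neN : ∀ {j}, j ∈ Finset.Icc 2 p → p + 1 ≠ j := fun hj => by
    have := Finset.mem_Icc.1 hj; omega
  -- the Gauss-Manin equation for the smaller fibre, in the directions `i` and `p + 1`
  have e1 := hGM i (Finset.mem_Icc.2 (by omega)) Q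
  have e2 := hGM (p + 1) hN4 Q
  have her1 : (Finset.Icc 2 (p + 1)).erase i = insert (p + 1) ((Finset.Icc 2 p).erase i) := by
    ext x; simp only [Finset.mem_erase, Finset.mem_insert, Finset.mem_Icc]; omega
  have her2 : (Finset.Icc 2 (p + 1)).erase (p + 1) = Finset.Icc 2 p := by
    ext x; simp only [Finset.mem_erase, Finset.mem_Icc]; omega
  set F : Word n (p + 1) → RegRing n c₁ c₂ c₃ := basisY with hF
  set H : ℕ → RegRing n c₁ c₂ c₃ := fun j => act (Ωn i j) F Q with hH
  set G : ℕ → RegRing n c₁ c₂ c₃ := fun j => act (Ωn (p + 1) j) F Q with hG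
  rw [her1, Finset.sum_insert (by simp)] at e1
  rw [her2] at e2
  change covD s i (F Q) - κ • (R i (p + 1) * H (p + 1) +
    ∑ j ∈ (Finset.Icc 2 p).erase i, R i j * H j) ∈ exactForms s (p + 1) at e1
  change covD s (p + 1) (F Q) - κ • (∑ j ∈ Finset.Icc 2 p, R (p + 1) j * G j) ∈
    exactForms s (p + 1) at e2
  have hHN : H (p + 1) = G i := by
    simp only [hH, hG]
    rw [hΩn.symm i (Finset.mem_Icc.2 (by omega)) (p + 1) (Finset.mem_Icc.2 (by omega))]
  rw [hHN, R_swap hi2 hN2] at e1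
  simp only [hX, act_mul_left]
  change covD s i (R (p + 1) q * F Q) - κ • ∑ j ∈ (Finset.Icc 2 p).erase i, R i j *
    (R (p + 1) q * H j +
      (if q = i then R (p + 1) i * G j - (if 3 ≤ j then R (p + 1) j * G j else 0) else 0) +
      (if q = j then R (p + 1) j * G i - R (p + 1) i * G i else 0) +
      (if j = 2 ∧ q = i then ∑ r ∈ Finset.Ico 3 (p + 1), R (p + 1) r * G r else 0)) ∈ _
  have three : ∀ {j}, j ∈ (Finset.Icc 2 p).erase i →
      (R (p + 1) i * R (p + 1) j : RegRing n c₁ c₂ c₃) = (R (p + 1) i - R (p + 1) j) * R i j :=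
    fun {j} hj => R_mul_R hN2 hi2 (mem2 (Finset.mem_of_mem_erase hj)) (by omega)
      (neN (Finset.mem_of_mem_erase hj)) (Finset.ne_of_mem_erase hj).symm
  have memR : ∀ {l m}, l ∈ Finset.Icc 2 (p + 1) → m ∈ Finset.Icc 2 (p + 1) →
      (R l m : RegRing n c₁ c₂ c₃) ∈ sub (p + 1) := fun hl hm => R_mem_sub hl hm
  have hN2' : p + 1 ∈ Finset.Icc 2 (p + 1) := Finset.mem_Icc.2 (by omega)
  have hi2' : i ∈ Finset.Icc 2 (p + 1) := Finset.mem_Icc.2 (by omega)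
  have hiq2' : q ∈ Finset.Icc 2 (p + 1) := Finset.mem_Icc.2 (by omega)
  have h22' : 2 ∈ Finset.Icc 2 (p + 1) := Finset.mem_Icc.2 (by omega)
  have memE : ∀ {l m e}, l ∈ Finset.Icc 2 (p + 1) → m ∈ Finset.Icc 2 (p + 1) →
      e ∈ exactForms s (p + 1) → (R l m : RegRing n c₁ c₂ c₃) * e ∈ exactForms s p :=
    fun hl hm he => exactForms_mono (sub_mul_mem_exactForms (by omega) (memR hl hm) he)
  rw [covD_mul, pd_R hi4 hN2 hq2, if_neg (show ¬ i = p + 1 by omega)]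
  by_cases hqi : q = i
  · subst hqi
    rw [if_pos rfl]
    have hS : ∑ r ∈ Finset.Icc 2 p, R (p + 1) r * G r =
        R (p + 1) 2 * G 2 + ∑ r ∈ Finset.Ico 3 (p + 1), R (p + 1) r * G r := by
      have : Finset.Icc 2 p = insert 2 (Finset.Ico 3 (p + 1)) := by
        ext x; simp only [Finset.mem_insert, Finset.mem_Icc, Finset.mem_Ico]; omega
      rw [this, Finset.sum_insert (by simp)]
    set S : RegRing n c₁ c₂ c₃ := ∑ r ∈ Finset.Icc 2 p, R (p + 1) r * G r with hSdef
    have hrow : ∀ j ∈ (Finset.Icc 2 p).erase q, R q j *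
        (R (p + 1) q * H j +
          (if q = q then R (p + 1) q * G j - (if 3 ≤ j then R (p + 1) j * G j else 0) else 0) +
          (if q = j then R (p + 1) j * G q - R (p + 1) q * G q else 0) +
          (if j = 2 ∧ q = q then ∑ r ∈ Finset.Ico 3 (p + 1), R (p + 1) r * G r else 0)) =
        R (p + 1) q * (R q j * H j) + R (p + 1) q * (R (p + 1) j * G j) +
          (if 2 = j then R q 2 * S else 0) := by
      intro j hj
      have hj' := Finset.mem_Icc.1 (Finset.mem_of_mem_erase hj)
      have t := three hj
      rw [if_pos rfl, if_neg (Finset.ne_of_mem_erase hj).symm]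
      by_cases hj2 : j = 2
      · subst hj2
        rw [if_neg (by norm_num), if_pos ⟨rfl, rfl⟩, if_pos rfl]
        linear_combination (-R q 2) * hS - G 2 * t
      · rw [if_pos (show 3 ≤ j by omega), if_neg (fun h => hj2 h.1), if_neg (Ne.symm hj2)]
        linear_combination (-G j) * t
    have h2m : 2 ∈ (Finset.Icc 2 p).erase q := by
      rw [Finset.mem_erase, Finset.mem_Icc]; omega
    have hSq : S = R (p + 1) q * G q + ∑ j ∈ (Finset.Icc 2 p).erase q, R (p + 1) j * G j :=
      (Finset.add_sum_erase (Finset.Icc 2 p) (fun j => R (p + 1) j * G j)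
        (Finset.mem_Icc.2 (by omega))).symm
    rw [Finset.sum_congr rfl hrow, Finset.sum_add_distrib, Finset.sum_add_distrib,
      Finset.sum_ite_eq, if_pos h2m, ← Finset.mul_sum, ← Finset.mul_sum]
    -- the two primitives, for `q = i`
    have d1 := covD_mem_exactForms (s := s) hNf (R (p + 1) q * F Q)
    have d2 := covD_mem_exactForms (s := s) hNf (R q 2 * F Q)
    rw [covD_mul, pd_R hNn hN2 hq2, if_pos rfl, if_neg (show ¬ p + 1 = q by omega)] at d1
    rw [covD_mul, pd_R hNn hq2 h22, if_neg (show ¬ p + 1 = q by omega),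
      if_neg (show ¬ p + 1 = 2 by omega)] at d2
    have m1 := memE hN2' hi2' e1
    have m2 := memE hN2' hi2' e2
    have m3 := memE hi2' h22' e2
    have := sub_mem (sub_mem (add_mem (add_mem m1 m2) m3) d1) d2
    convert this using 1
    simp only [Algebra.smul_def, hSq]
    ring
  · rw [if_neg (fun h => hqi h.symm)]
    have hqe : q ∈ (Finset.Icc 2 p).erase i := by
      rw [Finset.mem_erase, Finset.mem_Icc]; omega
    have hrow : ∀ j ∈ (Finset.Icc 2 p).erase i, R i j *
        (R (p + 1) q * H j +
          (if q = i then R (p + 1) i * G j - (if 3 ≤ j then R (p + 1) j * G j else 0) else 0) +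
          (if q = j then R (p + 1) j * G i - R (p + 1) i * G i else 0) +
          (if j = 2 ∧ q = i then ∑ r ∈ Finset.Ico 3 (p + 1), R (p + 1) r * G r else 0)) =
        R (p + 1) q * (R i j * H j) +
          (if q = j then -(R (p + 1) i * R (p + 1) q * G i) else 0) := by
      intro j hj
      rw [if_neg hqi, if_neg (show ¬(j = 2 ∧ q = i) from fun h => hqi h.2)]
      split_ifs with h
      · subst h
        linear_combination (G i) * three hj
      · ring
    rw [Finset.sum_congr rfl hrow, Finset.sum_add_distrib, Finset.sum_ite_eq, if_pos hqe,
      ← Finset.mul_sum]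
    convert memE hN2' hiq2' e1 using 1
    simp only [Algebra.smul_def]
    ring

end GaussManin

/-! ### Fuchsian systems in one variable: reduction -/

section Fuchs

variable {n p : ℕ} {c₁ c₂ c₃ : ℂ} {W : Type*} [Fintype W]

/-- `Submodule.sub_mem` for scalars in a subalgebra of the ring of regular functions. The scalars
form a subalgebra of a subalgebra, for which the ring structures expected by the general lemma are
not found by unification; here `a - b` is `a + (-1) • b`. -/
theorem submodule_sub_mem {M : Type*} [AddCommGroup M] [Module (RegRing n c₁ c₂ c₃) M]
    (S : Submodule (sub p : Subalgebra ℂ (RegRing n c₁ c₂ c₃)) M) {a b : M} (ha : a ∈ S)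
    (hb : b ∈ S) : a - b ∈ S := by
  have := S.add_mem ha (S.smul_mem (⟨-1, neg_mem (one_mem _)⟩ :
    (sub p : Subalgebra ℂ (RegRing n c₁ c₂ c₃))) hb)
  rwa [Subalgebra.smul_def, neg_smul, one_smul, ← sub_eq_add_neg] at this

/-- The covariant derivative `∂/∂y_{p+1} + ∑_j A_j / (y_{p+1} - y_j)` of a Fuchsian system with
singularities at `y_2, …, y_p` and infinity. -/
def fuchs (p : ℕ) (A : ℕ → Matrix W W ℂ) (u : W → RegRing n c₁ c₂ c₃) (Q : W) :
    RegRing n c₁ c₂ c₃ :=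
  pd (p + 1) (u Q) + ∑ j ∈ Finset.Icc 2 p, R (p + 1) j * act (A j) u Q

theorem fuchs_add (A : ℕ → Matrix W W ℂ) (u v : W → RegRing n c₁ c₂ c₃) :
    fuchs p A (u + v) = fuchs p A u + fuchs p A v := by
  funext Q
  simp only [fuchs, Pi.add_apply, map_add, act_add_vec, mul_add, Finset.sum_add_distrib]
  ring

/-- A Fuchsian system with exponents that are not positive integers at the finite singularities, and
none that is a negative integer at infinity; moreover the residue at `y_2` is invertible. -/
structure IsNonResonantSystem [DecidableEq W] (p : ℕ) (A : ℕ → Matrix W W ℂ) : Prop where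
  finite : ∀ j ∈ Finset.Icc 2 p, ∀ k : ℕ, 1 ≤ k → IsUnit (A j - (k : ℂ) • (1 : Matrix W W ℂ))
  two : IsUnit (A 2)
  infinite : ∀ k : ℕ, 1 ≤ k → IsUnit (∑ j ∈ Finset.Icc 2 p, A j + (k : ℂ) • (1 : Matrix W W ℂ))

/-- The vectors that are, up to total covariant derivatives, combinations of the
`1 / (y_{p+1} - y_q)`, `q = 3, …, p`, with coefficients that do not depend on `y_{p+1}`. -/
def reducible (hp3 : 3 ≤ p) (hp : p < n) (A : ℕ → Matrix W W ℂ) :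
    Submodule (sub p : Subalgebra ℂ (RegRing n c₁ c₂ c₃)) (W → RegRing n c₁ c₂ c₃) where
  carrier := {h | ∃ u : W → RegRing n c₁ c₂ c₃, ∃ c : ℕ → W → RegRing n c₁ c₂ c₃,
    (∀ Q, u Q ∈ sub (p + 1)) ∧ (∀ q Q, c q Q ∈ sub p) ∧
    h = fun Q => fuchs p A u Q + ∑ q ∈ Finset.Ico 3 (p + 1), R (p + 1) q * c q Q}
  zero_mem' := ⟨0, 0, fun _ => zero_mem _, fun _ _ => zero_mem _, by
    funext Q; simp [fuchs, act]⟩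
  add_mem' := by
    rintro _ _ ⟨u, c, hu, hc, rfl⟩ ⟨u', c', hu', hc', rfl⟩
    refine ⟨u + u', c + c', fun Q => add_mem (hu Q) (hu' Q),
      fun q Q => add_mem (hc q Q) (hc' q Q), ?_⟩
    funext Q
    rw [fuchs_add]
    simp only [Pi.add_apply, mul_add, Finset.sum_add_distrib]
    ring
  smul_mem' := by
    rintro ⟨r, hr⟩ _ ⟨u, c, hu, hc, rfl⟩
    refine ⟨fun Q => r * u Q, fun q Q => r * c q Q,
      fun Q => mul_mem (sub_mono (Nat.le_succ p) hr) (hu Q), fun q Q => mul_mem hr (hc q Q), ?_⟩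
    have h0 : pd (p + 1) r = 0 :=
      pd_eq_zero (Finset.mem_Ioc.2 ⟨Nat.lt_succ_self p, hp⟩) (by omega) hr
    funext Q
    simp only [fuchs, Pi.smul_apply, Subalgebra.smul_def, smul_eq_mul, act_mul_left,
      Derivation.leibniz, h0, mul_zero, add_zero, mul_add, Finset.mul_sum]
    congr 2
    · exact Finset.sum_congr rfl fun j _ => by ring
    · funext q; ring

variable {hp3 : 3 ≤ p} {hp : p < n} {A : ℕ → Matrix W W ℂ}

theorem fuchs_mem_reducible {u : W → RegRing n c₁ c₂ c₃} (hu : ∀ Q, u Q ∈ sub (p + 1)) :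
    fuchs p A u ∈ reducible hp3 hp A :=
  ⟨u, 0, hu, fun _ _ => zero_mem _, by funext Q; simp⟩

theorem mul_R_mem_reducible {q : ℕ} (hq : q ∈ Finset.Ico 3 (p + 1)) {v : W → RegRing n c₁ c₂ c₃}
    (hv : ∀ Q, v Q ∈ sub p) : (fun Q => R (p + 1) q * v Q) ∈ reducible hp3 hp A := by
  refine ⟨0, fun r => if r = q then v else 0, fun _ => zero_mem _, fun r Q => ?_, ?_⟩
  · beta_reduce
    split_ifs
    · exact hv Q
    · exact zero_mem _
  · funext Q
    rw [Finset.sum_eq_single q (fun r _ hr => by simp [if_neg hr]) (fun h => absurd hq h)]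
    simp [fuchs, act]

/-- The covariant derivative of `f v` if `v` does not depend on `y_{p+1}`. -/
theorem fuchs_mul (hp3 : 3 ≤ p) (hp : p < n) (f : RegRing n c₁ c₂ c₃)
    {v : W → RegRing n c₁ c₂ c₃} (hv : ∀ Q, v Q ∈ sub p) :
    fuchs p A (fun Q => f * v Q) = (fun Q => pd (p + 1) f * v Q) +
      ∑ j ∈ Finset.Icc 2 p, fun Q => f * R (p + 1) j * act (A j) v Q := by
  funext Q
  have h0 : pd (p + 1) (v Q) = 0 :=
    pd_eq_zero (Finset.mem_Ioc.2 ⟨Nat.lt_succ_self p, hp⟩) (by omega) (hv Q)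
  simp only [fuchs, act_mul_left, Derivation.leibniz, h0, smul_eq_mul,
    Pi.add_apply, Finset.sum_apply]
  congr 1
  · ring
  · exact Finset.sum_congr rfl fun j _ => by ring

variable [DecidableEq W]

theorem exists_act_eq {B : Matrix W W ℂ} (hB : IsUnit B) {v : W → RegRing n c₁ c₂ c₃}
    (hv : ∀ Q, v Q ∈ sub p) : ∃ w : W → RegRing n c₁ c₂ c₃, (∀ Q, w Q ∈ sub p) ∧ act B w = v := by
  obtain ⟨C, rfl⟩ := hB
  exact ⟨act (C⁻¹ : (Matrix W W ℂ)ˣ).1 v, act_mem (S := Subalgebra.toSubmodule (sub p)) _ hv, by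
    rw [act_act, Units.mul_inv, act_one]⟩

/-- Poles in `y_{p+1}` can be removed. By induction on the order: the covariant derivative of
`v / (y_{p+1} - y_j)^k` has the leading term `(A_j - k) v / (y_{p+1} - y_j)^{k+1}`, and `A_j - k` is
invertible. -/
theorem R_pow_mem_reducible (hA : IsNonResonantSystem p A) (k : ℕ) :
    ∀ j ∈ Finset.Icc 2 p, ∀ v : W → RegRing n c₁ c₂ c₃, (∀ Q, v Q ∈ sub p) →
      (fun Q => R (p + 1) j ^ (k + 1) * v Q) ∈ reducible hp3 hp A := by
  have hN : p + 1 ∈ Finset.Icc 2 n := Finset.mem_Icc.2 (by omega)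
  have hN4 : p + 1 ∈ Finset.Icc 4 n := Finset.mem_Icc.2 (by omega)
  have hn : ∀ {j}, j ∈ Finset.Icc 2 p → j ∈ Finset.Icc 2 n := fun hj =>
    Finset.Icc_subset_Icc_right hp.le hj
  have hactm : ∀ {B : Matrix W W ℂ} {v : W → RegRing n c₁ c₂ c₃}, (∀ Q, v Q ∈ sub p) →
      ∀ Q, act B v Q ∈ sub p := fun hv => act_mem (S := Subalgebra.toSubmodule (sub p)) _ hv
  induction k using Nat.strong_induction_on with
  | _ k ih =>
    intro j hj v hv
    rcases Nat.eq_zero_or_pos k with rfl | hk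
    · simp only [zero_add, pow_one]
      by_cases hj2 : j = 2
      · -- a simple pole at `y_2` is removed with a constant primitive
        subst hj2
        obtain ⟨w, hw, rfl⟩ := exists_act_eq hA.two hv
        have h1 := fuchs_mem_reducible (hp3 := hp3) (hp := hp) (A := A)
          (fun Q => sub_mono (Nat.le_succ p) (hw Q))
        have h2 := fuchs_mul (A := A) hp3 hp 1 hw
        simp only [one_mul, Derivation.map_one_eq_zero, zero_mul] at h2
        change fuchs p A w = _ at h2
        rw [← Finset.add_sum_erase _ _ hj] at h2
        have h3 : ∑ j ∈ (Finset.Icc 2 p).erase 2, (fun Q => R (p + 1) j * act (A j) w Q) ∈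
            reducible hp3 hp A := by
          refine sum_mem fun q hq => mul_R_mem_reducible ?_ (hactm hw)
          simp only [Finset.mem_erase, Finset.mem_Icc] at hq
          exact Finset.mem_Ico.2 (by omega)
        have h4 := submodule_sub_mem _ h1 h3
        rw [h2] at h4
        convert h4 using 1
        funext Q
        simp
      · refine mul_R_mem_reducible ?_ hv
        simp only [Finset.mem_Icc] at hj
        exact Finset.mem_Ico.2 (by omega)
    · obtain ⟨w, hw, rfl⟩ := exists_act_eq (hA.finite j hj k hk) hv
      -- a product of poles at two points is a sum of poles of lower order
      have hC : ∀ i ∈ (Finset.Icc 2 p).erase j, ∀ l, l ≤ k →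
          ∀ v : W → RegRing n c₁ c₂ c₃, (∀ Q, v Q ∈ sub p) →
          (fun Q => R (p + 1) j ^ l * R (p + 1) i * v Q) ∈ reducible hp3 hp A := by
        intro i hi l
        have hi2 := Finset.mem_of_mem_erase hi
        have hiN : p + 1 ≠ i := by have := Finset.mem_Icc.1 hi2; omega
        have hjN : p + 1 ≠ j := by have := Finset.mem_Icc.1 hj; omega
        induction l with
        | zero =>
          intro _ v hv
          simpa using ih 0 hk i hi2 v hv
        | succ l ihl =>
          intro hl v hv
          have hv' : ∀ Q, R i j * v Q ∈ sub p := fun Q => mul_mem (R_mem_sub hi2 hj) (hv Q)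
          have h := submodule_sub_mem _ (ihl (by omega) _ hv') (ih l (by omega) j hj _ hv')
          convert h using 1
          funext Q
          have := R_mul_R (c₁ := c₁) (c₂ := c₂) (c₃ := c₃) hN (hn hi2) (hn hj) hiN hjN
            (Finset.ne_of_mem_erase hi)
          simp only [Pi.sub_apply]
          linear_combination R (p + 1) j ^ l * v Q * this
      have hjN : R (p + 1) j ∈ (sub (p + 1) : Subalgebra ℂ (RegRing n c₁ c₂ c₃)) :=
        R_mem_sub (Finset.mem_Icc.2 (by omega)) (Finset.Icc_subset_Icc_right (Nat.le_succ p) hj)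
      have h1 := fuchs_mem_reducible (hp3 := hp3) (hp := hp) (A := A) (fun Q =>
        mul_mem (pow_mem hjN k) (sub_mono (Nat.le_succ p) (hw Q)))
      rw [fuchs_mul hp3 hp _ hw, ← Finset.add_sum_erase _ _ hj] at h1
      have h3 : ∑ i ∈ (Finset.Icc 2 p).erase j,
          (fun Q => R (p + 1) j ^ k * R (p + 1) i * act (A i) w Q) ∈ reducible hp3 hp A :=
        sum_mem fun i hi => hC i hi k le_rfl _ (hactm hw)
      have h4 := submodule_sub_mem _ h1 h3
      rw [← add_assoc, add_sub_cancel_right] at h4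
      convert h4 using 1
      funext Q
      have hjne : ¬ p + 1 = j := by have := Finset.mem_Icc.1 hj; omega
      simp only [Pi.add_apply]
      rw [Derivation.leibniz_pow, pd_R hN4 hN (hn hj), if_pos rfl, if_neg hjne, act_sub,
        act_smul_one, Pi.smul_apply]
      obtain ⟨k, rfl⟩ := Nat.exists_eq_succ_of_ne_zero hk.ne'
      simp only [Nat.succ_sub_one, Nat.succ_eq_add_one, smul_eq_mul, sub_zero, Algebra.smul_def,
        map_natCast, eq_natCast]
      ring

theorem Y_mul_R (hp3 : 3 ≤ p) (hp : p < n) {j : ℕ} (hj : j ∈ Finset.Icc 2 p) :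
    (Y (p + 1) * R (p + 1) j : RegRing n c₁ c₂ c₃) = 1 + Y j * R (p + 1) j := by
  have := R_mul_sub (c₁ := c₁) (c₂ := c₂) (c₃ := c₃) (i := p + 1) (j := j)
    (Finset.mem_Icc.2 (by omega)) (Finset.Icc_subset_Icc_right hp.le hj)
    (by have := Finset.mem_Icc.1 hj; omega)
  linear_combination this

/-- Poles at `y_{p+1} = ∞` can be removed: the covariant derivative of `y_{p+1}^{k+1} v` has the
leading term `(∑_j A_j + k + 1) y_{p+1}^k v`, whose matrix is invertible. -/
theorem Y_pow_mem_reducible (hA : IsNonResonantSystem p A) (k : ℕ) :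
    ∀ v : W → RegRing n c₁ c₂ c₃, (∀ Q, v Q ∈ sub p) →
      (fun Q => Y (p + 1) ^ k * v Q) ∈ reducible hp3 hp A := by
  have hN : p + 1 ∈ Finset.Icc 2 n := Finset.mem_Icc.2 (by omega)
  have hN4 : p + 1 ∈ Finset.Icc 4 n := Finset.mem_Icc.2 (by omega)
  have hactm : ∀ {B : Matrix W W ℂ} {v : W → RegRing n c₁ c₂ c₃}, (∀ Q, v Q ∈ sub p) →
      ∀ Q, act B v Q ∈ sub p := fun hv => act_mem (S := Subalgebra.toSubmodule (sub p)) _ hv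
  induction k using Nat.strong_induction_on with
  | _ k ih =>
    intro v hv
    obtain ⟨w, hw, rfl⟩ := exists_act_eq (hA.infinite (k + 1) (by omega)) hv
    have hE : ∀ j ∈ Finset.Icc 2 p, ∀ l, l ≤ k →
        ∀ v : W → RegRing n c₁ c₂ c₃, (∀ Q, v Q ∈ sub p) →
        (fun Q => Y (p + 1) ^ l * R (p + 1) j * v Q) ∈ reducible hp3 hp A := by
      intro j hj l
      induction l with
      | zero =>
        intro _ v hv
        simpa using R_pow_mem_reducible (hp3 := hp3) (hp := hp) hA 0 j hj v hv
      | succ l ihl =>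
        intro hl v hv
        have h := add_mem (ih l (by omega) v hv) (ihl (by omega) (fun Q => Y j * v Q)
          fun Q => mul_mem (Y_mem_sub hp.le hj) (hv Q))
        convert h using 1
        funext Q
        simp only [Pi.add_apply]
        linear_combination Y (p + 1) ^ l * v Q *
          Y_mul_R (c₁ := c₁) (c₂ := c₂) (c₃ := c₃) hp3 hp hj
    have h1 := fuchs_mem_reducible (hp3 := hp3) (hp := hp) (A := A)
      (u := fun Q => Y (p + 1) ^ (k + 1) * w Q) (fun Q =>
      mul_mem (pow_mem (Y_mem_sub (n := n) hp (Finset.mem_Icc.2 (by omega))) (k + 1))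
        (sub_mono (Nat.le_succ p) (hw Q)))
    rw [fuchs_mul hp3 hp _ hw] at h1
    have h3 : ∑ j ∈ Finset.Icc 2 p,
        (fun Q => Y (p + 1) ^ k * R (p + 1) j * (Y j * act (A j) w Q)) ∈ reducible hp3 hp A :=
      sum_mem fun j hj => hE j hj k le_rfl _ fun Q => mul_mem (Y_mem_sub hp.le hj) (hactm hw Q)
    have h4 := submodule_sub_mem _ h1 h3
    convert h4 using 1
    funext Q
    simp only [Pi.add_apply, Pi.sub_apply, Finset.sum_apply]
    rw [add_sub_assoc, ← Finset.sum_sub_distrib, Derivation.leibniz_pow, pd_Y hN4 hN, if_pos rfl,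
      act_add, act_sum, act_smul_one, Pi.smul_apply, mul_add, Finset.mul_sum, add_comm]
    simp only [Nat.add_sub_cancel, smul_eq_mul, Algebra.smul_def, map_natCast,
      eq_natCast]
    congr 1
    · ring
    · refine Finset.sum_congr rfl fun j hj => ?_
      linear_combination (-Y (p + 1) ^ k * act (A j) w Q) *
        Y_mul_R (c₁ := c₁) (c₂ := c₂) (c₃ := c₃) hp3 hp hj

/-- Powers of `y_{p+1}` and of the `1 / (y_{p+1} - y_j)`. -/
def partialFractions (n : ℕ) (c₁ c₂ c₃ : ℂ) (p : ℕ) : Set (RegRing n c₁ c₂ c₃) :=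
  {f | ∃ k, f = Y (p + 1) ^ k} ∪ {f | ∃ j ∈ Finset.Icc 2 p, ∃ k, f = R (p + 1) j ^ (k + 1)}

/-- Partial fraction decomposition with respect to `y_{p+1}`. -/
theorem mem_span_partialFractions (hp3 : 3 ≤ p) (hp : p < n) {f : RegRing n c₁ c₂ c₃}
    (hf : f ∈ sub (p + 1)) :
    f ∈ Submodule.span (sub p : Subalgebra ℂ (RegRing n c₁ c₂ c₃))
      (partialFractions n c₁ c₂ c₃ p) := by
  set S := Submodule.span (sub p : Subalgebra ℂ (RegRing n c₁ c₂ c₃))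
      (partialFractions n c₁ c₂ c₃ p) with hS
  have hN : p + 1 ∈ Finset.Icc 2 n := Finset.mem_Icc.2 (by omega)
  have hn : ∀ {j}, j ∈ Finset.Icc 2 p → j ∈ Finset.Icc 2 n := fun hj =>
    Finset.Icc_subset_Icc_right hp.le hj
  have hYm : ∀ k, Y (p + 1) ^ k ∈ S := fun k => Submodule.subset_span (Or.inl ⟨k, rfl⟩)
  have hRm : ∀ j ∈ Finset.Icc 2 p, ∀ k, R (p + 1) j ^ k ∈ S := fun j hj k => by
    rcases k with _ | k
    · simpa using hYm 0
    · exact Submodule.subset_span (Or.inr ⟨j, hj, k, rfl⟩)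
  have hsub : ∀ r ∈ (sub p : Subalgebra ℂ (RegRing n c₁ c₂ c₃)), ∀ s ∈ S, r * s ∈ S :=
    fun r hr s hs => S.smul_mem ⟨r, hr⟩ hs
  have hgen : ∀ g : RegRing n c₁ c₂ c₃, (∀ s ∈ partialFractions n c₁ c₂ c₃ p, g * s ∈ S) →
      ∀ s ∈ S, g * s ∈ S := by
    intro g hg s hs
    induction hs using Submodule.span_induction with
    | mem s hs => exact hg s hs
    | zero => rw [mul_zero]; exact zero_mem _
    | add s t _ _ hs ht => rw [mul_add]; exact add_mem hs ht
    | smul r s _ hs => rw [mul_smul_comm]; exact S.smul_mem r hs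
  have hY : ∀ s ∈ S, Y (p + 1) * s ∈ S := by
    refine hgen _ ?_
    rintro _ (⟨k, rfl⟩ | ⟨j, hj, k, rfl⟩)
    · rw [← pow_succ']; exact hYm _
    · rw [pow_succ', ← mul_assoc, Y_mul_R hp3 hp hj, add_mul, one_mul, mul_assoc, ← pow_succ']
      exact add_mem (hRm j hj k) (hsub _ (Y_mem_sub hp.le hj) _ (hRm j hj (k + 1)))
  have hR : ∀ i ∈ Finset.Icc 2 p, ∀ s ∈ S, R (p + 1) i * s ∈ S := by
    intro i hi
    refine hgen _ ?_
    have hiN : p + 1 ≠ i := by have := Finset.mem_Icc.1 hi; omega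
    rintro _ (⟨k, rfl⟩ | ⟨j, hj, k, rfl⟩)
    · induction k with
      | zero => simpa using hRm i hi 1
      | succ k ih =>
        have h := add_mem (hYm k) (hsub _ (Y_mem_sub hp.le hi) _ ih)
        convert h using 1
        linear_combination Y (p + 1) ^ k * Y_mul_R (c₁ := c₁) (c₂ := c₂) (c₃ := c₃) hp3 hp hi
    · have hjN : p + 1 ≠ j := by have := Finset.mem_Icc.1 hj; omega
      by_cases hij : i = j
      · subst hij
        rw [← pow_succ']; exact hRm _ hi _
      · induction k + 1 with
        | zero => simpa using hRm i hi 1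
        | succ k ih =>
          have h := hsub _ (R_mem_sub hi hj) _ (submodule_sub_mem _ ih (hRm j hj (k + 1)))
          convert h using 1
          have := R_mul_R (c₁ := c₁) (c₂ := c₂) (c₃ := c₃) hN (hn hi) (hn hj) hiN hjN hij
          linear_combination R (p + 1) j ^ k * this
  have hall : ∀ s ∈ S, f * s ∈ S := by
    induction hf using Algebra.adjoin_induction with
    | mem f hf =>
      rcases hf with ⟨l, hl, rfl⟩ | ⟨i, hi, j, hj, rfl⟩
      · by_cases hlN : l = p + 1
        · rw [hlN]; exact hY
        · refine hsub _ (Y_mem_sub hp.le ?_)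
          simp only [Finset.mem_Icc] at hl ⊢; omega
      · have hlt : ∀ {i}, i ∈ Finset.Icc 2 (p + 1) → i ≠ p + 1 → i ∈ Finset.Icc 2 p :=
          fun h h' => by simp only [Finset.mem_Icc] at h ⊢; omega
        by_cases h1 : i = p + 1 <;> by_cases h2 : j = p + 1
        · rw [h1, h2, R_self]
          intro s _
          rw [zero_mul]; exact zero_mem _
        · rw [h1]; exact hR j (hlt hj h2)
        · rw [h2, R_swap (hn (hlt hi h1)) hN]
          intro s hs
          have := submodule_sub_mem _ (zero_mem S) (hR i (hlt hi h1) s hs)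
          convert this using 1
          ring
        · exact hsub _ (R_mem_sub (hlt hi h1) (hlt hj h2))
    | algebraMap r => exact hsub _ ((sub p).algebraMap_mem r)
    | add f g _ _ hf hg => intro s hs; rw [add_mul]; exact add_mem (hf s hs) (hg s hs)
    | mul f g _ _ hf hg => intro s hs; rw [mul_assoc]; exact hf _ (hg s hs)
  have h1 : (1 : RegRing n c₁ c₂ c₃) ∈ S := by simpa using hYm 0
  simpa using hall 1 h1

/-- Every vector of functions reduces to the basis forms `dy_{p+1} / (y_{p+1} - y_q)`. -/
theorem exists_reduction (hp3 : 3 ≤ p) (hp : p < n) (hA : IsNonResonantSystem p A)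
    {h : W → RegRing n c₁ c₂ c₃} (hh : ∀ Q, h Q ∈ sub (p + 1)) :
    ∃ u : W → RegRing n c₁ c₂ c₃, ∃ c : ℕ → W → RegRing n c₁ c₂ c₃,
      (∀ Q, u Q ∈ sub (p + 1)) ∧ (∀ q Q, c q Q ∈ sub p) ∧
      h = fun Q => fuchs p A u Q + ∑ q ∈ Finset.Ico 3 (p + 1), R (p + 1) q * c q Q := by
  change h ∈ reducible hp3 hp A
  have hsingle : ∀ (Q : W) (f : RegRing n c₁ c₂ c₃),
      (Pi.single Q f : W → RegRing n c₁ c₂ c₃) = fun P => f * (Pi.single Q 1 : W → _) P := by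
    intro Q f
    funext P
    by_cases hPQ : P = Q
    · subst hPQ; simp
    · simp [Pi.single_eq_of_ne hPQ]
  have hmem : ∀ Q P, (Pi.single Q 1 : W → RegRing n c₁ c₂ c₃) P ∈ sub p := by
    intro Q P
    by_cases hPQ : P = Q
    · subst hPQ; simp
    · simp [Pi.single_eq_of_ne hPQ]
  rw [← Finset.univ_sum_single h]
  refine sum_mem fun Q _ => ?_
  have hle : Submodule.span (sub p : Subalgebra ℂ (RegRing n c₁ c₂ c₃))
      (partialFractions n c₁ c₂ c₃ p) ≤ (reducible hp3 hp A).comap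
        (LinearMap.single (sub p : Subalgebra ℂ (RegRing n c₁ c₂ c₃)) (fun _ : W => _) Q) := by
    rw [Submodule.span_le]
    rintro _ (⟨k, rfl⟩ | ⟨j, hj, k, rfl⟩)
    · change (Pi.single Q _ : W → RegRing n c₁ c₂ c₃) ∈ reducible hp3 hp A
      rw [hsingle]
      exact Y_pow_mem_reducible hA k _ (hmem Q)
    · change (Pi.single Q _ : W → RegRing n c₁ c₂ c₃) ∈ reducible hp3 hp A
      rw [hsingle]
      exact R_pow_mem_reducible hA k j hj _ (hmem Q)
  exact hle (mem_span_partialFractions hp3 hp (hh Q))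

end Fuchs

/-! ### Fuchsian systems in one variable: independence -/

section PolynomialSystem

open Polynomial

variable {W : Type*} [Fintype W]

theorem eq_zero_of_act_eq_zero [DecidableEq W] {A : Matrix W W ℂ} (hA : IsUnit A) {x : W → ℂ}
    (h : act A x = 0) : x = 0 := by
  obtain ⟨B, rfl⟩ := hA
  have h1 : act (B⁻¹ : (Matrix W W ℂ)ˣ).1 (act B.1 x) = x := by
    rw [act_act, Units.inv_mul, act_one]
  rw [← h1, h]
  funext Q
  simp [act]

theorem eval_act (A : Matrix W W ℂ) (P : W → ℂ[X]) (Q : W) (t : ℂ) :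
    (act A P Q).eval t = act A (fun Q => (P Q).eval t) Q := by
  simp [act, eval_finsetSum]

theorem coeff_act (A : Matrix W W ℂ) (P : W → ℂ[X]) (Q : W) (d : ℕ) :
    (act A P Q).coeff d = act A (fun Q => (P Q).coeff d) Q := by
  simp [act]

theorem act_mul_poly (A : Matrix W W ℂ) (f : ℂ[X]) (P : W → ℂ[X]) (Q : W) :
    act A (fun Q => f * P Q) Q = f * act A P Q := by
  simp [act, Finset.mul_sum]

/-- The polynomial `∏_{j ∈ S} (X - y_j)`. -/
def nodePoly (S : Finset ℕ) (y : ℕ → ℂ) : ℂ[X] := ∏ j ∈ S, (X - C (y j))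

variable {S : Finset ℕ} {y : ℕ → ℂ}

theorem nodePoly_monic (S : Finset ℕ) (y : ℕ → ℂ) : (nodePoly S y).Monic :=
  monic_prod_of_monic _ _ fun _ _ => monic_X_sub_C _

theorem natDegree_nodePoly (S : Finset ℕ) (y : ℕ → ℂ) : (nodePoly S y).natDegree = S.card := by
  rw [nodePoly, natDegree_prod_of_monic _ _ fun _ _ => monic_X_sub_C _]
  simp

theorem eval_nodePoly {j : ℕ} (hj : j ∈ S) : (nodePoly S y).eval (y j) = 0 := by
  rw [nodePoly, eval_prod]
  exact Finset.prod_eq_zero hj (by simp)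

theorem eval_nodePoly_ne_zero {t : ℂ} (ht : ∀ j ∈ S, t ≠ y j) : (nodePoly S y).eval t ≠ 0 := by
  rw [nodePoly, eval_prod]
  exact Finset.prod_ne_zero_iff.2 fun j hj => by simpa [sub_eq_zero] using ht j hj

theorem nodePoly_erase {j : ℕ} (hj : j ∈ S) :
    nodePoly S y = (X - C (y j)) * nodePoly (S.erase j) y :=
  (Finset.mul_prod_erase S (fun j => X - C (y j)) hj).symm

theorem eval_derivative_nodePoly {j : ℕ} (hj : j ∈ S) :
    (derivative (nodePoly S y)).eval (y j) = (nodePoly (S.erase j) y).eval (y j) := by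
  rw [nodePoly_erase hj, derivative_mul]
  simp

/-- If `u = P / ∏_j (X - y_j)^m` solves `u' + ∑_j A_j u / (X - y_j) = ∑_j c_j / (X - y_j)`, where
one of the `c_j` vanishes, then all `c_j` vanish; the hypothesis `h` is this equation with the
denominators cleared. By the conditions on the exponents, `u` has no poles (they are removed one
order at a time) and is constant (its degree is lowered one at a time), so that `A_j u = c_j` for
all `j`; if `c_{j₀} = 0`, the invertible matrix `A_{j₀}` forces `u = 0`. -/
theorem eq_zero_of_poly_system [DecidableEq W] (hy : Set.InjOn y S) {A : ℕ → Matrix W W ℂ}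
    (hfin : ∀ j ∈ S, ∀ k : ℕ, 1 ≤ k → IsUnit (A j - (k : ℂ) • (1 : Matrix W W ℂ)))
    (hinf : ∀ k : ℕ, 1 ≤ k → IsUnit (∑ j ∈ S, A j + (k : ℂ) • (1 : Matrix W W ℂ)))
    {c : ℕ → W → ℂ} {j₀ : ℕ} (hj₀ : j₀ ∈ S) (hA : IsUnit (A j₀)) (hc : c j₀ = 0)
    {m : ℕ} {P : W → ℂ[X]}
    (h : ∀ Q, derivative (P Q) * nodePoly S y - m * (derivative (nodePoly S y) * P Q) +
      ∑ j ∈ S, nodePoly (S.erase j) y * act (A j) P Q =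
      nodePoly S y ^ m * ∑ j ∈ S, nodePoly (S.erase j) y * C (c j Q)) :
    ∀ j ∈ S, c j = 0 := by
  have hne : ∀ j ∈ S, (nodePoly (S.erase j) y).eval (y j) ≠ 0 := fun j hj =>
    eval_nodePoly_ne_zero fun i hi hij => (Finset.ne_of_mem_erase hi)
      (hy (Finset.mem_of_mem_erase hi) hj hij.symm)
  have hsum : ∀ (f : ℕ → ℂ[X]), ∀ j ∈ S, (∑ i ∈ S, nodePoly (S.erase i) y * f i).eval (y j) =
      (nodePoly (S.erase j) y).eval (y j) * (f j).eval (y j) := by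
    intro f j hj
    rw [eval_finsetSum, Finset.sum_eq_single j, eval_mul]
    · intro i _ hij
      rw [eval_mul, eval_nodePoly (Finset.mem_erase.2 ⟨hij.symm, hj⟩), zero_mul]
    · exact fun h => absurd hj h
  induction m generalizing P with
  | succ m ih =>
    -- the leading polar parts vanish
    have hroot : ∀ j ∈ S, ∀ Q, (P Q).eval (y j) = 0 := by
      intro j hj
      suffices (fun Q => (P Q).eval (y j)) = 0 from fun Q => congrFun this Q
      refine eq_zero_of_act_eq_zero (hfin j hj (m + 1) (by omega)) ?_
      funext Q
      have := congrArg (eval (y j)) (h Q)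
      rw [eval_add, hsum _ j hj, eval_sub, eval_mul, eval_mul, eval_mul, eval_mul, eval_pow,
        eval_nodePoly hj, zero_pow (Nat.succ_ne_zero m), eval_derivative_nodePoly hj, eval_act,
        eval_natCast] at this
      rw [act_sub, act_smul_one, Pi.smul_apply, smul_eq_mul, Pi.zero_apply]
      refine mul_left_cancel₀ (hne j hj) ?_
      linear_combination this
    have hdvd : ∀ Q, ∃ P', P Q = nodePoly S y * P' := fun Q =>
      Finset.prod_dvd_of_coprime (fun i hi j hj hij =>
        isCoprime_X_sub_C_of_isUnit_sub (sub_ne_zero.2 fun h => hij (hy hi hj h)).isUnit)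
        fun j hj => dvd_iff_isRoot.2 (hroot j hj Q)
    choose P' hP' using hdvd
    refine ih (P := P') fun Q => mul_left_cancel₀ (nodePoly_monic S y).ne_zero ?_
    have e := h Q
    have hP : P = fun Q => nodePoly S y * P' Q := funext hP'
    rw [hP] at e
    simp only [act_mul_poly, derivative_mul] at e
    have e2 : ∑ j ∈ S, nodePoly (S.erase j) y * (nodePoly S y * act (A j) P' Q) =
        nodePoly S y * ∑ j ∈ S, nodePoly (S.erase j) y * act (A j) P' Q := by
      rw [Finset.mul_sum]
      exact Finset.sum_congr rfl fun j _ => by ring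
    rw [e2] at e
    push_cast at e
    linear_combination e
  | zero =>
    simp only [Nat.cast_zero, zero_mul, sub_zero, pow_zero, one_mul] at h
    -- a solution is constant since it has no pole at infinity
    have hconst : ∀ d : ℕ, 1 ≤ d → (∀ Q, (P Q).natDegree ≤ d) → ∀ Q, (P Q).natDegree ≤ d - 1 := by
      intro d hd hP
      obtain ⟨s, hs⟩ : ∃ s, S.card = s + 1 :=
        ⟨S.card - 1, by have := Finset.card_pos.2 ⟨j₀, hj₀⟩; omega⟩
      have hcoeff : ∀ j ∈ S, ∀ (q : ℂ[X]), q.natDegree ≤ d →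
          (nodePoly (S.erase j) y * q).coeff (s + d) = q.coeff d := by
        intro j hj q hq
        have h1 : (nodePoly (S.erase j) y).natDegree = s := by
          rw [natDegree_nodePoly, Finset.card_erase_of_mem hj, hs, Nat.add_sub_cancel]
        rw [coeff_mul_add_eq_of_natDegree_le h1.le hq, ← h1, (nodePoly_monic _ y).coeff_natDegree,
          one_mul]
      suffices (fun Q => (P Q).coeff d) = 0 by
        intro Q
        rw [natDegree_le_iff_coeff_eq_zero]
        intro N hN
        by_cases hNd : N = d
        · rw [hNd]; exact congrFun this Q
        · exact natDegree_le_iff_coeff_eq_zero.1 (hP Q) N (by omega)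
      refine eq_zero_of_act_eq_zero (hinf d hd) ?_
      funext Q
      have e := congrArg (fun q => q.coeff (s + d)) (h Q)
      simp only [coeff_add, finsetSum_coeff] at e
      have e1 : ∀ j ∈ S, (nodePoly (S.erase j) y * act (A j) P Q).coeff (s + d) =
          act (A j) (fun Q => (P Q).coeff d) Q := by
        intro j hj
        rw [hcoeff j hj _ ?_, coeff_act]
        exact natDegree_sum_le_of_forall_le _ _ fun Q' _ =>
          (natDegree_smul_le _ _).trans (hP Q')
      have e2 : ∀ j ∈ S, (nodePoly (S.erase j) y * C (c j Q)).coeff (s + d) = 0 := by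
        intro j hj
        rw [hcoeff j hj _ (by simp), coeff_C, if_neg (by omega)]
      have e3 : (derivative (P Q) * nodePoly S y).coeff (s + d) = (P Q).coeff d * d := by
        obtain ⟨d, rfl⟩ : ∃ d', d = d' + 1 := ⟨d - 1, by omega⟩
        have h1 : (nodePoly S y).natDegree = s + 1 := by rw [natDegree_nodePoly, hs]
        have h2 : (derivative (P Q)).natDegree ≤ d :=
          (natDegree_derivative_le _).trans (by have := hP Q; omega)
        rw [show s + (d + 1) = d + (s + 1) by ring, coeff_mul_add_eq_of_natDegree_le h2 h1.le,
          ← h1, (nodePoly_monic _ y).coeff_natDegree, mul_one, coeff_derivative]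
        push_cast
        ring
      rw [Finset.sum_congr rfl e1, Finset.sum_congr rfl e2, Finset.sum_const_zero, e3] at e
      rw [act_add, act_sum, act_smul_one, Pi.smul_apply, smul_eq_mul, Pi.zero_apply]
      linear_combination e
    have hdeg : ∀ d : ℕ, (∀ Q, (P Q).natDegree ≤ d) → ∀ Q, (P Q).natDegree ≤ 0 := by
      intro d
      induction d with
      | zero => exact fun h => h
      | succ d ih => exact fun h => ih (hconst (d + 1) (by omega) h)
    have h0 := hdeg (∑ Q, (P Q).natDegree) fun Q =>
      Finset.single_le_sum (f := fun Q => (P Q).natDegree) (fun _ _ => Nat.zero_le _)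
        (Finset.mem_univ Q)
    have hP : ∀ Q, P Q = C ((P Q).coeff 0) := fun Q => eq_C_of_natDegree_le_zero (h0 Q)
    set x : W → ℂ := fun Q => (P Q).coeff 0 with hx
    -- for constant `u` the equation compares residues
    have hres : ∀ j ∈ S, act (A j) x = c j := by
      intro j hj
      funext Q
      have e := congrArg (eval (y j)) (h Q)
      rw [eval_add, hsum _ j hj, hsum _ j hj, eval_mul, eval_nodePoly hj, mul_zero, zero_add,
        eval_act, eval_C] at e
      have hPx : (fun Q => (P Q).eval (y j)) = x := by
        funext Q
        rw [hP Q, eval_C]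
      rw [hPx] at e
      exact mul_left_cancel₀ (hne j hj) e
    have hx0 : x = 0 := eq_zero_of_act_eq_zero hA ((hres j₀ hj₀).trans hc)
    intro j hj
    rw [← hres j hj, hx0]
    funext Q
    simp [act]

end PolynomialSystem

section Evaluation

open Polynomial

variable {n p : ℕ} {c₁ c₂ c₃ : ℂ}

/-- The coordinate `y_N` of a point can be moved to any value away from the other punctures. -/
theorem exists_move {N : ℕ} (hN : N ∈ Finset.Icc 4 n) (z : config n c₁ c₂ c₃) {t : ℂ} (h0 : t ≠ 0)
    (ht : ∀ j ∈ (Finset.Icc 2 n).erase N, t ≠ yFun j z) :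
    ∃ z' : config n c₁ c₂ c₃, (∀ i, i ≠ N → z'.1 i = z.1 i) ∧ yFun N z' = t := by
  have hN' := Finset.mem_Icc.1 hN
  have hmem : Function.update z.1 N (z.1 1 + 1 / t) ∈ config n c₁ c₂ c₃ := by
    refine update_mem_config hN z fun j hj h => ?_
    have hjN := Finset.ne_of_mem_erase hj
    have hj1 := Finset.mem_Icc.1 (Finset.mem_of_mem_erase hj)
    by_cases hj' : j = 1
    · rw [hj', add_eq_left, one_div, inv_eq_zero] at h
      exact h0 h
    · refine ht j (Finset.mem_erase.2 ⟨hjN, Finset.mem_Icc.2 (by omega)⟩) ?_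
      rw [yFun, ← h, add_sub_cancel_left, one_div_one_div]
  refine ⟨⟨_, hmem⟩, fun i hi => Function.update_of_ne hi _ _, ?_⟩
  rw [yFun]
  simp only [Function.update_self]
  rw [Function.update_of_ne (show 1 ≠ N by omega), add_sub_cancel_left, one_div_one_div]

theorem yFun_congr {N : ℕ} (hN : N ∈ Finset.Icc 4 n) {z z' : config n c₁ c₂ c₃}
    (h : ∀ i, i ≠ N → z'.1 i = z.1 i) {j : ℕ} (hj : j ≠ N) : yFun j z' = yFun j z := by
  have hN' := Finset.mem_Icc.1 hN
  rw [yFun, yFun, h j hj, h 1 (by omega)]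

/-- Polynomial identities in `y_N` may be checked on the configuration space. -/
theorem poly_eq_of_eval_eq {N : ℕ} (hN : N ∈ Finset.Icc 4 n) (z : config n c₁ c₂ c₃) {P P' : ℂ[X]}
    (h : ∀ z' : config n c₁ c₂ c₃, (∀ i, i ≠ N → z'.1 i = z.1 i) →
      P.eval (yFun N z') = P'.eval (yFun N z')) : P = P' := by
  refine eq_of_infinite_eval_eq P P' ?_
  have hfin : (insert 0 (((Finset.Icc 2 n).erase N).image fun j => yFun j z) : Set ℂ).Finite :=
    ((((Finset.Icc 2 n).erase N).image fun j => yFun j z).finite_toSet).insert 0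
  refine hfin.infinite_compl.mono fun t ht => ?_
  simp only [Set.mem_compl_iff, Set.mem_insert_iff, Finset.coe_image, Set.mem_image, not_or,
    not_exists, not_and] at ht
  obtain ⟨z', h1, h2⟩ := exists_move hN z ht.1 fun j hj hjt => ht.2 j hj hjt.symm
  have := h z' h1
  rwa [h2] at this

theorem injOn_yFun (hp : p ≤ n) (z : config n c₁ c₂ c₃) :
    Set.InjOn (fun j => yFun j z) (Finset.Icc 2 p) := by
  intro i hi j hj hij
  by_contra hne
  exact yFun_ne (Finset.Icc_subset_Icc_right hp hi) (Finset.Icc_subset_Icc_right hp hj) hne z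
    (sub_eq_zero.2 hij)

theorem eval_nodePoly_mul_ev_R {S : Finset ℕ} {N : ℕ} (hN : N ∈ Finset.Icc 4 n)
    (hS : S ⊆ (Finset.Icc 2 n).erase N) {z z' : config n c₁ c₂ c₃}
    (h : ∀ i, i ≠ N → z'.1 i = z.1 i) {j : ℕ} (hj : j ∈ S) :
    (nodePoly S fun j => yFun j z).eval (yFun N z') * ev z' (R N j) =
      (nodePoly (S.erase j) fun j => yFun j z).eval (yFun N z') := by
  have hj' := hS hj
  have hjN := Finset.ne_of_mem_erase hj'
  have hN2 : N ∈ Finset.Icc 2 n := by simp only [Finset.mem_Icc] at hN ⊢; omega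
  have hne := yFun_ne hN2 (Finset.mem_of_mem_erase hj') hjN.symm z'
  rw [nodePoly_erase hj, ev_R hN2 (Finset.mem_of_mem_erase hj'), eval_mul, ← yFun_congr hN h hjN]
  simp only [eval_sub, eval_X, eval_C]
  field_simp

/-- The functions `1 / (y_i - y_j)` with fixed `i` are linearly independent. -/
theorem eq_zero_of_sum_R_eq_zero {i : ℕ} (hi : i ∈ Finset.Icc 4 n) {S : Finset ℕ}
    (hS : S ⊆ (Finset.Icc 2 n).erase i) (z : config n c₁ c₂ c₃) {a : ℕ → ℂ}
    (h : ∑ j ∈ S, a j • (R i j : RegRing n c₁ c₂ c₃) = 0) : ∀ j ∈ S, a j = 0 := by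
  have hp : ∑ j ∈ S, nodePoly (S.erase j) (fun j => yFun j z) * C (a j) = 0 := by
    refine poly_eq_of_eval_eq hi z fun z' hz' => ?_
    have e := congrArg (fun x => (nodePoly S fun j => yFun j z).eval (yFun i z') * ev z' x) h
    simp only [map_sum, map_smul, map_zero, mul_zero, Finset.mul_sum] at e
    rw [eval_zero, eval_finsetSum, ← e]
    refine Finset.sum_congr rfl fun j hj => ?_
    rw [eval_mul, eval_C, ← eval_nodePoly_mul_ev_R hi hS hz' hj, smul_eq_mul]
    ring
  have hinj := injOn_yFun le_rfl z
  have hS2 : ∀ {j}, j ∈ S → j ∈ Finset.Icc 2 n := fun h => Finset.mem_of_mem_erase (hS h)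
  intro j hj
  have e := congrArg (eval (yFun j z)) hp
  rw [eval_zero, eval_finsetSum, Finset.sum_eq_single j, eval_mul, eval_C] at e
  · refine (mul_eq_zero.1 e).resolve_left (eval_nodePoly_ne_zero fun l hl hlj => ?_)
    exact Finset.ne_of_mem_erase hl (hinj (hS2 (Finset.mem_of_mem_erase hl)) (hS2 hj) hlj.symm)
  · intro l _ hlj
    rw [eval_mul, eval_nodePoly (y := fun j => yFun j z) (Finset.mem_erase.2 ⟨hlj.symm, hj⟩),
      zero_mul]
  · exact fun h => absurd hj h

/-- The function `f` is `P / ∏_j (y_{p+1} - y_j)^m` as a function of `y_{p+1}`, the other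
coordinates being those of `z`, and its derivative is the derivative of this quotient. -/
def IsFraction (p : ℕ) (z : config n c₁ c₂ c₃) (f : RegRing n c₁ c₂ c₃) (m : ℕ) (P : ℂ[X]) : Prop :=
  ∀ z' : config n c₁ c₂ c₃, (∀ i, i ≠ p + 1 → z'.1 i = z.1 i) →
    ev z' f * (nodePoly (Finset.Icc 2 p) fun j => yFun j z).eval (yFun (p + 1) z') ^ m =
      P.eval (yFun (p + 1) z') ∧
    ev z' (pd (p + 1) f) *
        (nodePoly (Finset.Icc 2 p) fun j => yFun j z).eval (yFun (p + 1) z') ^ (m + 1) =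
      (derivative P * (nodePoly (Finset.Icc 2 p) fun j => yFun j z) -
        m * (derivative (nodePoly (Finset.Icc 2 p) fun j => yFun j z) * P)).eval (yFun (p + 1) z')

variable {z : config n c₁ c₂ c₃} {f g : RegRing n c₁ c₂ c₃} {m m' : ℕ} {P P' : ℂ[X]}

theorem IsFraction.mul (hf : IsFraction p z f m P) (hg : IsFraction p z g m' P') :
    IsFraction p z (f * g) (m + m') (P * P') := by
  intro z' hz'
  obtain ⟨h1, h2⟩ := hf z' hz'
  obtain ⟨h3, h4⟩ := hg z' hz'
  refine ⟨?_, ?_⟩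
  · rw [map_mul, eval_mul, ← h1, ← h3]; ring
  · rw [Derivation.leibniz, smul_eq_mul, smul_eq_mul, map_add, map_mul, map_mul]
    simp only [derivative_mul, eval_sub, eval_mul, eval_add, eval_natCast, Nat.cast_add] at h2 h4 ⊢
    rw [← h1] at h2 ⊢
    rw [← h3] at h4 ⊢
    linear_combination (ev z' f *
      (nodePoly (Finset.Icc 2 p) fun j => yFun j z).eval (yFun (p + 1) z') ^ m) * h4 + (ev z' g *
      (nodePoly (Finset.Icc 2 p) fun j => yFun j z).eval (yFun (p + 1) z') ^ m') * h2

theorem IsFraction.add_same (hf : IsFraction p z f m P) (hg : IsFraction p z g m P') :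
    IsFraction p z (f + g) m (P + P') := by
  intro z' hz'
  obtain ⟨h1, h2⟩ := hf z' hz'
  obtain ⟨h3, h4⟩ := hg z' hz'
  refine ⟨?_, ?_⟩
  · rw [map_add, eval_add, ← h1, ← h3]; ring
  · rw [map_add, map_add, add_mul, h2, h4]
    simp only [derivative_add, eval_sub, eval_mul, eval_add, eval_natCast]
    ring

theorem isFraction_one (p : ℕ) (z : config n c₁ c₂ c₃) (k : ℕ) :
    IsFraction p z 1 k ((nodePoly (Finset.Icc 2 p) fun j => yFun j z) ^ k) := by
  intro z' hz'
  refine ⟨by rw [map_one, one_mul, eval_pow], ?_⟩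
  rw [Derivation.map_one_eq_zero, map_zero, zero_mul, derivative_pow]
  rcases k with _ | k
  · simp
  · simp only [Nat.add_sub_cancel, eval_sub, eval_mul, eval_pow, eval_natCast, eval_C]
    ring

theorem IsFraction.mono (hf : IsFraction p z f m P) (h : m ≤ m') :
    IsFraction p z f m' (P * (nodePoly (Finset.Icc 2 p) fun j => yFun j z) ^ (m' - m)) := by
  have := hf.mul (isFraction_one p z (m' - m))
  rwa [mul_one, Nat.add_sub_cancel' h] at this

/-- On a line along which only `y_{p+1}` varies, a regular function of `y_4, …, y_{p+1}` is a
rational function of `y_{p+1}` with poles at the other punctures. -/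
theorem exists_isFraction (hp3 : 3 ≤ p) (hp : p < n) (z : config n c₁ c₂ c₃)
    {f : RegRing n c₁ c₂ c₃} (hf : f ∈ sub (p + 1)) : ∃ m P, IsFraction p z f m P := by
  have hN4 : p + 1 ∈ Finset.Icc 4 n := Finset.mem_Icc.2 (by omega)
  have hN2 : p + 1 ∈ Finset.Icc 2 n := Finset.mem_Icc.2 (by omega)
  have hNf : p + 1 ∈ Finset.Ioc p n := Finset.mem_Ioc.2 (by omega)
  have hS : Finset.Icc 2 p ⊆ (Finset.Icc 2 n).erase (p + 1) := fun j hj => by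
    simp only [Finset.mem_Icc, Finset.mem_erase] at hj ⊢; omega
  have hconst : ∀ {f : RegRing n c₁ c₂ c₃}, f ∈ sub p → ∃ m P, IsFraction p z f m P := by
    intro f hf
    refine ⟨0, C (ev z f), fun z' hz' => ?_⟩
    have h1 : ev z' f = ev z f := sub_apply_congr hp.le hf fun i hi => hz' i (by
      have := Finset.mem_Icc.1 hi; omega)
    rw [pd_eq_zero hNf (by omega) hf, h1]
    simp
  have hR : ∀ j ∈ Finset.Icc 2 p, ∃ m P, IsFraction p z (R (p + 1) j) m P := by
    intro j hj
    refine ⟨1, nodePoly ((Finset.Icc 2 p).erase j) fun j => yFun j z, fun z' hz' => ?_⟩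
    have e := eval_nodePoly_mul_ev_R hN4 hS hz' hj
    refine ⟨by rw [← e]; ring, ?_⟩
    rw [pd_R hN4 hN2 (Finset.mem_of_mem_erase (hS hj)), if_pos rfl,
      if_neg (Finset.ne_of_mem_erase (hS hj)).symm, nodePoly_erase hj] at *
    simp only [derivative_mul, eval_sub, eval_mul, eval_add, eval_natCast, derivative_X,
      derivative_C, eval_X, eval_C, eval_one, eval_zero, map_mul, map_neg, map_sub,
      map_one, map_zero, map_pow] at e ⊢
    set π := (nodePoly ((Finset.Icc 2 p).erase j) fun j => yFun j z).eval (yFun (p + 1) z')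
    push_cast
    linear_combination (-((yFun (p + 1) z' - yFun j z) * π * ev z' (R (p + 1) j) + π)) * e
  have hneg : ∀ {f : RegRing n c₁ c₂ c₃}, (∃ m P, IsFraction p z f m P) →
      ∃ m P, IsFraction p z (-f) m P := by
    rintro f ⟨m, P, h⟩
    obtain ⟨m', P', h'⟩ := hconst (neg_mem (one_mem (sub p)))
    refine ⟨m' + m, P' * P, ?_⟩
    convert h'.mul h using 1
    ring
  induction hf using Algebra.adjoin_induction with
  | mem f hf =>
    have hlt : ∀ {i}, i ∈ Finset.Icc 2 (p + 1) → i ≠ p + 1 → i ∈ Finset.Icc 2 p :=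
      fun h h' => by simp only [Finset.mem_Icc] at h ⊢; omega
    rcases hf with ⟨l, hl, rfl⟩ | ⟨i, hi, j, hj, rfl⟩
    · by_cases hlN : l = p + 1
      · subst hlN
        refine ⟨0, X, fun z' hz' => ?_⟩
        rw [pd_Y hN4 hN2, if_pos rfl, ev_Y hN2]
        simp
      · exact hconst (Y_mem_sub hp.le (by simp only [Finset.mem_Icc] at hl ⊢; omega))
    · by_cases h1 : i = p + 1 <;> by_cases h2 : j = p + 1
      · rw [h1, h2, R_self]; exact hconst (zero_mem _)
      · rw [h1]; exact hR j (hlt hj h2)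
      · rw [h2, R_swap (Finset.mem_of_mem_erase (hS (hlt hi h1))) hN2]
        exact hneg (hR i (hlt hi h1))
      · exact hconst (R_mem_sub (hlt hi h1) (hlt hj h2))
  | algebraMap r => exact hconst ((sub p).algebraMap_mem r)
  | add f g _ _ hf hg =>
    obtain ⟨m, P, h⟩ := hf
    obtain ⟨m', P', h'⟩ := hg
    exact ⟨_, _, (h.mono (Nat.le_add_right m m')).add_same (h'.mono (Nat.le_add_left m' m))⟩
  | mul f g _ _ hf hg =>
    obtain ⟨m, P, h⟩ := hf
    obtain ⟨m', P', h'⟩ := hg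
    exact ⟨_, _, h.mul h'⟩

variable {W : Type*} [Fintype W] {A : ℕ → Matrix W W ℂ}

theorem ev_act (z : config n c₁ c₂ c₃) (B : Matrix W W ℂ) (u : W → RegRing n c₁ c₂ c₃) (Q : W) :
    ev z (act B u Q) = act B (fun Q => ev z (u Q)) Q := by
  simp [act]

/-- The basis forms `dy_{p+1} / (y_{p+1} - y_q)`, `q = 3, …, p`, are independent modulo total
covariant derivatives. -/
theorem eq_zero_of_fuchs_eq [DecidableEq W] (hp3 : 3 ≤ p) (hp : p < n)
    (hA : IsNonResonantSystem p A)
    {u : W → RegRing n c₁ c₂ c₃} (hu : ∀ Q, u Q ∈ sub (p + 1)) {c : ℕ → W → RegRing n c₁ c₂ c₃}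
    (hc : ∀ q Q, c q Q ∈ sub p)
    (h : ∀ Q, fuchs p A u Q = ∑ q ∈ Finset.Ico 3 (p + 1), R (p + 1) q * c q Q) :
    ∀ q ∈ Finset.Ico 3 (p + 1), ∀ Q, c q Q = 0 := by
  intro q hq Q
  refine RegRing.ext_ev fun z => ?_
  have hN4 : p + 1 ∈ Finset.Icc 4 n := Finset.mem_Icc.2 (by omega)
  have hS : Finset.Icc 2 p ⊆ (Finset.Icc 2 n).erase (p + 1) := fun j hj => by
    simp only [Finset.mem_Icc, Finset.mem_erase] at hj ⊢; omega
  have h2 : 2 ∈ Finset.Icc 2 p := Finset.mem_Icc.2 (by omega)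
  choose m P hP using fun Q => exists_isFraction hp3 hp z (hu Q)
  have hm : ∀ Q, m Q ≤ ∑ Q, m Q := fun Q =>
    Finset.single_le_sum (fun _ _ => Nat.zero_le _) (Finset.mem_univ Q)
  obtain ⟨M, P', hP'⟩ : ∃ M, ∃ P' : W → ℂ[X], ∀ Q, IsFraction p z (u Q) M (P' Q) :=
    ⟨_, _, fun Q => (hP Q).mono (hm Q)⟩
  set c' : ℕ → W → ℂ := fun q Q => if q = 2 then 0 else ev z (c q Q) with hc'
  have hq' := Finset.mem_Ico.1 hq
  have key := eq_zero_of_poly_system (y := fun j => yFun j z) (injOn_yFun hp.le z) hA.finite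
    hA.infinite (c := c') h2 hA.two (by funext Q; simp [hc']) (m := M) (P := P') (fun Q => ?_)
    q (Finset.mem_Icc.2 (by omega))
  · have := congrFun key Q
    rw [hc'] at this
    simp only [if_neg (show q ≠ 2 by omega), Pi.zero_apply] at this
    rw [this, map_zero]
  · refine poly_eq_of_eval_eq hN4 z fun z' hz' => ?_
    have e := congrArg (ev z') (h Q)
    have hsum : ∑ q ∈ Finset.Ico 3 (p + 1), ev z' (R (p + 1) q) * ev z' (c q Q) =
        ∑ q ∈ Finset.Icc 2 p, ev z' (R (p + 1) q) * c' q Q := by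
      have hS2 : Finset.Icc 2 p = insert 2 (Finset.Ico 3 (p + 1)) := by
        ext x; simp only [Finset.mem_insert, Finset.mem_Icc, Finset.mem_Ico]; omega
      rw [hS2, Finset.sum_insert (by simp), hc']
      simp only [if_true, mul_zero, zero_add]
      refine Finset.sum_congr rfl fun q hq => ?_
      rw [if_neg (by have := Finset.mem_Ico.1 hq; omega)]
      congr 1
      exact sub_apply_congr hp.le (hc q Q) fun i hi => hz' i (by
        have := Finset.mem_Icc.1 hi; omega)
    simp only [fuchs, map_add, map_sum, map_mul, ev_act] at e
    rw [hsum] at e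
    have hPe : ∀ Q, (P' Q).eval (yFun (p + 1) z') = _ := fun Q => (hP' Q z' hz').1.symm
    simp only [eval_add, eval_mul, eval_pow, eval_finsetSum, eval_act, eval_C]
    rw [← (hP' Q z' hz').2]
    simp only [hPe]
    have hact : ∀ j, act (A j) (fun Q => ev z' (u Q) *
        (nodePoly (Finset.Icc 2 p) fun j => yFun j z).eval (yFun (p + 1) z') ^ M) Q =
        act (A j) (fun Q => ev z' (u Q)) Q *
          (nodePoly (Finset.Icc 2 p) fun j => yFun j z).eval (yFun (p + 1) z') ^ M := fun j => by
      simp [act, Finset.sum_mul, mul_assoc]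
    simp only [hact]
    rw [Finset.sum_congr rfl fun j hj => by rw [← eval_nodePoly_mul_ev_R hN4 hS hz' hj],
      Finset.sum_congr (s₁ := Finset.Icc 2 p) (f := fun j => eval _ (nodePoly _ _) * c' j Q) rfl
        fun j hj => by rw [← eval_nodePoly_mul_ev_R hN4 hS hz' hj]]
    set π := (nodePoly (Finset.Icc 2 p) fun j => yFun j z).eval (yFun (p + 1) z')
    have e' := congrArg (fun x => π ^ (M + 1) * x) e
    simp only [mul_add, Finset.mul_sum] at e' ⊢
    rw [mul_comm (π ^ (M + 1))] at e'
    convert e' using 2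
    · exact Finset.sum_congr rfl fun j _ => by ring
    · ring

end Evaluation

/-! ### The fibration basis is a basis of twisted cohomology -/

section Cohomology

variable {n p : ℕ} {c₁ c₂ c₃ : ℂ} {s : ℕ → ℕ → ℂ} {κ : ℂ}

/-- The twisted connection is flat. -/
theorem covD_comm (hs : ∀ i j, s i j = s j i) {l m : ℕ} (hl : l ∈ Finset.Icc 4 n)
    (hm : m ∈ Finset.Icc 4 n) (f : RegRing n c₁ c₂ c₃) :
    covD s l (covD s m f) = covD s m (covD s l f) := by
  by_cases hlm : l = m
  · rw [hlm]
  have h2 : ∀ {l}, l ∈ Finset.Icc 4 n → l ∈ Finset.Icc 2 n := fun h => by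
    simp only [Finset.mem_Icc] at h ⊢; omega
  have key : ∀ {l m : ℕ}, l ∈ Finset.Icc 4 n → m ∈ Finset.Icc 4 n → l ≠ m →
      pd l (∑ j ∈ Finset.Icc 2 n, s m j • (R m j : RegRing n c₁ c₂ c₃)) = s m l • R m l ^ 2 := by
    intro l m hl hm hlm
    rw [map_sum, Finset.sum_eq_single l]
    · rw [Derivation.map_smul, pd_R hl (h2 hm) (h2 hl), if_neg hlm, if_pos rfl]
      simp
    · intro j hj hjl
      rw [Derivation.map_smul, pd_R hl (h2 hm) hj, if_neg hlm, if_neg hjl.symm]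
      simp
    · exact fun h => absurd (h2 hl) h
  have e : s m l • (R m l : RegRing n c₁ c₂ c₃) ^ 2 = s l m • R l m ^ 2 := by
    rw [hs m l, R_swap (h2 hm) (h2 hl)]
    congr 1
    ring
  rw [covD_apply, covD_apply s m f, covD_apply, covD_apply s l f, map_add, map_add,
    Derivation.leibniz, Derivation.leibniz, key hl hm hlm, key hm hl (Ne.symm hlm), e,
    pd_comm hl hm]
  simp only [smul_eq_mul]
  ring

theorem covD_mem_of_mem (hs : ∀ i j, s i j = s j i) {l m : ℕ} (hm : 3 ≤ m)
    (hl : l ∈ Finset.Icc 4 n) {e : RegRing n c₁ c₂ c₃} (he : e ∈ exactForms s m) :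
    covD s l e ∈ exactForms s m := by
  obtain ⟨g, rfl⟩ := he
  refine ⟨fun j => covD s l (g j), ?_⟩
  rw [map_sum]
  exact Finset.sum_congr rfl fun j hj => covD_comm hs hl (Ioc_subset_Icc_four hm hj) _

/-- The fibration basis spans the twisted cohomology of the fibre `F_{n,p}`, over the regular
functions on the base. -/
def BasisSpans (c₁ c₂ c₃ : ℂ) (s : ℕ → ℕ → ℂ) (n p : ℕ) : Prop :=
  ∀ f : RegRing n c₁ c₂ c₃, ∃ h : Word n p → RegRing n c₁ c₂ c₃, (∀ a, h a ∈ sub p) ∧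
    f - ∑ a, h a * basisY a ∈ exactForms s p

/-- The fibration basis is independent in the twisted cohomology of the fibre `F_{n,p}`, over the
regular functions on the base. -/
def BasisIndependent (c₁ c₂ c₃ : ℂ) (s : ℕ → ℕ → ℂ) (n p : ℕ) : Prop :=
  ∀ h : Word n p → RegRing n c₁ c₂ c₃, (∀ a, h a ∈ sub p) →
    ∑ a, h a * basisY a ∈ exactForms s p → h = 0

instance : IsEmpty ↥(Finset.Ioc n n) := by
  rw [Finset.Ioc_self]
  infer_instance

theorem basisY_self (a : Word n n) : (basisY a : RegRing n c₁ c₂ c₃) = 1 := by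
  rw [basisY, Finset.univ_eq_empty, Finset.prod_empty]

theorem sum_word_self {M : Type*} [AddCommMonoid M] (g : Word n n → M) (a : Word n n) :
    ∑ b, g b = g a := by
  have : Subsingleton (Word n n) := inferInstance
  rw [Finset.sum_eq_single a (fun b _ hb => absurd (Subsingleton.elim b a) hb)
    fun h => absurd (Finset.mem_univ a) h]

theorem exactForms_self {e : RegRing n c₁ c₂ c₃} (he : e ∈ exactForms s n) : e = 0 := by
  obtain ⟨g, rfl⟩ := he
  rw [Finset.Ioc_self, Finset.sum_empty]

theorem basisSpans_self (c₁ c₂ c₃ : ℂ) (s : ℕ → ℕ → ℂ) (n : ℕ) : BasisSpans c₁ c₂ c₃ s n n := by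
  intro f
  refine ⟨fun _ => f, fun _ => by rw [sub_top]; trivial, ?_⟩
  rw [sum_word_self _ isEmptyElim, basisY_self, mul_one, sub_self]
  exact zero_mem _

theorem basisIndependent_self (c₁ c₂ c₃ : ℂ) (s : ℕ → ℕ → ℂ) (n : ℕ) :
    BasisIndependent c₁ c₂ c₃ s n n := by
  intro h _ he
  funext a
  have := exactForms_self he
  rwa [sum_word_self _ a, basisY_self, mul_one] at this

/-- The residues of the Fuchsian system that the coefficients with respect to the fibration basis
obey in the direction of `y_{p+1}`. -/
def fibreSystem (κ : ℂ) (Ω : MatrixFamily n (p + 1)) (j : ℕ) :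
    Matrix (Word n (p + 1)) (Word n (p + 1)) ℂ :=
  κ • (Ω (p + 1) j).transpose

theorem sum_mul_act {W : Type*} [Fintype W] (B : Matrix W W ℂ) (u F : W → RegRing n c₁ c₂ c₃) :
    ∑ P, u P * act B F P = ∑ Q, act B.transpose u Q * F Q := by
  simp only [act, Finset.mul_sum, Finset.sum_mul, Matrix.transpose_apply]
  rw [Finset.sum_comm]
  refine Finset.sum_congr rfl fun Q _ => Finset.sum_congr rfl fun P _ => ?_
  rw [mul_smul_comm, smul_mul_assoc]

theorem act_smul {W : Type*} [Fintype W] (r : ℂ) (B : Matrix W W ℂ)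
    (u : W → RegRing n c₁ c₂ c₃) (Q : W) : act (r • B) u Q = r • act B u Q := by
  simp [act, Finset.smul_sum, mul_smul]

/-- The covariant derivative in the direction of `y_{p+1}` acts on the twisted cohomology of the
smaller fibre as a Fuchsian system. -/
theorem covD_sum_sub_mem (hp3 : 3 ≤ p) {Ω : MatrixFamily n (p + 1)}
    (hΩ : SolvesGMY c₁ c₂ c₃ s κ (p + 1) Ω) {u : Word n (p + 1) → RegRing n c₁ c₂ c₃}
    (hu : ∀ Q, u Q ∈ sub (p + 1)) :
    covD s (p + 1) (∑ Q, u Q * basisY Q) - ∑ Q, fuchs p (fibreSystem κ Ω) u Q * basisY Q ∈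
      exactForms s (p + 1) := by
  have her : (Finset.Icc 2 (p + 1)).erase (p + 1) = Finset.Icc 2 p := by
    ext x; simp only [Finset.mem_erase, Finset.mem_Icc]; omega
  have h : ∀ Q, u Q * (covD s (p + 1) (basisY Q) - κ • ∑ j ∈ Finset.Icc 2 p,
      R (p + 1) j * act (Ω (p + 1) j) basisY Q) ∈ exactForms s (p + 1) := fun Q => by
    have := hΩ (p + 1) (Finset.mem_Icc.2 (by omega)) Q
    rw [her] at this
    exact sub_mul_mem_exactForms (by omega) (hu Q) this
  convert sum_mem fun Q (_ : Q ∈ Finset.univ) => h Q using 1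
  simp only [map_sum, covD_mul, mul_sub, Finset.sum_sub_distrib, Finset.sum_add_distrib, fuchs,
    add_mul, fibreSystem]
  rw [add_sub_add_left_eq_sub]
  congr 1
  simp only [Finset.sum_mul, Finset.smul_sum, Finset.mul_sum]
  rw [Finset.sum_comm, Finset.sum_comm (s := Finset.univ) (t := Finset.Icc 2 p)]
  refine Finset.sum_congr rfl fun j _ => ?_
  have e := congrArg (fun x => κ • (R (p + 1) j * x)) (sum_mul_act (Ω (p + 1) j) u basisY)
  simp only [Finset.mul_sum, Finset.smul_sum] at e
  rw [Finset.sum_congr rfl fun Q _ => ?_, ← e]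
  · exact Finset.sum_congr rfl fun Q _ => by simp only [Algebra.smul_def]; ring
  · rw [act_smul]; simp only [Algebra.smul_def]; ring

theorem fuchs_mem_sub {W : Type*} [Fintype W] (hp3 : 3 ≤ p) (hp : p < n) (A : ℕ → Matrix W W ℂ)
    {u : W → RegRing n c₁ c₂ c₃} (hu : ∀ Q, u Q ∈ sub (p + 1)) (Q : W) :
    fuchs p A u Q ∈ sub (p + 1) :=
  add_mem (pd_mem_sub hp (Finset.mem_Icc.2 (by omega)) (hu Q)) (sum_mem fun j hj =>
    mul_mem (R_mem_sub (Finset.mem_Icc.2 (by omega))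
      (Finset.Icc_subset_Icc_right (Nat.le_succ p) hj))
      (act_mem (S := Subalgebra.toSubmodule (sub (p + 1))) _ hu Q))

theorem sum_mul_basisY (hp : p < n) (c : ℕ → Word n (p + 1) → RegRing n c₁ c₂ c₃) :
    ∑ a : Word n p, c (a.head hp) a.tail * basisY a =
      ∑ Q, (∑ q ∈ Finset.Ico 3 (p + 1), R (p + 1) q * c q Q) * basisY Q := by
  simp only [basisY_cons hp]
  rw [sum_word hp fun q Q => c q Q * (R (p + 1) q * basisY Q), Finset.sum_comm]
  refine Finset.sum_congr rfl fun Q _ => ?_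
  rw [Finset.sum_mul]
  exact Finset.sum_congr rfl fun q _ => by ring

/-- A class on the fibre `F_{n,p}` is reduced first on the smaller fibre `F_{n,p+1}`, and then in
the variable `y_{p+1}` by `exists_reduction`. -/
theorem BasisSpans.step (hp3 : 3 ≤ p) (hp : p < n) {Ω : MatrixFamily n (p + 1)}
    (hΩ : SolvesGMY c₁ c₂ c₃ s κ (p + 1) Ω) (hA : IsNonResonantSystem p (fibreSystem κ Ω))
    (h : BasisSpans c₁ c₂ c₃ s n (p + 1)) : BasisSpans c₁ c₂ c₃ s n p := by
  intro f
  obtain ⟨g, hg, hf⟩ := h f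
  obtain ⟨u, c, hu, hc, rfl⟩ := exists_reduction hp3 hp hA hg
  refine ⟨fun a => c (a.head hp) a.tail, fun a => hc _ _, ?_⟩
  have h1 := exactForms_mono hf
  have h2 := exactForms_mono (covD_sum_sub_mem hp3 hΩ hu)
  have h3 := covD_mem_exactForms (s := s) (p := p)
    (Finset.mem_Ioc.2 ⟨Nat.lt_succ_self p, hp⟩) (∑ Q, u Q * basisY Q)
  have h4 := add_mem (sub_mem h1 h2) h3
  convert h4 using 1
  rw [sum_mul_basisY]
  simp only [add_mul, Finset.sum_add_distrib]
  ring

/-- If a combination of the basis on `F_{n,p}` is exact, then its coefficients are a covariant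
derivative of the Fuchsian system in `y_{p+1}`, and `eq_zero_of_fuchs_eq` applies. -/
theorem BasisIndependent.step (hs : ∀ i j, s i j = s j i) (hp3 : 3 ≤ p) (hp : p < n)
    {Ω : MatrixFamily n (p + 1)} (hΩ : SolvesGMY c₁ c₂ c₃ s κ (p + 1) Ω)
    (hA : IsNonResonantSystem p (fibreSystem κ Ω)) (hS : BasisSpans c₁ c₂ c₃ s n (p + 1))
    (h : BasisIndependent c₁ c₂ c₃ s n (p + 1)) : BasisIndependent c₁ c₂ c₃ s n p := by
  intro x hx he
  obtain ⟨g, hg⟩ := he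
  have hN : p + 1 ∈ Finset.Icc 4 n := Finset.mem_Icc.2 (by omega)
  have hIoc : Finset.Ioc p n = insert (p + 1) (Finset.Ioc (p + 1) n) := by
    ext l; simp only [Finset.mem_insert, Finset.mem_Ioc]; omega
  have hsplit : ∑ l ∈ Finset.Ioc p n, covD s l (g l) =
      covD s (p + 1) (g (p + 1)) + ∑ l ∈ Finset.Ioc (p + 1) n, covD s l (g l) := by
    rw [hIoc, Finset.sum_insert (by simp)]
  rw [hsplit] at hg
  have hg' : ∑ l ∈ Finset.Ioc (p + 1) n, covD s l (g l) ∈ exactForms s (p + 1) := ⟨g, rfl⟩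
  obtain ⟨u, hu, hgu⟩ := hS (g (p + 1))
  set c : ℕ → Word n (p + 1) → RegRing n c₁ c₂ c₃ := fun q Q =>
    if hq : q ∈ Finset.Ico 3 (p + 1) then x (Word.cons hp hq Q) else 0 with hc
  have hxc : ∀ a : Word n p, x a = c (a.head hp) a.tail := fun a => by
    rw [hc]
    simp only [dif_pos (a.head_mem hp), Word.cons_head_tail]
  have hcm : ∀ q Q, c q Q ∈ sub p := fun q Q => by
    simp only [hc]
    split_ifs
    · exact hx _
    · exact zero_mem _
  simp only [hxc] at hg
  rw [sum_mul_basisY] at hg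
  -- the primitive in the direction of `y_{p+1}` may be reduced to the smaller basis
  have h1 := covD_mem_of_mem hs (show 3 ≤ p + 1 by omega) hN hgu
  have h2 := covD_sum_sub_mem hp3 hΩ hu
  have h3 := h (fun Q => (∑ q ∈ Finset.Ico 3 (p + 1), R (p + 1) q * c q Q) -
    fuchs p (fibreSystem κ Ω) u Q) (fun Q => sub_mem (sum_mem fun q hq => mul_mem
      (R_mem_sub (Finset.mem_Icc.2 (by omega))
        (Finset.mem_Icc.2 (by have := Finset.mem_Ico.1 hq; omega)))
      (sub_mono (Nat.le_succ p) (hcm q Q))) (fuchs_mem_sub hp3 hp _ hu Q)) (by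
    convert add_mem (add_mem h1 h2) hg' using 1
    simp only [sub_mul, Finset.sum_sub_distrib]
    rw [hg, map_sub]
    ring)
  have h4 := eq_zero_of_fuchs_eq hp3 hp hA hu hcm fun Q => (sub_eq_zero.1 (congrFun h3 Q)).symm
  funext a
  rw [hxc]
  exact h4 _ (a.head_mem hp) _

/-- If the fibration basis is independent, then the solutions of the Gauss-Manin equation are
unique: the difference of two solutions is a matrix of one-forms that annihilates the basis, and the
functions `1 / (y_i - y_j)` with fixed `i` are linearly independent. The point `z` serves to exclude
that the configuration space is empty, in which case all functions would be zero. -/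
theorem SolvesGMY.unique (hκ : κ ≠ 0) (hp : p ≤ n) (h : BasisIndependent c₁ c₂ c₃ s n p)
    (z : config n c₁ c₂ c₃) {Ω Ω' : MatrixFamily n p} (hΩ : SolvesGMY c₁ c₂ c₃ s κ p Ω)
    (hΩ' : SolvesGMY c₁ c₂ c₃ s κ p Ω') {i j : ℕ} (hi : i ∈ Finset.Icc 4 p)
    (hj : j ∈ (Finset.Icc 2 p).erase i) : Ω i j = Ω' i j := by
  ext a b
  have h1 := sub_mem (hΩ' i hi a) (hΩ i hi a)
  have h2 := h (fun b => ∑ j ∈ (Finset.Icc 2 p).erase i, (κ * (Ω i j a b - Ω' i j a b)) • R i j)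
    (fun b => sum_mem fun j hj => (sub p).smul_mem (R_mem_sub
      (by simp only [Finset.mem_Icc] at hi ⊢; omega) (Finset.mem_of_mem_erase hj)) _) (by
    convert h1 using 1
    rw [sub_sub_sub_cancel_left, ← smul_sub, ← Finset.sum_sub_distrib, Finset.smul_sum]
    simp only [Finset.sum_mul]
    rw [Finset.sum_comm]
    refine Finset.sum_congr rfl fun j _ => ?_
    rw [← mul_sub, ← Finset.sum_sub_distrib, Finset.mul_sum, Finset.smul_sum]
    refine Finset.sum_congr rfl fun b _ => ?_
    simp only [Algebra.smul_def, map_mul, map_sub]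
    ring)
  have hS : (Finset.Icc 2 p).erase i ⊆ (Finset.Icc 2 n).erase i :=
    Finset.erase_subset_erase _ (Finset.Icc_subset_Icc_right hp)
  have h3 := eq_zero_of_sum_R_eq_zero (Finset.Icc_subset_Icc_right hp hi) hS z
    (congrFun h2 b) j hj
  exact sub_eq_zero.1 ((mul_eq_zero.1 h3).resolve_left hκ)

/-- The matrix `Ω^{i1}` is determined by the other ones and the row sum. -/
theorem IsAnsatz.eq_of_eq (hp3 : 3 ≤ p) {Ω Ω' : MatrixFamily n p} (hΩ : IsAnsatz n p Ω)
    (hΩ' : IsAnsatz n p Ω') {i : ℕ} (hi : i ∈ Finset.Icc 4 p)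
    (h : ∀ j ∈ (Finset.Icc 2 p).erase i, Ω i j = Ω' i j) {j : ℕ} (hj : j ∈ Finset.Icc 1 p) :
    Ω i j = Ω' i j := by
  have hi1 : i ∈ Finset.Icc 1 p := by simp only [Finset.mem_Icc] at hi ⊢; omega
  have h2 : ∀ j ∈ Finset.Icc 2 p, Ω i j = Ω' i j := by
    intro j hj
    by_cases hij : j = i
    · rw [hij, hΩ.diag i hi1, hΩ'.diag i hi1]
    · exact h j (Finset.mem_erase.2 ⟨hij, hj⟩)
  by_cases hj1 : j = 1
  · subst hj1
    have h1 : Finset.Icc 1 p = insert 1 (Finset.Icc 2 p) := by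
      ext x; simp only [Finset.mem_Icc, Finset.mem_insert]; omega
    have e := (hΩ.sum_eq_zero i hi1).trans (hΩ'.sum_eq_zero i hi1).symm
    rw [h1, Finset.sum_insert (by simp), Finset.sum_insert (by simp),
      Finset.sum_congr rfl h2] at e
    exact add_right_cancel e
  · exact h2 j (by simp only [Finset.mem_Icc] at hj ⊢; omega)

end Cohomology

/-! ### Points of the moduli space and non-resonant systems -/

section NonResonance

variable {n p : ℕ} {c₁ c₂ c₃ : ℂ}

/-- The remaining punctures are placed on the real axis, at distinct points of modulus larger than
`|c₁|`, `|c₂|`, `|c₃|`. -/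
theorem nonempty_config (n : ℕ) (h₁₂ : c₁ ≠ c₂) (h₁₃ : c₁ ≠ c₃) (h₂₃ : c₂ ≠ c₃) :
    Nonempty (config n c₁ c₂ c₃) := by
  set M : ℝ := ‖c₁‖ + ‖c₂‖ + ‖c₃‖ with hM
  have h1 := norm_nonneg c₁
  have h2 := norm_nonneg c₂
  have h3 := norm_nonneg c₃
  set z : ℕ → ℂ := fun l => if l = 1 then c₁ else if l = 2 then c₂ else if l = 3 then c₃ else
    ((M + l : ℝ) : ℂ) with hz
  have hn : ∀ l, 4 ≤ l → z l = ((M + l : ℝ) : ℂ) := fun l hl => by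
    simp only [hz]
    rw [if_neg (by omega), if_neg (by omega), if_neg (by omega)]
  have hfar : ∀ l, 4 ≤ l → ‖z l‖ = M + l := fun l hl => by
    rw [hn l hl, Complex.norm_real, Real.norm_of_nonneg (by positivity)]
  have hlt : ∀ i l, 1 ≤ i → i ≤ 3 → 4 ≤ l → z i ≠ z l := by
    intro i l hi hi3 hl h
    have e := congrArg norm h
    have hl' : (4 : ℝ) ≤ l := by exact_mod_cast hl
    rw [hfar l hl] at e
    interval_cases i <;> simp [hz] at e <;> linarith
  refine ⟨⟨z, by simp [hz], by simp [hz], by simp [hz], fun i hi j hj hij => ?_⟩⟩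
  by_cases hi4 : 4 ≤ i <;> by_cases hj4 : 4 ≤ j
  · rw [hn i hi4, hn j hj4, Complex.ofReal_inj, add_right_inj] at hij
    exact_mod_cast hij
  · exact absurd hij.symm (hlt j i hj.1 (by omega) hi4)
  · exact absurd hij (hlt i j hi.1 (by omega) hj4)
  · have a := hi.1
    have b := hj.1
    have : i ≤ 3 := by omega
    have : j ≤ 3 := by omega
    interval_cases i <;> interval_cases j <;> simp [hz] at hij ⊢ <;>
      first | exact h₁₂ hij | exact h₁₃ hij | exact h₂₃ hij | exact h₁₂ hij.symm |
        exact h₁₃ hij.symm | exact h₂₃ hij.symm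

/-- A number that is not an eigenvalue, expressed in terms of `act`. -/
theorem isUnit_sub_smul_one {W : Type*} [Fintype W] [DecidableEq W] {A : Matrix W W ℂ} {μ : ℂ}
    (h : ∀ x : W → ℂ, act A x = μ • x → x = 0) : IsUnit (A - μ • (1 : Matrix W W ℂ)) := by
  rw [← Matrix.mulVec_injective_iff_isUnit, ← Matrix.coe_mulVecLin, ← LinearMap.ker_eq_bot,
    LinearMap.ker_eq_bot']
  intro x hx
  refine h x ?_
  rw [Matrix.mulVecLin_apply, Matrix.sub_mulVec, Matrix.smul_mulVec, Matrix.one_mulVec,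
    sub_eq_zero] at hx
  exact hx

/-- Non-resonance for the divisors `I = {p+1, j}` is non-resonance of the Fuchsian system in
`y_{p+1}`. The case `j = 1` gives the condition at infinity, where `z_1` has been moved. -/
theorem HasNonResonantResidues.isNonResonantSystem {Λ : ℝ} (hΛ : 0 < Λ) (hp3 : 3 ≤ p)
    {Ω : MatrixFamily n (p + 1)} (hΩ : IsAnsatz n (p + 1) Ω)
    (h : HasNonResonantResidues n (p + 1) Λ Ω) :
    IsNonResonantSystem p (fibreSystem (1 / (Λ : ℂ) ^ 2) Ω) := by
  have hΛ1 : (Λ : ℂ) ≠ 0 := Complex.ofReal_ne_zero.2 hΛ.ne'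
  have hΛ0 : ((Λ : ℂ) ^ 2) ≠ 0 := pow_ne_zero _ hΛ1
  have key : ∀ j ∈ Finset.Icc 1 p, ∀ k : ℕ,
      IsUnit (fibreSystem (1 / (Λ : ℂ) ^ 2) Ω j - (k : ℂ) • (1 : Matrix _ _ ℂ)) := by
    intro j hj k
    have hj' := Finset.mem_Icc.1 hj
    have hsum : sumPairs Ω {p + 1, j} = Ω (p + 1) j := by
      rw [sumPairs_insert Ω (fun i hi => by rw [Finset.mem_singleton] at hi; omega),
        Finset.sum_singleton, sumPairs, Finset.sum_singleton, Finset.filter_singleton,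
        if_neg (lt_irrefl j), Finset.sum_empty, zero_add]
    have h1 := h {p + 1, j} (fun i hi => by
        simp only [Finset.mem_insert, Finset.mem_singleton] at hi
        exact Finset.mem_Icc.2 (by omega))
      (by rw [Finset.card_pair (by omega)])
      (by
        refine (Finset.card_le_card (t := {j}) fun i hi => ?_).trans (by simp)
        simp only [Finset.mem_inter, Finset.mem_insert, Finset.mem_singleton] at hi ⊢
        omega) k
    rw [hsum] at h1
    have h2 := (isUnit_sub_smul_one h1)
    have e : fibreSystem (1 / (Λ : ℂ) ^ 2) Ω j - (k : ℂ) • (1 : Matrix _ _ ℂ) =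
        (1 / (Λ : ℂ) ^ 2) •
          (Ω (p + 1) j - (((k : ℤ) : ℂ) * (Λ : ℂ) ^ 2) • (1 : Matrix _ _ ℂ)).transpose := by
      rw [fibreSystem, Matrix.transpose_sub, Matrix.transpose_smul, Matrix.transpose_one, smul_sub,
        smul_smul]
      congr 2
      push_cast
      field_simp
    rw [e]
    exact ((Matrix.isUnit_transpose _).2 h2).smul (Units.mk0 _ (one_div_ne_zero hΛ0))
  refine ⟨fun j hj k _ => key j (mem_Icc_one hj) k, ?_, fun k _ => ?_⟩
  · simpa using key 2 (Finset.mem_Icc.2 (by omega)) 0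
  · have hN : p + 1 ∈ Finset.Icc 1 (p + 1) := Finset.mem_Icc.2 (by omega)
    have h1 : Finset.Icc 1 p = insert 1 (Finset.Icc 2 p) := by
      ext x; simp only [Finset.mem_Icc, Finset.mem_insert]; omega
    have e := hΩ.sum_eq_zero (p + 1) hN
    rw [Finset.sum_Icc_succ_top (by omega), hΩ.diag _ hN, add_zero, h1,
      Finset.sum_insert (by simp)] at e
    have e2 : ∑ j ∈ Finset.Icc 2 p, fibreSystem (1 / (Λ : ℂ) ^ 2) Ω j + (k : ℂ) • 1 =
        -(fibreSystem (1 / (Λ : ℂ) ^ 2) Ω 1 - (k : ℂ) • 1) := by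
      simp only [fibreSystem]
      rw [← Finset.smul_sum, ← Matrix.transpose_sum, eq_neg_of_add_eq_zero_right e,
        Matrix.transpose_neg, smul_neg]
      abel
    rw [e2]
    exact (key 1 (Finset.mem_Icc.2 (by omega)) k).neg

end NonResonance

/-! ### The kinematic braid matrices, existence and uniqueness -/

section Kinematics

variable {D n p : ℕ} {c₁ c₂ c₃ : ℂ} {Λ : ℝ} {k : ℕ → Fin (D + 1) → ℂ}

theorem mdot_comm (u v : Fin (D + 1) → ℂ) : mdot u v = mdot v u := by
  simp only [mdot, mul_comm]

theorem mdot_add_left (u v w : Fin (D + 1) → ℂ) : mdot (u + v) w = mdot u w + mdot v w := by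
  simp only [mdot, Pi.add_apply, add_mul, Finset.sum_add_distrib]
  ring

theorem mdot_add_right (u v w : Fin (D + 1) → ℂ) : mdot w (u + v) = mdot w u + mdot w v := by
  rw [mdot_comm, mdot_add_left, mdot_comm u, mdot_comm v]

theorem mdot_sum_right {ι : Type*} (I : Finset ι) (f : ι → Fin (D + 1) → ℂ) (u : Fin (D + 1) → ℂ) :
    mdot u (∑ i ∈ I, f i) = ∑ i ∈ I, mdot u (f i) := by
  classical
  induction I using Finset.induction_on with
  | empty => simp [mdot]
  | insert i I hi ih => rw [Finset.sum_insert hi, Finset.sum_insert hi, mdot_add_right, ih]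

theorem sInv_eq (massless : ∀ i ∈ Finset.Icc 1 n, mdot (k i) (k i) = 0) {i j : ℕ}
    (hi : i ∈ Finset.Icc 1 n) (hj : j ∈ Finset.Icc 1 n) : sInv k i j = 2 * mdot (k i) (k j) := by
  rw [sInv, mdot_add_left, mdot_add_right, mdot_add_right, massless i hi, massless j hj,
    mdot_comm (k j)]
  ring

theorem twistExp_comm (i j : ℕ) : twistExp Λ k i j = twistExp Λ k j i := by
  rw [twistExp, twistExp, mdot_comm]

/-- For massless momenta the residue along the divisor of `I` is `s_I = (∑_{i ∈ I} p_i)²`. -/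
theorem sum_pairs_eq_invariantOf (massless : ∀ i ∈ Finset.Icc 1 n, mdot (k i) (k i) = 0)
    (I : Finset ℕ) (hI : I ⊆ Finset.Icc 1 n) :
    ∑ i ∈ I, ∑ j ∈ I with j < i, 2 * mdot (k i) (k j) = invariantOf k I := by
  induction I using Finset.induction_on_max with
  | empty => simp [invariantOf, mdot]
  | insert N I hN ih =>
    have hNI : N ∉ I := fun h => lt_irrefl _ (hN N h)
    have h := sumPairs_insert (fun i j => 2 * mdot (k i) (k j)) hN
    rw [sumPairs, sumPairs, ih ((Finset.subset_insert _ _).trans hI)] at h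
    rw [h, invariantOf, invariantOf, Finset.sum_insert hNI, mdot_add_left, mdot_add_right,
      mdot_add_right, massless N (hI (Finset.mem_insert_self _ _)),
      mdot_comm (∑ i ∈ I, k i) (k N), mdot_sum_right I k (k N), ← Finset.mul_sum]
    ring

/-- The braid matrices for `p = n`, where the fibre is a point. -/
def kinematicFamily (n : ℕ) (k : ℕ → Fin (D + 1) → ℂ) : MatrixFamily n n := fun i j =>
  (2 * mdot (k i) (k j)) • 1

theorem kinematicFamily_isAnsatz (momentum_conservation : ∑ i ∈ Finset.Icc 1 n, k i = 0)
    (massless : ∀ i ∈ Finset.Icc 1 n, mdot (k i) (k i) = 0) :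
    IsAnsatz n n (kinematicFamily n k) where
  symm i _ j _ := by rw [kinematicFamily, kinematicFamily, mdot_comm]
  diag i hi := by rw [kinematicFamily, massless i hi, mul_zero, zero_smul]
  sum_eq_zero i hi := by
    simp only [kinematicFamily]
    rw [← Finset.sum_smul, ← Finset.mul_sum, ← mdot_sum_right, momentum_conservation]
    simp [mdot]

theorem kinematicFamily_solvesGMY (Λ : ℝ) (k : ℕ → Fin (D + 1) → ℂ) :
    SolvesGMY c₁ c₂ c₃ (twistExp Λ k) (1 / (Λ : ℂ) ^ 2) n (kinematicFamily n k) := by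
  intro i hi a
  have hi2 : i ∈ Finset.Icc 2 n := by simp only [Finset.mem_Icc] at hi ⊢; omega
  convert zero_mem (exactForms (twistExp Λ k) n) using 1
  rw [covD_apply, basisY_self, Derivation.map_one_eq_zero, zero_add, mul_one,
    ← Finset.add_sum_erase _ _ hi2, R_self, smul_zero, zero_add, Finset.smul_sum, sub_eq_zero]
  refine Finset.sum_congr rfl fun j _ => ?_
  rw [sum_word_self _ a, basisY_self, kinematicFamily, Matrix.smul_apply, Matrix.one_apply_eq,
    smul_eq_mul, mul_one, twistExp, mul_smul, mul_smul_comm, mul_one]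

/-- The residues are `s_I` times the identity, and `|I| ≤ n - 2` since `I` misses at least two of
the punctures `1, 2, 3`. -/
theorem kinematicFamily_hasNonResonantResidues (hn : 3 ≤ n)
    (massless : ∀ i ∈ Finset.Icc 1 n, mdot (k i) (k i) = 0) (h : NonResonant n Λ k) :
    HasNonResonantResidues n n Λ (kinematicFamily n k) := by
  intro I hI hcard hI3 m x hx
  have hsum : sumPairs (kinematicFamily n k) I = invariantOf k I • (1 : Matrix _ _ ℂ) := by
    rw [← sum_pairs_eq_invariantOf massless I hI, Finset.sum_smul]
    exact Finset.sum_congr rfl fun i _ => by rw [Finset.sum_smul]; rfl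
  have hI2 : I.card + 2 ≤ n := by
    have h1 : (I \ {1, 2, 3}).card ≤ (Finset.Icc 4 n).card := Finset.card_le_card fun i hi => by
      simp only [Finset.mem_sdiff, Finset.mem_insert, Finset.mem_singleton] at hi
      have := Finset.mem_Icc.1 (hI hi.1)
      exact Finset.mem_Icc.2 (by omega)
    have h2 := Finset.card_inter_add_card_sdiff I {1, 2, 3}
    rw [Nat.card_Icc] at h1
    omega
  rw [hsum, act_smul_one, ← sub_eq_zero, ← sub_smul] at hx
  exact (smul_eq_zero.1 hx).resolve_left (sub_ne_zero.2 (h I hI hcard hI2 m))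

/-- Braid matrices exist for all `p`: the recursion produces them from the kinematic ones. For
generic kinematics these have non-resonant residues, which is needed to compare with other
solutions. -/
theorem exists_solution (hn : 3 ≤ n) (momentum_conservation : ∑ i ∈ Finset.Icc 1 n, k i = 0)
    (massless : ∀ i ∈ Finset.Icc 1 n, mdot (k i) (k i) = 0) (c₁ c₂ c₃ : ℂ) (Λ : ℝ) (d : ℕ) :
    ∀ p, 3 ≤ p → p + d = n → ∃ Ω : MatrixFamily n p, IsAnsatz n p Ω ∧
      SolvesGMY c₁ c₂ c₃ (twistExp Λ k) (1 / (Λ : ℂ) ^ 2) p Ω ∧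
      (NonResonant n Λ k → HasNonResonantResidues n p Λ Ω) := by
  induction d with
  | zero =>
    rintro p _ rfl
    exact ⟨kinematicFamily _ k, kinematicFamily_isAnsatz momentum_conservation massless,
      kinematicFamily_solvesGMY Λ k, kinematicFamily_hasNonResonantResidues hn massless⟩
  | succ d ih =>
    intro p hp3 hpd
    have hp : p < n := by omega
    obtain ⟨Ω, h1, h2, h3⟩ := ih (p + 1) (by omega) (by omega)
    have hr := recFamily_satisfiesRecursion hp Ω
    exact ⟨recFamily hp Ω, recFamily_isAnsatz hp3 hp h1, h2.recursion hp3 hp h1 hr,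
      fun h => (h3 h).recursion hp3 hp h1 hr⟩

/-- For generic kinematics the fibration basis is a basis of the twisted cohomology of every fibre;
the induction on `d = n - p` starts at the fibre that is a point. -/
theorem basis_spans_and_independent (hn : 3 ≤ n) (hΛ : 0 < Λ)
    (momentum_conservation : ∑ i ∈ Finset.Icc 1 n, k i = 0)
    (massless : ∀ i ∈ Finset.Icc 1 n, mdot (k i) (k i) = 0) (c₁ c₂ c₃ : ℂ)
    (h : NonResonant n Λ k) (d : ℕ) :
    ∀ p, 3 ≤ p → p + d = n → BasisSpans c₁ c₂ c₃ (twistExp Λ k) n p ∧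
      BasisIndependent c₁ c₂ c₃ (twistExp Λ k) n p := by
  induction d with
  | zero =>
    rintro p _ rfl
    exact ⟨basisSpans_self _ _ _ _ _, basisIndependent_self _ _ _ _ _⟩
  | succ d ih =>
    intro p hp3 hpd
    have hp : p < n := by omega
    obtain ⟨hS, hI⟩ := ih (p + 1) (by omega) (by omega)
    obtain ⟨Ω, h1, h2, h3⟩ := exists_solution hn momentum_conservation massless c₁ c₂ c₃ Λ d (p + 1)
      (by omega) (by omega)
    have hA := (h3 h).isNonResonantSystem hΛ hp3 h1
    exact ⟨hS.step hp3 hp h2 hA, hI.step twistExp_comm hp3 hp h2 hA hS⟩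

/-- Families that satisfy the linear constraints are equal if they agree for `i ≥ 4`: the three
matrices with `i, j ≤ 3` are determined by the row sums. -/
theorem IsAnsatz.ext (hp3 : 3 ≤ p) {Ω Ω' : MatrixFamily n p} (hΩ : IsAnsatz n p Ω)
    (hΩ' : IsAnsatz n p Ω')
    (h : ∀ i ∈ Finset.Icc 4 p, ∀ j ∈ Finset.Icc 1 p, Ω i j = Ω' i j) {i j : ℕ}
    (hi : i ∈ Finset.Icc 1 p) (hj : j ∈ Finset.Icc 1 p) : Ω i j = Ω' i j := by
  have hle : ∀ {a}, a ∈ ({1, 2, 3} : Finset ℕ) → a ∈ Finset.Icc 1 p := fun ha => by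
    simp only [Finset.mem_insert, Finset.mem_singleton] at ha
    exact Finset.mem_Icc.2 (by omega)
  have hsplit : Finset.Icc 1 p = {1, 2, 3} ∪ Finset.Icc 4 p := by
    ext x
    simp only [Finset.mem_union, Finset.mem_insert, Finset.mem_singleton, Finset.mem_Icc]
    omega
  have hdisj : Disjoint ({1, 2, 3} : Finset ℕ) (Finset.Icc 4 p) := by
    rw [Finset.disjoint_left]
    intro x hx hx'
    simp only [Finset.mem_insert, Finset.mem_singleton, Finset.mem_Icc] at hx hx'
    omega
  have hrow : ∀ a ∈ ({1, 2, 3} : Finset ℕ),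
      Ω a 1 + (Ω a 2 + Ω a 3) = Ω' a 1 + (Ω' a 2 + Ω' a 3) := by
    intro a ha
    have e := (hΩ.sum_eq_zero a (hle ha)).trans (hΩ'.sum_eq_zero a (hle ha)).symm
    have h4 : ∑ j ∈ Finset.Icc 4 p, Ω a j = ∑ j ∈ Finset.Icc 4 p, Ω' a j :=
      Finset.sum_congr rfl fun j hj => by
        have hj1 : j ∈ Finset.Icc 1 p := by simp only [Finset.mem_Icc] at hj ⊢; omega
        rw [hΩ.symm a (hle ha) j hj1, hΩ'.symm a (hle ha) j hj1, h j hj a (hle ha)]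
    rw [hsplit, Finset.sum_union hdisj, Finset.sum_union hdisj, h4] at e
    have e' := add_right_cancel e
    simpa using e'
  have m1 : 1 ∈ ({1, 2, 3} : Finset ℕ) := by simp
  have m2 : 2 ∈ ({1, 2, 3} : Finset ℕ) := by simp
  have m3 : 3 ∈ ({1, 2, 3} : Finset ℕ) := by simp
  have r1 := hrow 1 m1
  have r2 := hrow 2 m2
  have r3 := hrow 3 m3
  rw [hΩ.diag 1 (hle m1), hΩ'.diag 1 (hle m1), zero_add, zero_add] at r1
  rw [hΩ.diag 2 (hle m2), hΩ'.diag 2 (hle m2), zero_add, zero_add, hΩ.symm 2 (hle m2) 1 (hle m1),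
    hΩ'.symm 2 (hle m2) 1 (hle m1)] at r2
  rw [hΩ.diag 3 (hle m3), hΩ'.diag 3 (hle m3), add_zero, add_zero, hΩ.symm 3 (hle m3) 1 (hle m1),
    hΩ'.symm 3 (hle m3) 1 (hle m1), hΩ.symm 3 (hle m3) 2 (hle m2),
    hΩ'.symm 3 (hle m3) 2 (hle m2)] at r3
  have key : ∀ a b, Ω 1 2 a b = Ω' 1 2 a b ∧ Ω 1 3 a b = Ω' 1 3 a b ∧ Ω 2 3 a b = Ω' 2 3 a b := by
    intro a b
    have t1 := congrFun (congrFun r1 a) b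
    have t2 := congrFun (congrFun r2 a) b
    have t3 := congrFun (congrFun r3 a) b
    simp only [Matrix.add_apply] at t1 t2 t3
    refine ⟨?_, ?_, ?_⟩
    · linear_combination (1 / 2 : ℂ) * t1 + (1 / 2 : ℂ) * t2 - (1 / 2 : ℂ) * t3
    · linear_combination (1 / 2 : ℂ) * t1 + (1 / 2 : ℂ) * t3 - (1 / 2 : ℂ) * t2
    · linear_combination (1 / 2 : ℂ) * t2 + (1 / 2 : ℂ) * t3 - (1 / 2 : ℂ) * t1
  have hlt : ∀ i j, i < j → i ∈ Finset.Icc 1 p → j ∈ Finset.Icc 1 p → Ω i j = Ω' i j := by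
    intro i j hij hi hj
    by_cases hj4 : 4 ≤ j
    · rw [hΩ.symm i hi j hj, hΩ'.symm i hi j hj]
      exact h j (by simp only [Finset.mem_Icc] at hj ⊢; omega) i hi
    · have hi' := Finset.mem_Icc.1 hi
      have : (i = 1 ∧ j = 2) ∨ (i = 1 ∧ j = 3) ∨ (i = 2 ∧ j = 3) := by omega
      ext a b
      rcases this with ⟨rfl, rfl⟩ | ⟨rfl, rfl⟩ | ⟨rfl, rfl⟩
      exacts [(key a b).1, (key a b).2.1, (key a b).2.2]
  rcases lt_trichotomy i j with hij | rfl | hij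
  · exact hlt i j hij hi hj
  · rw [hΩ.diag i hi, hΩ'.diag i hi]
  · rw [hΩ.symm i hi j hj, hΩ'.symm i hi j hj]
    exact hlt j i hij hj hi

theorem IsAnsatz.congr {Ω Ω' : MatrixFamily n p} (hΩ : IsAnsatz n p Ω)
    (h : ∀ i ∈ Finset.Icc 1 p, ∀ j ∈ Finset.Icc 1 p, Ω' i j = Ω i j) : IsAnsatz n p Ω' where
  symm i hi j hj := by rw [h i hi j hj, h j hj i hi, hΩ.symm i hi j hj]
  diag i hi := by rw [h i hi i hi, hΩ.diag i hi]
  sum_eq_zero i hi := by rw [Finset.sum_congr rfl (h i hi), hΩ.sum_eq_zero i hi]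

theorem SolvesGMY.congr {s : ℕ → ℕ → ℂ} {κ : ℂ} {Ω Ω' : MatrixFamily n p}
    (hΩ : SolvesGMY c₁ c₂ c₃ s κ p Ω)
    (h : ∀ i ∈ Finset.Icc 1 p, ∀ j ∈ Finset.Icc 1 p, Ω' i j = Ω i j) :
    SolvesGMY c₁ c₂ c₃ s κ p Ω' := by
  intro i hi a
  have hi1 : i ∈ Finset.Icc 1 p := by simp only [Finset.mem_Icc] at hi ⊢; omega
  rw [Finset.sum_congr rfl fun j hj => by
    rw [h i hi1 j (mem_Icc_one (Finset.mem_of_mem_erase hj))]]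
  exact hΩ i hi a

/-- Braid matrices in the coordinates `y`. -/
theorem isBraidFamily_iff (momentum_conservation : ∑ i ∈ Finset.Icc 1 n, k i = 0)
    (massless : ∀ i ∈ Finset.Icc 1 n, mdot (k i) (k i) = 0) (hp3 : 3 ≤ p) (hp : p ≤ n)
    {Ω : MatrixFamily n p} : IsBraidFamily n Λ k c₁ c₂ c₃ p Ω ↔
      IsAnsatz n p Ω ∧ SolvesGMY c₁ c₂ c₃ (twistExp Λ k) (1 / (Λ : ℂ) ^ 2) p Ω := by
  have hk := twistBalanced_of momentum_conservation massless
  exact ⟨fun h => ⟨h.ansatz, (solvesGaussManin_iff hk hp3 hp h.ansatz).1 h.gaussManin⟩,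
    fun h => ⟨h.1, (solvesGaussManin_iff hk hp3 hp h.1).2 h.2⟩⟩

/-- If the fibration basis is independent, then any two solutions agree for `i ≥ 4`. -/
theorem eq_of_solvesGMY {s : ℕ → ℕ → ℂ} {κ : ℂ} (hκ : κ ≠ 0) (hp3 : 3 ≤ p) (hp : p ≤ n)
    (h : BasisIndependent c₁ c₂ c₃ s n p) (z : config n c₁ c₂ c₃) {Ω Ω' : MatrixFamily n p}
    (hΩ : IsAnsatz n p Ω) (hΩ' : IsAnsatz n p Ω') (hG : SolvesGMY c₁ c₂ c₃ s κ p Ω)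
    (hG' : SolvesGMY c₁ c₂ c₃ s κ p Ω') {i j : ℕ} (hi : i ∈ Finset.Icc 4 p)
    (hj : j ∈ Finset.Icc 1 p) : Ω i j = Ω' i j :=
  hΩ.eq_of_eq hp3 hΩ' hi (fun _ hj => hG.unique hκ hp h z hG' hi hj) hj

end Kinematics

end BraidMatrices

end

theorem lemma3p3 {D : ℕ} (n : ℕ) (hn : 3 ≤ n) (Λ : ℝ) (hΛ : 0 < Λ)
    (k : ℕ → Fin (D + 1) → ℂ)
    (momentum_conservation : ∑ i ∈ Finset.Icc 1 n, k i = 0)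
    (massless : ∀ i ∈ Finset.Icc 1 n, BraidMatrices.mdot (k i) (k i) = 0)
    (c₁ c₂ c₃ : ℂ) (h₁₂ : c₁ ≠ c₂) (h₁₃ : c₁ ≠ c₃) (h₂₃ : c₂ ≠ c₃) :
    -- braid matrices exist for all `p`
    (∀ p : ℕ, 3 ≤ p → p ≤ n → ∃ Ω : BraidMatrices.MatrixFamily n p,
      BraidMatrices.IsBraidFamily n Λ k c₁ c₂ c₃ p Ω) ∧
    -- the initial condition
    (∀ Ω : BraidMatrices.MatrixFamily n n,
      BraidMatrices.IsBraidFamily n Λ k c₁ c₂ c₃ n Ω ↔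
        ∀ i ∈ Finset.Icc 1 n, ∀ j ∈ Finset.Icc 1 n,
          Ω i j = BraidMatrices.sInv k i j • (1 : Matrix _ _ ℂ)) ∧
    -- the recursion: the matrices that it yields are braid matrices and, for generic kinematics,
    -- there are no others
    (∀ (p : ℕ) (_ : 3 ≤ p) (hp : p < n)
      (Ωnext : BraidMatrices.MatrixFamily n (p + 1)) (Ω : BraidMatrices.MatrixFamily n p),
      BraidMatrices.IsBraidFamily n Λ k c₁ c₂ c₃ (p + 1) Ωnext →
      BraidMatrices.IsAnsatz n p Ω →
      (BraidMatrices.SatisfiesRecursion n p hp Ωnext Ω →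
        BraidMatrices.IsBraidFamily n Λ k c₁ c₂ c₃ p Ω) ∧
      (BraidMatrices.NonResonant n Λ k → BraidMatrices.IsBraidFamily n Λ k c₁ c₂ c₃ p Ω →
        BraidMatrices.SatisfiesRecursion n p hp Ωnext Ω)) := by
  have hκ : (1 / (Λ : ℂ) ^ 2) ≠ 0 :=
    one_div_ne_zero (pow_ne_zero _ (Complex.ofReal_ne_zero.2 hΛ.ne'))
  obtain ⟨z⟩ := BraidMatrices.nonempty_config n h₁₂ h₁₃ h₂₃
  have hiff := fun {p : ℕ} (hp3 : 3 ≤ p) (hp : p ≤ n) {Ω : BraidMatrices.MatrixFamily n p} =>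
    BraidMatrices.isBraidFamily_iff (Λ := Λ) (c₁ := c₁) (c₂ := c₂) (c₃ := c₃) (Ω := Ω)
      momentum_conservation massless hp3 hp
  refine ⟨fun p hp3 hp => ?_, fun Ω => ⟨fun h => ?_, fun h => ?_⟩,
    fun p hp3 hp Ωnext Ω hnext hΩ => ⟨fun hrec => ?_, fun hnr h => ?_⟩⟩
  · obtain ⟨Ω, h1, h2, -⟩ := BraidMatrices.exists_solution hn momentum_conservation massless
      c₁ c₂ c₃ Λ (n - p) p hp3 (by omega)
    exact ⟨Ω, (hiff hp3 hp).2 ⟨h1, h2⟩⟩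
  · rw [hiff hn le_rfl] at h
    have h1 := BraidMatrices.kinematicFamily_isAnsatz momentum_conservation massless
    intro i hi j hj
    rw [h.1.ext hn h1 (fun i hi j hj => BraidMatrices.eq_of_solvesGMY hκ hn le_rfl
      (BraidMatrices.basisIndependent_self _ _ _ _ _) z h.1 h1 h.2
      (BraidMatrices.kinematicFamily_solvesGMY Λ k) hi hj) hi hj,
      BraidMatrices.sInv_eq massless hi hj, BraidMatrices.kinematicFamily]
  · have h' : ∀ i ∈ Finset.Icc 1 n, ∀ j ∈ Finset.Icc 1 n,
        Ω i j = BraidMatrices.kinematicFamily n k i j := fun i hi j hj => by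
      rw [h i hi j hj, BraidMatrices.sInv_eq massless hi hj, BraidMatrices.kinematicFamily]
    exact (hiff hn le_rfl).2
      ⟨(BraidMatrices.kinematicFamily_isAnsatz momentum_conservation massless).congr h',
        (BraidMatrices.kinematicFamily_solvesGMY Λ k).congr h'⟩
  · rw [hiff (by omega) hp] at hnext
    exact (hiff hp3 hp.le).2 ⟨hΩ, hnext.2.recursion hp3 hp hnext.1 hrec⟩
  · rw [hiff (by omega) hp] at hnext
    rw [hiff hp3 hp.le] at h
    have hr := BraidMatrices.recFamily_satisfiesRecursion hp Ωnext
    have hI := (BraidMatrices.basis_spans_and_independent hn hΛ momentum_conservation massless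
      c₁ c₂ c₃ hnr (n - p) p hp3 (by omega)).2
    intro i hi j hj hij a b
    rw [← hr i hi j hj hij a b, BraidMatrices.eq_of_solvesGMY hκ hp3 hp.le hI z h.1
      (BraidMatrices.recFamily_isAnsatz hp3 hp hnext.1) h.2
      (hnext.2.recursion hp3 hp hnext.1 hr) hi hj]
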